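/- Let $s\in(0,1)$, $d\in\mathbb N$ with $d>2s$, $m>1$, $\gamma\in[0,2s)\cap[0,d-2s]$, $\gamma_0\in[0,\gamma]$, and let $\rho:\mathbb R^d\to\mathbb R$ be a (Lebesgue) measurable weight such that, for some constants $0<c<C$, $c|x|^{-\gamma_0}\le\rho(x)\le C|x|^{-\gamma_0}$ for a.e. $|x|<1$ and $c|x|^{-\gamma}\le\rho(x)\le C|x|^{-\gamma}$ for a.e. $|x|\ge1$. Write $L^1_\rho=L^1(\mathbb R^d;\rho\,\mathrm dx)$. For $\sigma\in(0,1)$ and $\phi\in C_c^\infty(\mathbb R^d)$ put $(-\Delta)^{\sigma}\phi(x)=\mathrm{p.v.}\;C_{d,\sigma}\int_{\mathbb R^d}\frac{\phi(x)-\phi(y)}{|x-y|^{d+2\sigma}}\,\mathrm dy$ with $C_{d,\sigma}=\Big(\int_{\mathbb R^d}\frac{1-\cos\zeta_1}{|\zeta|^{d+2\sigma}}\,\mathrm d\zeta\Big)^{-1}$; let $\dot H^s(\mathbb R^d)$ be the closure of $C_c^\infty(\mathbb R^d)$ with respect to $\|\phi\|_{\dot H^s}^2=\frac{C_{d,s}}2\iint\frac{(\phi(x)-\phi(y))^2}{|x-y|^{d+2s}}\,\mathrm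 dx\,\mathrm dy$, regarded as a space of functions in $L^{2d/(d-2s)}(\mathbb R^d)$ through the Sobolev embedding; for $v\in\dot H^s(\mathbb R^d)$, $(-\Delta)^{s/2}v$ is meant in the sense of distributions. Let $u\ge0$ be a measurable function on $\mathbb R^d\times(0,\infty)$ such that (i) $u\in L^\infty((0,\infty);L^1_\rho(\mathbb R^d))$; (ii) $u^m\in L^2_{\rm loc}((0,\infty);\dot H^s(\mathbb R^d))$; (iii) for all $\varphi\in C_c^\infty(\mathbb R^d\times(0,\infty))$, $$-\int_0^\infty\!\!\int_{\mathbb R^d}u\,\varphi_t\,\rho\,\mathrm dx\,\mathrm dt+\int_0^\infty\!\!\int_{\mathbb R^d}(-\Delta)^{s/2}(u^m)\,(-\Delta)^{s/2}(\varphi)\,\mathrm dx\,\mathrm dt=0;$$ (iv) either $u\in L^\infty(\mathbb R^d\times(\tau,\infty))$ for all $\tau>0$, or $\int_{t_1}^{t_2}u^m(\cdot,\tau)\,\mathrm d\tau\in L^1_\rho(\mathbb R^d)$ for all $t_2>t_1>0$. Then there exists a unique positive (i.e. nonnegative) finite Radon measure $\mu$ on $\mathbb R^d$ which is the initial trace of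 $u$, in the sense that $\operatorname{ess\,lim}_{t\to0^+}\int_{\mathbb R^d}\phi(x)\,u(x,t)\,\rho(x)\,\mathrm dx=\int_{\mathbb R^d}\phi\,\mathrm d\mu$ for all bounded continuous $\phi:\mathbb R^d\to\mathbb R$, with an exceptional null set of times independent of $\phi$. Moreover $\mu(\mathbb R^d)=\int_{\mathbb R^d}u(x,t)\,\rho(x)\,\mathrm dx$ for a.e. $t>0$. -/

import Mathlib

open MeasureTheory Filter Topology Set
open scoped ContDiff ENNReal NNReal BoundedContinuousFunction

noncomputable section

namespace FracPME

/-- The normalising constant `C_{d,σ} = (∫ (1 - cos ζ₁) / |ζ|^{d+2σ} dζ)⁻¹`, for which `(-Δ)^σ`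
has Fourier symbol `|ξ|^{2σ}`. -/
def normConst (d : ℕ) [NeZero d] (σ : ℝ) : ℝ :=
  (∫ ζ : EuclideanSpace ℝ (Fin d), (1 - Real.cos (ζ 0)) / ‖ζ‖ ^ ((d : ℝ) + 2 * σ))⁻¹

/-- `φ ∈ 𝒟(ℝ^d) = C_c^∞(ℝ^d)`. -/
def IsTest {d : ℕ} (φ : EuclideanSpace ℝ (Fin d) → ℝ) : Prop :=
  ContDiff ℝ ∞ φ ∧ HasCompactSupport φ

/-- `φ ∈ C_c^∞(ℝ^d × (0,∞))`. -/
def IsSpaceTimeTest {d : ℕ} (φ : EuclideanSpace ℝ (Fin d) × ℝ → ℝ) : Prop :=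
  ContDiff ℝ ∞ φ ∧ HasCompactSupport φ ∧ tsupport φ ⊆ univ ×ˢ Ioi (0 : ℝ)

/-- The fractional Laplacian `(-Δ)^σ φ (x) = p.v. C_{d,σ} ∫ (φ(x) - φ(y)) / |x - y|^{d+2σ} dy`
(the principal value exists for test functions). -/
def fracLap {d : ℕ} [NeZero d] (σ : ℝ) (φ : EuclideanSpace ℝ (Fin d) → ℝ)
    (x : EuclideanSpace ℝ (Fin d)) : ℝ :=
  limUnder (𝓝[>] (0 : ℝ)) fun ε =>
    normConst d σ * ∫ y in {y | ε < ‖x - y‖}, (φ x - φ y) / ‖x - y‖ ^ ((d : ℝ) + 2 * σ)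

/-- The locally integrable function `g` is `(-Δ)^σ v` in the sense of distributions. -/
def IsDistribFracLap {d : ℕ} [NeZero d] (σ : ℝ) (v g : EuclideanSpace ℝ (Fin d) → ℝ) : Prop :=
  LocallyIntegrable g ∧
    ∀ ψ : EuclideanSpace ℝ (Fin d) → ℝ, IsTest ψ →
      Integrable (fun x => v x * fracLap σ ψ x) ∧
        ∫ x, g x * ψ x = ∫ x, v x * fracLap σ ψ x

/-- The squared norm
`‖v‖²_{Ḣ^s} = (C_{d,s} / 2) ∫∫ (v(x) - v(y))² / |x - y|^{d+2s} dx dy`, with values in `[0,∞]`. -/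
def hdotNormSq {d : ℕ} [NeZero d] (s : ℝ) (v : EuclideanSpace ℝ (Fin d) → ℝ) : ℝ≥0∞ :=
  ENNReal.ofReal (normConst d s / 2) *
    ∫⁻ x, ∫⁻ y, ENNReal.ofReal ((v x - v y) ^ 2 / ‖x - y‖ ^ ((d : ℝ) + 2 * s))

/-- `v ∈ Ḣ^s(ℝ^d)`, the closure of `𝒟(ℝ^d)` with respect to the `Ḣ^s` norm. For `d > 2s` it is
a space of functions through the Sobolev embedding in `L^{2d/(d-2s)}`: the limit of a sequence
of test functions in the `Ḣ^s` norm is identified with its limit in `L^{2d/(d-2s)}`. -/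
def MemHdot {d : ℕ} [NeZero d] (s : ℝ) (v : EuclideanSpace ℝ (Fin d) → ℝ) : Prop :=
  AEStronglyMeasurable v ∧
    ∃ φ : ℕ → EuclideanSpace ℝ (Fin d) → ℝ, (∀ n, IsTest (φ n)) ∧
      Tendsto (fun n => hdotNormSq s (fun x => v x - φ n x)) atTop (𝓝 0) ∧
      Tendsto (fun n => eLpNorm (fun x => v x - φ n x)
        (ENNReal.ofReal (2 * d / (d - 2 * s))) volume) atTop (𝓝 0)

/-- The two-sided power bounds on the weight: `|x|^{-γ₀}` in `B₁`, `|x|^{-γ}` outside `B₁`. -/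
def WeightBounds {d : ℕ} (γ₀ γ : ℝ) (ρ : EuclideanSpace ℝ (Fin d) → ℝ) : Prop :=
  ∃ c C : ℝ, 0 < c ∧ c < C ∧ ∀ᵐ x : EuclideanSpace ℝ (Fin d),
    (‖x‖ < 1 → c * ‖x‖ ^ (-γ₀) ≤ ρ x ∧ ρ x ≤ C * ‖x‖ ^ (-γ₀)) ∧
    (1 ≤ ‖x‖ → c * ‖x‖ ^ (-γ) ≤ ρ x ∧ ρ x ≤ C * ‖x‖ ^ (-γ))

/-- The measure `ρ(x) dx`. -/
def weightMeasure {d : ℕ} (ρ : EuclideanSpace ℝ (Fin d) → ℝ) :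
    Measure (EuclideanSpace ℝ (Fin d)) :=
  volume.withDensity fun x => ENNReal.ofReal (ρ x)

/-- `u ∈ L^∞((0,∞); L¹_ρ(ℝ^d))`. -/
def LinftyL1 {d : ℕ} (ρ : EuclideanSpace ℝ (Fin d) → ℝ)
    (u : EuclideanSpace ℝ (Fin d) → ℝ → ℝ) : Prop :=
  ∃ M : ℝ≥0, ∀ᵐ t ∂(volume.restrict (Ioi (0 : ℝ))),
    AEStronglyMeasurable (fun x => u x t) (weightMeasure ρ) ∧
      ∫⁻ x, ‖u x t‖ₑ ∂(weightMeasure ρ) ≤ M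

/-- `u ∈ L^∞(ℝ^d × (τ,∞))` for every `τ > 0`. -/
def BoundedAwayFromZero {d : ℕ} (u : EuclideanSpace ℝ (Fin d) → ℝ → ℝ) : Prop :=
  ∀ τ : ℝ, 0 < τ → ∃ M : ℝ,
    ∀ᵐ z : EuclideanSpace ℝ (Fin d) × ℝ ∂(volume.restrict (univ ×ˢ Ioi τ)), |u z.1 z.2| ≤ M

/-- `∫_{t₁}^{t₂} u^m(·,τ) dτ ∈ L¹_ρ(ℝ^d)` for all `t₂ > t₁ > 0` (for nonnegative `u`). -/
def PowerTimeIntegrable {d : ℕ} (m : ℝ) (ρ : EuclideanSpace ℝ (Fin d) → ℝ)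
    (u : EuclideanSpace ℝ (Fin d) → ℝ → ℝ) : Prop :=
  ∀ t₁ t₂ : ℝ, 0 < t₁ → t₁ < t₂ →
    ∫⁻ x, (∫⁻ τ in Ioo t₁ t₂, ENNReal.ofReal (u x τ ^ m)) ∂(weightMeasure ρ) < ⊤

/-- `v ∈ L²_loc((0,∞); Ḣ^s(ℝ^d))` (for `v` measurable in space-time). -/
def L2locHdot {d : ℕ} [NeZero d] (s : ℝ) (v : EuclideanSpace ℝ (Fin d) → ℝ → ℝ) : Prop :=
  (∀ᵐ t ∂(volume.restrict (Ioi (0 : ℝ))), MemHdot s (fun x => v x t)) ∧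
    ∀ t₁ t₂ : ℝ, 0 < t₁ → t₁ < t₂ → (∫⁻ t in Ioo t₁ t₂, hdotNormSq s (fun x => v x t)) < ⊤

/-- The weak formulation of `ρ u_t + (-Δ)^s (u^m) = 0` on `ℝ^d × (0,∞)`:
`-∫∫ u φ_t ρ + ∫∫ (-Δ)^{s/2}(u^m) (-Δ)^{s/2}(φ) = 0` for all `φ ∈ C_c^∞(ℝ^d × (0,∞))`.
Here `g` is the (a.e. unique) function `(-Δ)^{s/2}(u^m)`. -/
def WeakFormulation {d : ℕ} [NeZero d] (s m : ℝ) (ρ : EuclideanSpace ℝ (Fin d) → ℝ)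
    (u : EuclideanSpace ℝ (Fin d) → ℝ → ℝ) : Prop :=
  ∃ g : EuclideanSpace ℝ (Fin d) → ℝ → ℝ,
    AEStronglyMeasurable (fun z : EuclideanSpace ℝ (Fin d) × ℝ => g z.1 z.2)
      (volume.restrict (univ ×ˢ Ioi (0 : ℝ))) ∧
    (∀ᵐ t ∂(volume.restrict (Ioi (0 : ℝ))),
      IsDistribFracLap (s / 2) (fun x => u x t ^ m) (fun x => g x t)) ∧
    ∀ φ : EuclideanSpace ℝ (Fin d) × ℝ → ℝ, IsSpaceTimeTest φ →
      -(∫ t in Ioi (0 : ℝ), ∫ x, u x t * deriv (fun τ => φ (x, τ)) t * ρ x) +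
        ∫ t in Ioi (0 : ℝ), ∫ x, g x t * fracLap (s / 2) (fun y => φ (y, t)) x = 0

/-- The nonnegative function `u` solves `ρ u_t + (-Δ)^s (u^m) = 0` weakly, with no prescribed
initial condition and no boundedness requirement. -/
structure IsWeakSolution {d : ℕ} [NeZero d] (s m : ℝ) (ρ : EuclideanSpace ℝ (Fin d) → ℝ)
    (u : EuclideanSpace ℝ (Fin d) → ℝ → ℝ) : Prop where
  measurable : AEStronglyMeasurable (fun z : EuclideanSpace ℝ (Fin d) × ℝ => u z.1 z.2)
    (volume.restrict (univ ×ˢ Ioi (0 : ℝ)))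
  nonneg : ∀ᵐ z : EuclideanSpace ℝ (Fin d) × ℝ ∂(volume.restrict (univ ×ˢ Ioi (0 : ℝ))),
    0 ≤ u z.1 z.2
  linftyL1 : LinftyL1 ρ u
  energy : L2locHdot s (fun x t => u x t ^ m)
  weak : WeakFormulation s m ρ u

/-- `μ = ess lim_{t → 0} ρ u(·,t)` in `σ(ℳ(ℝ^d), C_b(ℝ^d))`: off a null set `N` of times,
`ρ u(·,t)` is integrable and `∫ φ u(·,t) ρ → ∫ φ dμ` as `t → 0⁺` for every `φ ∈ C_b(ℝ^d)`. -/
def IsInitialTrace {d : ℕ} (ρ : EuclideanSpace ℝ (Fin d) → ℝ)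
    (u : EuclideanSpace ℝ (Fin d) → ℝ → ℝ)
    (μ : FiniteMeasure (EuclideanSpace ℝ (Fin d))) : Prop :=
  ∃ N : Set ℝ, volume N = 0 ∧
    (∀ t ∈ Ioi (0 : ℝ) \ N, Integrable (fun x => u x t) (weightMeasure ρ)) ∧
    ∀ φ : EuclideanSpace ℝ (Fin d) →ᵇ ℝ,
      Tendsto (fun t => ∫ x, φ x * u x t ∂(weightMeasure ρ)) (𝓝[Ioi 0 \ N] 0)
        (𝓝 (∫ x, φ x ∂(μ : Measure (EuclideanSpace ℝ (Fin d)))))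

end FracPME

end

namespace FracPME

/-! The proof is a potential argument. Testing the equation with `χ(x) θ(t)` shows that the measures
`λ_t = u(·,t) ρ dx` satisfy `λ_{t₁} - λ_{t₂} = (-Δ)^s V` for almost all `t₁ < t₂`, where `V =
∫_{t₁}^{t₂} u^m dτ ≥ 0`. Either alternative in (iv) makes `V` integrable against `(1 + |x|)^{-γ}`,
and after this step nothing else about the nonlinearity is used.

The Riesz kernel `|x|^{2s-d}` would turn `(-Δ)^s V` back into `V` and give a potential decreasing in
time. A regularised kernel serves instead: for a smooth radially nonincreasing bump `φ` put `k_L(x)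
= ∫_L^∞ r^{-1-d+2s} φ(x/r) dr`, which for `L = 0` is a multiple of the Riesz kernel. By scaling,
`(-Δ)^s k_L(x) = ∫_L^∞ r^{-1-d} ((-Δ)^s φ)(x/r) dr`, and polar coordinates turn this into a multiple
of `|x|^{-d}` times the mass of `(-Δ)^s φ` in the ball of radius `|x|/L`. That mass is positive by
rearrangement: translating `φ` can only lower its mass in a centred ball. The quantitative form
`potentialSource_ge` bounds `(-Δ)^s k_L` below by a multiple of `(1 + |x|/L)^{-(d+2s)}`, which is
exactly the decay rate of `(-Δ)^s χ` for a test function `χ`.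

Two consequences follow. The potential `∫ k_L dλ_t` (`bumpPotential`) is nonincreasing in time, and
it is bounded by the mass, so it converges as `t → 0⁺`. Moreover the increment of `∫ χ dλ_t` is at
most a constant times that of the potential with `L = 1`, so it also converges
(`IsTest.exists_abs_integral_sub_le`). Density of test functions, bounded masses and the Riesz
representation theorem give a vague limit `μ`.

It remains to exclude loss of mass. Testing with `φ(x/r)` gives an error of order `r^{γ-2s} → 0`, so
the mass is conserved for positive times, and the mass of `μ` is at most that mass. Conversely, with
`J_L = ∫_L^∞ r^{-1-d+2s} dr`, monotonicity of the potential gives `J_L ∫ φ(x/L) dλ_t ≤ ∫ k_L dλ_t ≤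
∫ k_L dμ ≤ J_L φ(0) μ(ℝ^d)`; dividing by `J_L` and letting `L → ∞` yields the reverse inequality.
Vague convergence without loss of mass is convergence against bounded continuous functions. -/

/-- Euclidean space of dimension `d`. -/
abbrev Sp (d : ℕ) := EuclideanSpace ℝ (Fin d)

/-! ### Pointwise theory of the fractional Laplacian of test functions -/

section SecondDifference

variable {d : ℕ}

/-- The symmetric second difference of `φ` at `x` in direction `z`, with the sign of `-Δ`. -/
def secondDiff (φ : Sp d → ℝ) (x z : Sp d) : ℝ := 2 * φ x - φ (x + z) - φ (x - z)

/-- The fractional Laplacian without normalising constant, as an absolutely convergent integral of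
second differences. -/
noncomputable def sdLap (σ : ℝ) (φ : Sp d → ℝ) (x : Sp d) : ℝ :=
  ∫ z, secondDiff φ x z / (2 * ‖z‖ ^ ((d : ℝ) + 2 * σ))

/-- The Lévy-type majorant `min 1 |z|² / |z|^{d+2σ}`. -/
noncomputable def levyMajorant (σ : ℝ) (z : Sp d) : ℝ :=
  min 1 (‖z‖ ^ 2) / ‖z‖ ^ ((d : ℝ) + 2 * σ)

lemma levyMajorant_nonneg (σ : ℝ) (z : Sp d) : 0 ≤ levyMajorant σ z := by
  unfold levyMajorant; positivity

/-- In polar coordinates the density is `r^{1-2σ}` on `(0,1]`, integrable because `σ < 1`, and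
`r^{-1-2σ}` beyond 1, integrable because `σ > 0`. -/
lemma integrable_levyMajorant [NeZero d] {σ : ℝ} (h0 : 0 < σ) (h1 : σ < 1) :
    Integrable (levyMajorant (d := d) σ) := by
  have hd : 1 ≤ d := Nat.one_le_iff_ne_zero.mpr (NeZero.ne d)
  have key := integrable_fun_norm_addHaar (volume : Measure (Sp d))
    (f := fun y : ℝ => min 1 (y ^ 2) / y ^ ((d : ℝ) + 2 * σ))
  refine key.2 ?_
  rw [finrank_euclideanSpace_fin, ← Ioc_union_Ioi_eq_Ioi zero_le_one]
  have hpow : ∀ y : ℝ, 0 < y → y ^ (d - 1) = y ^ ((d : ℝ) - 1) := fun y hy => by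
    rw [← Real.rpow_natCast, Nat.cast_sub hd, Nat.cast_one]
  refine IntegrableOn.union ?_ ?_
  · have : IntegrableOn (fun y : ℝ => y ^ (1 - 2 * σ)) (Ioc 0 1) := by
      rw [← intervalIntegrable_iff_integrableOn_Ioc_of_le zero_le_one]
      exact intervalIntegral.intervalIntegrable_rpow' (by linarith)
    refine this.congr_fun (fun y hy => ?_) measurableSet_Ioc
    have hy2 : y ^ 2 ≤ 1 := pow_le_one₀ hy.1.le hy.2
    simp only [smul_eq_mul]
    rw [min_eq_right hy2, hpow y hy.1, ← Real.rpow_natCast y 2, ← Real.rpow_sub hy.1,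
      ← Real.rpow_add hy.1]
    congr 1; push_cast; ring
  · have : IntegrableOn (fun y : ℝ => y ^ (-1 - 2 * σ)) (Ioi 1) :=
      (integrableOn_Ioi_rpow_iff one_pos).2 (by linarith)
    refine this.congr_fun (fun y hy => ?_) measurableSet_Ioi
    have hy1 : (1 : ℝ) < y := hy
    have hy0 : 0 < y := by linarith
    have hy2 : 1 ≤ y ^ 2 := one_le_pow₀ hy1.le
    simp only [smul_eq_mul]
    rw [min_eq_left hy2, hpow y hy0, one_div, ← Real.rpow_neg hy0.le, ← Real.rpow_add hy0]
    congr 1; ring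

lemma IsTest.bounded {φ : Sp d → ℝ} (h : IsTest φ) : ∃ C, 0 ≤ C ∧ ∀ x, |φ x| ≤ C := by
  obtain ⟨C, hC⟩ := h.1.continuous.bounded_above_of_compact_support h.2
  exact ⟨C, (norm_nonneg _).trans (hC 0), hC⟩

lemma IsTest.integrable {φ : Sp d → ℝ} (h : IsTest φ) : Integrable φ :=
  h.1.continuous.integrable_of_hasCompactSupport h.2

/-- A test function vanishes outside some ball of radius at least one. -/
lemma IsTest.exists_radius {φ : Sp d → ℝ} (h : IsTest φ) :
    ∃ R, 1 ≤ R ∧ ∀ x, R < ‖x‖ → φ x = 0 := by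
  obtain ⟨R, hR⟩ := h.2.isCompact.isBounded.subset_closedBall 0
  refine ⟨max R 1, le_max_right _ _, fun x hx => ?_⟩
  by_contra hne
  have := hR (subset_tsupport _ hne)
  rw [mem_closedBall_zero_iff] at this
  exact absurd (this.trans (le_max_left R 1)) (not_le.2 hx)

/-- Mean value inequality on `[0,1]` for `t ↦ φ(x + tz) + φ(x - tz)`: its derivative compares the
Lipschitz map `fderiv ℝ φ` at two points at distance `2t|z|`, whence the constant `2K`. -/
lemma IsTest.abs_secondDiff_le_sq {φ : Sp d → ℝ} (h : IsTest φ) :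
    ∃ C, 0 ≤ C ∧ ∀ x z, |secondDiff φ x z| ≤ C * ‖z‖ ^ 2 := by
  have hd1 : ContDiff ℝ 1 (fderiv ℝ φ) := h.1.fderiv_right (m := 1) (WithTop.coe_le_coe.2 le_top)
  obtain ⟨K, hK⟩ := (hd1).lipschitzWith_of_hasCompactSupport (h.2.fderiv (𝕜 := ℝ)) (by simp)
  refine ⟨2 * K, by positivity, fun x z => ?_⟩
  have hdiff : Differentiable ℝ φ := h.1.differentiable (by simp)
  let f : ℝ → ℝ := fun t => φ (x + t • z) + φ (x - t • z)
  have hf : ∀ t : ℝ, HasDerivAt f (fderiv ℝ φ (x + t • z) z - fderiv ℝ φ (x - t • z) z) t := by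
    intro t
    have h1 : HasDerivAt (fun t : ℝ => x + t • z) z t := by
      simpa using ((hasDerivAt_id t).smul_const z).const_add x
    have h2 : HasDerivAt (fun t : ℝ => x - t • z) (-z) t := by
      simpa using ((hasDerivAt_id t).smul_const z).const_sub x
    have := ((hdiff (x + t • z)).hasFDerivAt.comp_hasDerivAt t h1).add
      ((hdiff (x - t • z)).hasFDerivAt.comp_hasDerivAt t h2)
    refine this.congr_deriv ?_
    simp only [map_neg, ← sub_eq_add_neg]
  have hb : ∀ t ∈ Ico (0 : ℝ) 1,
      ‖fderiv ℝ φ (x + t • z) z - fderiv ℝ φ (x - t • z) z‖ ≤ 2 * K * ‖z‖ ^ 2 := by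
    intro t ht
    rw [← sub_apply]
    have hl := hK.dist_le_mul (x + t • z) (x - t • z)
    rw [dist_eq_norm, dist_eq_norm, show x + t • z - (x - t • z) = (2 * t) • z by module,
      norm_smul] at hl
    have ht2 : ‖2 * t‖ ≤ 2 := by
      rw [Real.norm_eq_abs, abs_of_nonneg (by linarith [ht.1])]; linarith [ht.2]
    calc _ ≤ ‖fderiv ℝ φ (x + t • z) - fderiv ℝ φ (x - t • z)‖ * ‖z‖ :=
          ContinuousLinearMap.le_opNorm _ _
      _ ≤ (K * (2 * ‖z‖)) * ‖z‖ := by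
          gcongr
          exact hl.trans (by gcongr)
      _ = _ := by ring
  have := norm_image_sub_le_of_norm_deriv_le_segment_01'
    (fun t _ => (hf t).hasDerivWithinAt) hb
  simp only [f, one_smul, zero_smul, add_zero, sub_zero] at this
  rw [Real.norm_eq_abs, abs_sub_comm] at this
  calc |secondDiff φ x z| = |φ x + φ x - (φ (x + z) + φ (x - z))| := by
        unfold secondDiff; congr 1; ring
    _ ≤ _ := this

lemma IsTest.abs_secondDiff_le {φ : Sp d → ℝ} (h : IsTest φ) :
    ∃ C, 0 ≤ C ∧ ∀ x z, |secondDiff φ x z| ≤ C * min 1 (‖z‖ ^ 2) := by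
  obtain ⟨C, hC0, hC⟩ := h.abs_secondDiff_le_sq
  obtain ⟨B, hB0, hB⟩ := h.bounded
  refine ⟨max C (4 * B), by positivity, fun x z => ?_⟩
  rcases min_cases 1 (‖z‖ ^ 2) with ⟨h1, _⟩ | ⟨h1, _⟩ <;> rw [h1]
  · have : |secondDiff φ x z| ≤ 4 * B := by
      have h1 := abs_le.1 (hB x)
      have h2 := abs_le.1 (hB (x + z))
      have h3 := abs_le.1 (hB (x - z))
      unfold secondDiff
      exact abs_le.2 ⟨by linarith, by linarith⟩
    rw [mul_one]; exact this.trans (le_max_right _ _)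
  · exact (hC x z).trans (by gcongr; exact le_max_left _ _)

lemma measurable_kernel (σ : ℝ) : Measurable fun z : Sp d => ‖z‖ ^ ((d : ℝ) + 2 * σ) :=
  measurable_norm.pow_const _

lemma continuous_secondDiff {φ : Sp d → ℝ} (h : Continuous φ) :
    Continuous fun p : Sp d × Sp d => secondDiff φ p.1 p.2 := by
  unfold secondDiff; fun_prop

lemma measurable_secondDiff_div {φ : Sp d → ℝ} (h : Continuous φ) (σ : ℝ) :
    Measurable fun p : Sp d × Sp d =>
      secondDiff φ p.1 p.2 / (2 * ‖p.2‖ ^ ((d : ℝ) + 2 * σ)) :=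
  (continuous_secondDiff h).measurable.div
    (((measurable_kernel σ).comp measurable_snd).const_mul 2)

lemma measurable_secondDiff_div_right {φ : Sp d → ℝ} (h : Continuous φ) (σ : ℝ) (x : Sp d) :
    Measurable fun z : Sp d => secondDiff φ x z / (2 * ‖z‖ ^ ((d : ℝ) + 2 * σ)) :=
  (measurable_secondDiff_div h σ).comp measurable_prodMk_left

lemma abs_secondDiff_div_le {φ : Sp d → ℝ} {C : ℝ} (hC0 : 0 ≤ C)
    (hC : ∀ x z, |secondDiff φ x z| ≤ C * min 1 (‖z‖ ^ 2)) (σ : ℝ) (x z : Sp d) :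
    ‖secondDiff φ x z / (2 * ‖z‖ ^ ((d : ℝ) + 2 * σ))‖ ≤ C * levyMajorant σ z := by
  have hp : 0 ≤ ‖z‖ ^ ((d : ℝ) + 2 * σ) := by positivity
  rw [norm_div, Real.norm_eq_abs, Real.norm_of_nonneg (by positivity)]
  calc |secondDiff φ x z| / (2 * ‖z‖ ^ ((d : ℝ) + 2 * σ))
      ≤ C * min 1 (‖z‖ ^ 2) / (2 * ‖z‖ ^ ((d : ℝ) + 2 * σ)) := by gcongr; exact hC x z
    _ = C * levyMajorant σ z / 2 := by unfold levyMajorant; rw [mul_comm 2, ← div_div]; ring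
    _ ≤ C * levyMajorant σ z :=
        half_le_self (mul_nonneg hC0 (levyMajorant_nonneg σ z))

variable [NeZero d]

lemma IsTest.integrable_secondDiff_div {φ : Sp d → ℝ} (h : IsTest φ) {σ : ℝ} (h0 : 0 < σ)
    (h1 : σ < 1) (x : Sp d) :
    Integrable fun z => secondDiff φ x z / (2 * ‖z‖ ^ ((d : ℝ) + 2 * σ)) := by
  obtain ⟨C, hC0, hC⟩ := h.abs_secondDiff_le
  exact ((integrable_levyMajorant h0 h1).const_mul C).mono'
    (measurable_secondDiff_div_right h.1.continuous σ x).aestronglyMeasurable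
    (ae_of_all _ fun z => abs_secondDiff_div_le hC0 hC σ x z)

lemma IsTest.continuous_sdLap {φ : Sp d → ℝ} (h : IsTest φ) {σ : ℝ} (h0 : 0 < σ)
    (h1 : σ < 1) : Continuous (sdLap σ φ) := by
  obtain ⟨C, hC0, hC⟩ := h.abs_secondDiff_le
  refine continuous_of_dominated (bound := fun z => C * levyMajorant σ z) (fun x => ?_)
    (fun x => ae_of_all _ fun z => abs_secondDiff_div_le hC0 hC σ x z)
    ((integrable_levyMajorant h0 h1).const_mul C) (ae_of_all _ fun z => ?_)
  · exact (measurable_secondDiff_div_right h.1.continuous σ x).aestronglyMeasurable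
  · have := h.1.continuous
    unfold secondDiff
    fun_prop

/-- On the complement of the support the fractional Laplacian is an integral against the kernel. -/
lemma IsTest.abs_sdLap_le_of_far {φ : Sp d → ℝ} (h : IsTest φ) {σ : ℝ} (h0 : 0 < σ)
    {R : ℝ} (hR1 : 1 ≤ R) (hR : ∀ x, R < ‖x‖ → φ x = 0) {x : Sp d} (hx : 2 * R < ‖x‖) :
    |sdLap σ φ x| ≤ (‖x‖ / 2) ^ (-((d : ℝ) + 2 * σ)) * ∫ y, |φ y| := by
  have hα : 0 < (d : ℝ) + 2 * σ := by positivity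
  have hint1 : Integrable fun z => |φ (x + z)| := h.integrable.abs.comp_add_left x
  have hint2 : Integrable fun z => |φ (x - z)| := h.integrable.abs.comp_sub_left x
  have hx2 : 0 < ‖x‖ / 2 := by linarith
  have hφx : φ x = 0 := hR x (by linarith)
  have hk : ∀ z : Sp d, ‖x‖ / 2 ≤ ‖z‖ → (‖z‖ ^ ((d : ℝ) + 2 * σ))⁻¹ ≤
      (‖x‖ / 2) ^ (-((d : ℝ) + 2 * σ)) := by
    intro z hz
    rw [Real.rpow_neg hx2.le]
    exact inv_anti₀ (by positivity) (Real.rpow_le_rpow hx2.le hz hα.le)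
  -- The point `x + z` must lie in the ball of radius `R < |x|/2`, so `z` is at least `|x|/2` away
  -- from the singularity and the kernel is at most `A`.
  have hz1 : ∀ z, φ (x + z) ≠ 0 → ‖x‖ / 2 ≤ ‖z‖ := by
    intro z hz
    have : ‖x + z‖ ≤ R := not_lt.1 fun hlt => hz (hR _ hlt)
    have h3 : ‖x‖ - ‖z‖ ≤ ‖x + z‖ := by
      have := norm_sub_norm_le x (-z); rwa [norm_neg, sub_neg_eq_add] at this
    linarith
  have hz2 : ∀ z, φ (x - z) ≠ 0 → ‖x‖ / 2 ≤ ‖z‖ := by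
    intro z hz
    have := hz1 (-z) (by rwa [← sub_eq_add_neg])
    rwa [norm_neg] at this
  set A := (‖x‖ / 2) ^ (-((d : ℝ) + 2 * σ)) with hA
  have hA0 : 0 ≤ A := by positivity
  have hpt : ∀ z, ‖secondDiff φ x z / (2 * ‖z‖ ^ ((d : ℝ) + 2 * σ))‖ ≤
      A / 2 * |φ (x + z)| + A / 2 * |φ (x - z)| := by
    intro z
    have e : secondDiff φ x z / (2 * ‖z‖ ^ ((d : ℝ) + 2 * σ)) =
        -(φ (x + z) * (‖z‖ ^ ((d : ℝ) + 2 * σ))⁻¹) / 2 +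
          -(φ (x - z) * (‖z‖ ^ ((d : ℝ) + 2 * σ))⁻¹) / 2 := by
      unfold secondDiff; rw [hφx, div_eq_mul_inv, mul_inv]; ring
    have hk0 : 0 ≤ (‖z‖ ^ ((d : ℝ) + 2 * σ))⁻¹ := by positivity
    have q1 : |φ (x + z)| * (‖z‖ ^ ((d : ℝ) + 2 * σ))⁻¹ ≤ A * |φ (x + z)| := by
      by_cases hz : φ (x + z) = 0
      · simp [hz]
      · rw [mul_comm]; gcongr; exact hk z (hz1 z hz)
    have q2 : |φ (x - z)| * (‖z‖ ^ ((d : ℝ) + 2 * σ))⁻¹ ≤ A * |φ (x - z)| := by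
      by_cases hz : φ (x - z) = 0
      · simp [hz]
      · rw [mul_comm]; gcongr; exact hk z (hz2 z hz)
    rw [e]
    refine (norm_add_le _ _).trans ?_
    rw [norm_div, norm_div, norm_neg, norm_neg, norm_mul, norm_mul, Real.norm_of_nonneg hk0, Real.norm_ofNat,
      Real.norm_eq_abs, Real.norm_eq_abs]
    linarith
  unfold sdLap
  refine (norm_integral_le_of_norm_le ((hint1.const_mul (A / 2)).add (hint2.const_mul (A / 2)))
    (ae_of_all _ hpt)).trans (le_of_eq ?_)
  rw [integral_add' (hint1.const_mul (A / 2)) (hint2.const_mul (A / 2)), integral_const_mul,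
    integral_const_mul, integral_add_left_eq_self (fun y => |φ y|) x,
    integral_sub_left_eq_self (fun y => |φ y|) volume x]
  ring

/-- Bounded by the Lévy majorant near the support, and by the kernel at distance `|x|/2` far from
it. The exact rate `d + 2σ` matters: for `σ = s` it is the rate of the lower bound in
`potentialSource_ge`. -/
lemma IsTest.abs_sdLap_le {φ : Sp d → ℝ} (h : IsTest φ) {σ : ℝ} (h0 : 0 < σ) (h1 : σ < 1) :
    ∃ C, 0 ≤ C ∧ ∀ x, |sdLap σ φ x| ≤ C * (1 + ‖x‖) ^ (-((d : ℝ) + 2 * σ)) := by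
  obtain ⟨C, hC0, hC⟩ := h.abs_secondDiff_le
  obtain ⟨R, hR1, hR⟩ := h.exists_radius
  have hα : 0 < (d : ℝ) + 2 * σ := by positivity
  set α := (d : ℝ) + 2 * σ with hαdef
  set B := C * ∫ z : Sp d, levyMajorant σ z with hB
  have hbd : ∀ x, |sdLap σ φ x| ≤ B := by
    intro x
    unfold sdLap
    refine (norm_integral_le_of_norm_le ((integrable_levyMajorant h0 h1).const_mul C)
      (ae_of_all _ fun z => abs_secondDiff_div_le hC0 hC σ x z)).trans (le_of_eq ?_)
    rw [integral_const_mul]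
  have hB0 : 0 ≤ B := (abs_nonneg _).trans (hbd 0)
  have hI0 : 0 ≤ ∫ y, |φ y| := integral_nonneg fun _ => abs_nonneg _
  refine ⟨B * (1 + 2 * R) ^ α + 4 ^ α * ∫ y, |φ y|, by positivity, fun x => ?_⟩
  have hp : 0 < (1 + ‖x‖) ^ (-α) := by positivity
  rcases le_or_gt ‖x‖ (2 * R) with hx | hx
  · calc |sdLap σ φ x| ≤ B := hbd x
      _ = B * (1 + ‖x‖) ^ α * (1 + ‖x‖) ^ (-α) := by
          rw [mul_assoc, ← Real.rpow_add (by positivity), add_neg_cancel, Real.rpow_zero, mul_one]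
      _ ≤ (B * (1 + 2 * R) ^ α + 4 ^ α * ∫ y, |φ y|) * (1 + ‖x‖) ^ (-α) := by
          gcongr
          have : B * (1 + ‖x‖) ^ α ≤ B * (1 + 2 * R) ^ α := by gcongr
          have : 0 ≤ 4 ^ α * ∫ y, |φ y| := by positivity
          linarith
  · have h4 : (‖x‖ / 2) ^ (-α) ≤ 4 ^ α * (1 + ‖x‖) ^ (-α) := by
      -- The radius was taken at least 1 for this: `|x| > 2R` gives `1 + |x| ≤ 2|x|`.
      have : (1 + ‖x‖) / 4 ≤ ‖x‖ / 2 := by linarith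
      calc (‖x‖ / 2) ^ (-α) ≤ ((1 + ‖x‖) / 4) ^ (-α) :=
            Real.rpow_le_rpow_of_nonpos (by positivity) this (by linarith)
        _ = _ := by
            rw [Real.div_rpow (by positivity) (by norm_num), Real.rpow_neg (by norm_num : (0 : ℝ) ≤ 4),
              div_inv_eq_mul, mul_comm]
    calc |sdLap σ φ x| ≤ (‖x‖ / 2) ^ (-α) * ∫ y, |φ y| := h.abs_sdLap_le_of_far h0 hR1 hR hx
      _ ≤ 4 ^ α * (1 + ‖x‖) ^ (-α) * ∫ y, |φ y| := by gcongr
      _ = (4 ^ α * ∫ y, |φ y|) * (1 + ‖x‖) ^ (-α) := by ring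
      _ ≤ _ := by
          gcongr
          have : 0 ≤ B * (1 + 2 * R) ^ α := by positivity
          linarith

lemma IsTest.integrable_sdLap {φ : Sp d → ℝ} (h : IsTest φ) {σ : ℝ} (h0 : 0 < σ) (h1 : σ < 1) :
    Integrable (sdLap σ φ) := by
  obtain ⟨C, -, hC⟩ := h.abs_sdLap_le h0 h1
  refine Integrable.mono' ((integrable_one_add_norm (E := Sp d) (r := (d : ℝ) + 2 * σ) ?_).const_mul C)
    (h.continuous_sdLap h0 h1).aestronglyMeasurable (ae_of_all _ hC)
  rw [finrank_euclideanSpace_fin]; linarith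

lemma IsTest.bounded_sdLap {φ : Sp d → ℝ} (h : IsTest φ) {σ : ℝ} (h0 : 0 < σ) (h1 : σ < 1) :
    ∃ C, 0 ≤ C ∧ ∀ x, |sdLap σ φ x| ≤ C := by
  obtain ⟨C, hC0, hC⟩ := h.abs_sdLap_le h0 h1
  refine ⟨C, hC0, fun x => (hC x).trans (mul_le_of_le_one_right hC0 ?_)⟩
  exact Real.rpow_le_one_of_one_le_of_nonpos (by linarith [norm_nonneg x])
    (by have : (0 : ℝ) ≤ d := Nat.cast_nonneg d
        linarith)

/-- The principal value defining `fracLap` converges on test functions. -/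
lemma IsTest.fracLap_eq {φ : Sp d → ℝ} (h : IsTest φ) {σ : ℝ} (h0 : 0 < σ) (h1 : σ < 1)
    (x : Sp d) : fracLap σ φ x = normConst d σ * sdLap σ φ x := by
  have hα : 0 < (d : ℝ) + 2 * σ := by positivity
  -- The truncated domain is symmetric, so averaging the integrand over `z` and `-z` turns the first
  -- difference into half a second difference. The truncation makes the two halves integrable
  -- separately.
  have htr : ∀ ε : ℝ, 0 < ε →
      ∫ y in {y | ε < ‖x - y‖}, (φ x - φ y) / ‖x - y‖ ^ ((d : ℝ) + 2 * σ) =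
      ∫ z in {z | ε < ‖z‖}, secondDiff φ x z / (2 * ‖z‖ ^ ((d : ℝ) + 2 * σ)) := by
    intro ε hε
    have hm : MeasurableSet {z : Sp d | ε < ‖z‖} := measurableSet_lt measurable_const measurable_norm
    have hmx : MeasurableSet {y : Sp d | ε < ‖x - y‖} :=
      measurableSet_lt measurable_const (by fun_prop)
    let k : Sp d → ℝ := fun z => {z : Sp d | ε < ‖z‖}.indicator
      (fun z => (φ x - φ (x - z)) / ‖z‖ ^ ((d : ℝ) + 2 * σ)) z
    have e1 : ∫ y in {y | ε < ‖x - y‖}, (φ x - φ y) / ‖x - y‖ ^ ((d : ℝ) + 2 * σ) = ∫ z, k z := by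
      rw [← integral_indicator hmx, ← integral_sub_left_eq_self k volume x]
      congr 1; ext y
      simp only [k, indicator_apply, mem_ofPred_eq, sub_sub_cancel]
    obtain ⟨B, hB0, hB⟩ := h.bounded
    have hki : Integrable k := by
      have hmin : 0 < min 1 (ε ^ 2) := by positivity
      refine ((integrable_levyMajorant h0 h1).const_mul (2 * B / min 1 (ε ^ 2))).mono' ?_
        (ae_of_all _ fun z => ?_)
      · refine (Measurable.indicator ?_ hm).aestronglyMeasurable
        have := h.1.continuous
        exact Measurable.div (by fun_prop) (measurable_kernel σ)
      · simp only [k, indicator_apply, mem_ofPred_eq]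
        split_ifs with hz
        · have hp : 0 < ‖z‖ ^ ((d : ℝ) + 2 * σ) := Real.rpow_pos_of_pos (hε.trans hz) _
          rw [norm_div, Real.norm_of_nonneg hp.le, Real.norm_eq_abs]
          unfold levyMajorant
          rw [← mul_div_assoc]
          gcongr
          have h2 : |φ x - φ (x - z)| ≤ 2 * B := by
            have := abs_le.1 (hB x); have := abs_le.1 (hB (x - z))
            exact abs_le.2 ⟨by linarith, by linarith⟩
          refine h2.trans ?_
          rw [div_mul_eq_mul_div, le_div_iff₀ hmin]
          gcongr
        · rw [norm_zero]
          exact mul_nonneg (by positivity) (levyMajorant_nonneg σ z)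
    have e2 : ∫ z, k z = ∫ z, (k z + k (-z)) / 2 := by
      rw [integral_div, integral_add hki hki.comp_neg, integral_neg_eq_self k volume]; ring
    rw [e1, e2, ← integral_indicator hm]
    congr 1; ext z
    simp only [k, indicator_apply, mem_ofPred_eq, norm_neg, sub_neg_eq_add]
    split_ifs
    · unfold secondDiff; rw [← add_div, div_div, mul_comm _ (2 : ℝ)]; congr 1; ring
    · simp
  have hlim : Tendsto (fun ε : ℝ =>
      ∫ z in {z | ε < ‖z‖}, secondDiff φ x z / (2 * ‖z‖ ^ ((d : ℝ) + 2 * σ))) (𝓝[>] 0)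
      (𝓝 (sdLap σ φ x)) := by
    have hi := h.integrable_secondDiff_div h0 h1 x
    simp_rw [← integral_indicator (measurableSet_lt measurable_const measurable_norm :
      MeasurableSet {z : Sp d | _ < ‖z‖})]
    refine tendsto_integral_filter_of_dominated_convergence
      (fun z => ‖secondDiff φ x z / (2 * ‖z‖ ^ ((d : ℝ) + 2 * σ))‖) ?_ ?_ hi.norm ?_
    · exact Eventually.of_forall fun ε => hi.aestronglyMeasurable.indicator
        (measurableSet_lt measurable_const measurable_norm)
    · exact Eventually.of_forall fun ε => ae_of_all _ fun z => norm_indicator_le_norm_self _ _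
    · refine ae_of_all _ fun z => ?_
      by_cases hz : z = 0
      · subst hz
        simp [indicator_apply, secondDiff, two_mul]
      · have hz' : 0 < ‖z‖ := norm_pos_iff.2 hz
        refine tendsto_const_nhds.congr' ?_
        filter_upwards [mem_nhdsWithin_of_mem_nhds (Iio_mem_nhds hz')] with ε hε
        rw [indicator_of_mem]; exact hε
  unfold fracLap
  refine Tendsto.limUnder_eq ?_
  refine (hlim.const_mul (normConst d σ)).congr' ?_
  filter_upwards [self_mem_nhdsWithin] with ε hε
  rw [htr ε hε]

end SecondDifference

/-! ### Fourier symbol, symmetry and composition of fractional Laplacians -/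

section Fourier

open scoped FourierTransform RealInnerProductSpace

variable {d : ℕ}

/-- Any two vectors of the same norm are exchanged by a linear isometry. -/
lemma exists_isometry_map_eq {x y : Sp d} (h : ‖x‖ = ‖y‖) :
    ∃ A : Sp d ≃ₗᵢ[ℝ] Sp d, A x = y :=
  ⟨_, Submodule.reflection_sub h⟩

lemma integral_comp_isometry (A : Sp d ≃ₗᵢ[ℝ] Sp d) (f : Sp d → ℝ) :
    ∫ x, f (A x) = ∫ x, f x :=
  A.measurePreserving.integral_comp A.toHomeomorph.measurableEmbedding f

variable [NeZero d]

/-- For `|z| ≤ 1` the second difference lives in a fixed ball of radius `R + 1`, so the quadratic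
pointwise bound integrates; for larger `z` four times the `L¹` norm of `φ` suffices. -/
lemma IsTest.integral_abs_secondDiff_le {φ : Sp d → ℝ} (h : IsTest φ) :
    ∃ C, 0 ≤ C ∧ ∀ z, ∫ x, |secondDiff φ x z| ≤ C * min 1 (‖z‖ ^ 2) := by
  obtain ⟨C, hC0, hC⟩ := h.abs_secondDiff_le_sq
  obtain ⟨R, hR1, hR⟩ := h.exists_radius
  set V := (volume : Measure (Sp d)).real (Metric.closedBall 0 (R + 1)) with hV
  have hi := h.integrable
  have hI0 : 0 ≤ ∫ y, |φ y| := integral_nonneg fun _ => abs_nonneg _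
  refine ⟨C * V + 4 * ∫ x, |φ x|, by positivity, fun z => ?_⟩
  rcases min_cases 1 (‖z‖ ^ 2) with ⟨h1, h2⟩ | ⟨h1, h2⟩ <;> rw [h1]
  · have i1 : Integrable fun x => |φ (x + z)| := hi.abs.comp_add_right z
    have i2 : Integrable fun x => |φ (x - z)| := hi.abs.comp_sub_right z
    have : ∫ x, |secondDiff φ x z| ≤ ∫ x, (2 * |φ x| + |φ (x + z)| + |φ (x - z)|) := by
      refine integral_mono_of_nonneg (ae_of_all _ fun _ => abs_nonneg _)
        (((hi.abs.const_mul 2).add i1).add i2) (ae_of_all _ fun x => ?_)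
      unfold secondDiff
      refine (abs_sub _ _).trans (add_le_add ((abs_sub _ _).trans ?_) le_rfl)
      rw [abs_mul, abs_two]
    have i12 : Integrable fun x => 2 * |φ x| + |φ (x + z)| := (hi.abs.const_mul 2).add i1
    rw [integral_add i12 i2, integral_add (hi.abs.const_mul 2) i1,
      integral_const_mul, integral_add_right_eq_self (fun y => |φ y|) z,
      integral_sub_right_eq_self (fun y => |φ y|) z] at this
    have : 0 ≤ C * V := by positivity
    linarith
  · have hz1 : ‖z‖ ≤ 1 := by
      by_contra hlt
      exact absurd (one_le_pow₀ (n := 2) (not_le.1 hlt).le) (not_le.2 h2)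
    have : ∫ x, |secondDiff φ x z| ≤
        ∫ x, (Metric.closedBall (0 : Sp d) (R + 1)).indicator (fun _ => C * ‖z‖ ^ 2) x := by
      refine integral_mono_of_nonneg (ae_of_all _ fun _ => abs_nonneg _) ?_
        (ae_of_all _ fun x => ?_)
      · exact (integrable_indicator_iff measurableSet_closedBall).2
          (integrableOn_const (measure_closedBall_lt_top).ne)
      · by_cases hx : x ∈ Metric.closedBall (0 : Sp d) (R + 1)
        · rw [indicator_of_mem hx]; exact hC x z
        · rw [indicator_of_notMem hx]
          rw [mem_closedBall_zero_iff, not_le] at hx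
          have a1 : φ x = 0 := hR _ (by linarith)
          have a2 : φ (x + z) = 0 := hR _ (by
            have := norm_sub_norm_le x (-z); rw [norm_neg, sub_neg_eq_add] at this; linarith)
          have a3 : φ (x - z) = 0 := hR _ (by have := norm_sub_norm_le x z; linarith)
          simp [secondDiff, a1, a2, a3]
    rw [integral_indicator measurableSet_closedBall, setIntegral_const, smul_eq_mul] at this
    calc _ ≤ V * (C * ‖z‖ ^ 2) := this
      _ = C * V * ‖z‖ ^ 2 := by ring
      _ ≤ _ := by gcongr; linarith

/-- This licenses Fubini in `x` and `z`, for the Fourier symbol, for the Gagliardo seminorm and for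
masses in balls. -/
lemma IsTest.integrable_prod_secondDiff_div {φ : Sp d → ℝ} (h : IsTest φ) {σ : ℝ} (h0 : 0 < σ)
    (h1 : σ < 1) :
    Integrable (fun p : Sp d × Sp d =>
      secondDiff φ p.1 p.2 / (2 * ‖p.2‖ ^ ((d : ℝ) + 2 * σ))) (volume.prod volume) := by
  obtain ⟨C, hC0, hC⟩ := h.integral_abs_secondDiff_le
  have hi := h.integrable
  have hm := (measurable_secondDiff_div h.1.continuous σ).aestronglyMeasurable
    (μ := (volume : Measure (Sp d)).prod volume)
  refine (integrable_prod_iff' hm).2 ⟨ae_of_all _ fun z => ?_, ?_⟩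
  · have : Integrable fun x => secondDiff φ x z :=
      ((hi.const_mul 2).sub (hi.comp_add_right z)).sub (hi.comp_sub_right z)
    exact this.div_const (2 * ‖z‖ ^ ((d : ℝ) + 2 * σ))
  · refine ((integrable_levyMajorant (d := d) h0 h1).const_mul C).mono'
      hm.norm.prod_swap.integral_prod_right' (ae_of_all _ fun z => ?_)
    have hp : 0 ≤ ‖z‖ ^ ((d : ℝ) + 2 * σ) := by positivity
    rw [Real.norm_of_nonneg (integral_nonneg fun _ => norm_nonneg _)]
    simp_rw [norm_div, Real.norm_eq_abs]
    rw [integral_div, abs_of_nonneg (by positivity : 0 ≤ 2 * ‖z‖ ^ ((d : ℝ) + 2 * σ))]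
    calc _ ≤ C * min 1 (‖z‖ ^ 2) / (2 * ‖z‖ ^ ((d : ℝ) + 2 * σ)) := by gcongr; exact hC z
      _ = C * levyMajorant σ z / 2 := by unfold levyMajorant; rw [mul_comm 2, ← div_div]; ring
      _ ≤ C * levyMajorant σ z := half_le_self (mul_nonneg hC0 (levyMajorant_nonneg σ z))

/-- The Fourier symbol of `sdLap`. -/
noncomputable def sdSymbol (σ : ℝ) (ξ : Sp d) : ℝ :=
  ∫ z : Sp d, (1 - Real.cos (2 * Real.pi * ⟪z, ξ⟫)) / ‖z‖ ^ ((d : ℝ) + 2 * σ)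

lemma fourier_secondDiff {φ : Sp d → ℝ} (h : Integrable φ) (z ξ : Sp d) :
    𝓕 (fun x => (secondDiff φ x z : ℂ)) ξ =
      (2 * (1 - Real.cos (2 * Real.pi * ⟪z, ξ⟫)) : ℝ) * 𝓕 (fun x => (φ x : ℂ)) ξ := by
  have hc : Integrable fun x => (φ x : ℂ) := h.ofReal
  have hp := congrFun (VectorFourier.fourierIntegral_comp_add_right 𝐞 (volume : Measure (Sp d))
    (innerₗ (Sp d)) (fun x => (φ x : ℂ)) z) ξ
  have hm := congrFun (VectorFourier.fourierIntegral_comp_add_right 𝐞 (volume : Measure (Sp d))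
    (innerₗ (Sp d)) (fun x => (φ x : ℂ)) (-z)) ξ
  have conv : ∀ f : Sp d → ℂ, Integrable f → Integrable fun v => 𝐞 (-⟪v, ξ⟫) • f v := fun f hf =>
    (Real.fourierIntegral_convergent_iff ξ).2 hf
  have e : 𝓕 (fun x => (secondDiff φ x z : ℂ)) ξ = 2 * 𝓕 (fun x => (φ x : ℂ)) ξ -
      𝓕 ((fun x => (φ x : ℂ)) ∘ fun x => x + z) ξ -
      𝓕 ((fun x => (φ x : ℂ)) ∘ fun x => x + -z) ξ := by
    simp only [Real.fourier_eq]
    have c1 := (conv _ hc).const_mul 2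
    have c2 := conv ((fun x => (φ x : ℂ)) ∘ fun x => x + z) (hc.comp_add_right z)
    have c3 := conv ((fun x => (φ x : ℂ)) ∘ fun x => x + -z) (hc.comp_add_right (-z))
    rw [← integral_const_mul, ← integral_sub' c1 c2, ← integral_sub' (c1.sub c2) c3]
    congr 1; ext x
    simp only [Pi.sub_apply, secondDiff, Circle.smul_def, Function.comp_apply, smul_eq_mul, ← sub_eq_add_neg]
    push_cast; ring
  rw [e]
  change _ - VectorFourier.fourierIntegral 𝐞 volume (innerₗ (Sp d)) _ ξ -
    VectorFourier.fourierIntegral 𝐞 volume (innerₗ (Sp d)) _ ξ = _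
  rw [hp, hm]
  change 2 * 𝓕 (fun x => (φ x : ℂ)) ξ - 𝐞 ⟪z, ξ⟫ • 𝓕 (fun x => (φ x : ℂ)) ξ -
    𝐞 ⟪-z, ξ⟫ • 𝓕 (fun x => (φ x : ℂ)) ξ = _
  simp only [Circle.smul_def, Real.fourierChar_apply, inner_neg_left, smul_eq_mul]
  push_cast
  rw [Complex.cos]
  ring_nf

lemma IsTest.fourier_sdLap {φ : Sp d → ℝ} (h : IsTest φ) {σ : ℝ} (h0 : 0 < σ)
    (h1 : σ < 1) (ξ : Sp d) :
    𝓕 (fun x => (sdLap σ φ x : ℂ)) ξ = sdSymbol σ ξ * 𝓕 (fun x => (φ x : ℂ)) ξ := by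
  have hp := h.integrable_prod_secondDiff_div h0 h1
  have hsw : Integrable (Function.uncurry fun x z : Sp d =>
      𝐞 (-⟪x, ξ⟫) • ((secondDiff φ x z / (2 * ‖z‖ ^ ((d : ℝ) + 2 * σ)) : ℝ) : ℂ))
      (volume.prod volume) := by
    refine (hp.ofReal (𝕜 := ℂ)).norm.mono' ?_ (ae_of_all _ fun p => ?_)
    · refine AEStronglyMeasurable.smul (f := fun p : Sp d × Sp d => 𝐞 (-⟪p.1, ξ⟫)) ?_
        (hp.ofReal (𝕜 := ℂ)).aestronglyMeasurable
      exact (Real.continuous_fourierChar.comp (by fun_prop)).aestronglyMeasurable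
    · simp only [Function.uncurry]; rw [Circle.norm_smul]; rfl
  rw [Real.fourier_eq]
  calc ∫ x, 𝐞 (-⟪x, ξ⟫) • (sdLap σ φ x : ℂ)
      = ∫ x, ∫ z, 𝐞 (-⟪x, ξ⟫) •
          ((secondDiff φ x z / (2 * ‖z‖ ^ ((d : ℝ) + 2 * σ)) : ℝ) : ℂ) := by
        congr 1; ext x
        simp only [Circle.smul_def]
        rw [integral_smul, integral_complex_ofReal]; rfl
    _ = ∫ z, ∫ x, 𝐞 (-⟪x, ξ⟫) •
          ((secondDiff φ x z / (2 * ‖z‖ ^ ((d : ℝ) + 2 * σ)) : ℝ) : ℂ) :=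
        integral_integral_swap hsw
    _ = ∫ z, (((1 - Real.cos (2 * Real.pi * ⟪z, ξ⟫)) / ‖z‖ ^ ((d : ℝ) + 2 * σ) : ℝ) : ℂ) *
          𝓕 (fun x => (φ x : ℂ)) ξ := by
        congr 1; ext z
        have := fourier_secondDiff h.integrable z ξ
        rw [Real.fourier_eq] at this
        calc _ = ∫ x, (𝐞 (-⟪x, ξ⟫) • (secondDiff φ x z : ℂ)) /
              ((2 * ‖z‖ ^ ((d : ℝ) + 2 * σ) : ℝ) : ℂ) := by
              congr 1; ext x
              simp only [Circle.smul_def, smul_eq_mul]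
              push_cast; ring
          _ = _ := by
              rw [integral_div, this]
              push_cast
              rw [mul_assoc, mul_div_mul_left _ _ two_ne_zero]
              ring
    _ = _ := by
        rw [integral_mul_const, integral_complex_ofReal]; rfl

lemma integrable_one_sub_cos_div {σ : ℝ} (h0 : 0 < σ) (h1 : σ < 1) :
    Integrable fun ζ : Sp d => (1 - Real.cos (ζ 0)) / ‖ζ‖ ^ ((d : ℝ) + 2 * σ) := by
  refine ((integrable_levyMajorant h0 h1).const_mul 2).mono' ?_ (ae_of_all _ fun ζ => ?_)
  · exact (Measurable.div (by fun_prop) (measurable_kernel σ)).aestronglyMeasurable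
  · have hp : 0 ≤ ‖ζ‖ ^ ((d : ℝ) + 2 * σ) := by positivity
    have hc1 : 0 ≤ 1 - Real.cos (ζ 0) := by linarith [Real.cos_le_one (ζ 0)]
    rw [Real.norm_of_nonneg (by positivity)]
    unfold levyMajorant
    rw [← mul_div_assoc]
    gcongr
    rw [mul_min_of_nonneg _ _ (by norm_num : (0 : ℝ) ≤ 2)]
    refine le_min (by linarith [Real.neg_one_le_cos (ζ 0)]) ?_
    have h2 := Real.one_sub_sq_div_two_le_cos (x := ζ 0)
    have h3 : (ζ 0) ^ 2 ≤ ‖ζ‖ ^ 2 := by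
      have := PiLp.norm_apply_le ζ 0
      rw [Real.norm_eq_abs] at this
      rw [← sq_abs]; gcongr
    nlinarith [sq_nonneg ‖ζ‖]

/-- An inverse of a Bochner integral would be 0 if the integral diverged or vanished; integrability
and strict positivity on the slab `0 < ζ₁ < 1` exclude both. -/
lemma normConst_pos {σ : ℝ} (h0 : 0 < σ) (h1 : σ < 1) : 0 < normConst d σ := by
  unfold normConst
  rw [inv_pos, integral_pos_iff_support_of_nonneg (fun ζ => ?_) (integrable_one_sub_cos_div h0 h1)]
  · let U : Set (Sp d) := {ζ | 0 < ζ 0 ∧ ζ 0 < 1}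
    have hU : IsOpen U := by
      have hc : Continuous fun ζ : Sp d => ζ 0 := by fun_prop
      exact (isOpen_lt continuous_const hc).inter (isOpen_lt hc continuous_const)
    have hne : U.Nonempty := ⟨EuclideanSpace.single 0 (1 / 2), by
      simp only [U, mem_ofPred_eq, PiLp.single_apply]; norm_num⟩
    refine (hU.measure_pos volume hne).trans_le (measure_mono fun ζ hζ => ?_)
    have hζ0 : 0 < ‖ζ‖ := norm_pos_iff.2 fun h => by
      have := hζ.1; rw [h] at this; simp at this
    have hcos : Real.cos (ζ 0) < 1 := by
      have := Real.cos_lt_cos_of_nonneg_of_le_pi le_rfl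
        (by linarith [hζ.2, Real.pi_gt_three]) hζ.1
      rwa [Real.cos_zero] at this
    exact (div_pos (by linarith) (Real.rpow_pos_of_pos hζ0 _)).ne'
  · have hc1 : 0 ≤ 1 - Real.cos (ζ 0) := by linarith [Real.cos_le_one (ζ 0)]
    positivity

/-- A rotation brings `ξ` to the first axis and a dilation by `2π|ξ|` extracts the power; what
remains is the integral whose inverse is `normConst`. The `2π` comes from the convention `e^{-2πi
x·ξ}`. -/
lemma normConst_mul_sdSymbol {σ : ℝ} (h0 : 0 < σ) (h1 : σ < 1) (ξ : Sp d) :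
    normConst d σ * sdSymbol σ ξ = (2 * Real.pi * ‖ξ‖) ^ (2 * σ) := by
  rcases eq_or_ne ξ 0 with rfl | hξ
  · simp [sdSymbol, Real.zero_rpow (by positivity : 2 * σ ≠ 0)]
  have hξ0 : 0 < ‖ξ‖ := norm_pos_iff.2 hξ
  set c := 2 * Real.pi * ‖ξ‖ with hc
  have hc0 : 0 < c := by positivity
  obtain ⟨A, hA⟩ := exists_isometry_map_eq (x := EuclideanSpace.single (0 : Fin d) ‖ξ‖) (y := ξ)
    (by simp)
  let g : Sp d → ℝ := fun ζ => (1 - Real.cos (ζ 0)) / ‖ζ‖ ^ ((d : ℝ) + 2 * σ)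
  have e : sdSymbol σ ξ = c ^ ((d : ℝ) + 2 * σ) * ∫ z, g (c • z) := by
    unfold sdSymbol
    rw [← integral_comp_isometry A, ← integral_const_mul]
    congr 1; ext z
    have hin : ⟪A z, ξ⟫ = ‖ξ‖ * z 0 := by
      rw [← hA, A.inner_map_map, EuclideanSpace.inner_single_right, A.norm_map]
      simp
    have hpow : c ^ ((d : ℝ) + 2 * σ) ≠ 0 := (Real.rpow_pos_of_pos hc0 _).ne'
    simp only [g, hin, norm_smul, PiLp.smul_apply, smul_eq_mul, Real.norm_of_nonneg hc0.le,
      A.norm_map]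
    rw [Real.mul_rpow hc0.le (norm_nonneg _), ← mul_div_assoc, mul_div_mul_left _ _ hpow, hc]
    ring_nf
  have hnc := normConst_pos (d := d) h0 h1
  have hg : ∫ z, g z = (normConst d σ)⁻¹ := by unfold normConst; rw [inv_inv]
  rw [e, Measure.integral_comp_smul, finrank_euclideanSpace_fin, hg, smul_eq_mul,
    abs_of_nonneg (by positivity), Real.rpow_add hc0, Real.rpow_natCast]
  field_simp

lemma IsTest.fourier_fracLap {φ : Sp d → ℝ} (h : IsTest φ) {σ : ℝ} (h0 : 0 < σ)
    (h1 : σ < 1) (ξ : Sp d) :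
    𝓕 (fun x => (fracLap σ φ x : ℂ)) ξ =
      ((2 * Real.pi * ‖ξ‖) ^ (2 * σ) : ℝ) * 𝓕 (fun x => (φ x : ℂ)) ξ := by
  rw [← normConst_mul_sdSymbol h0 h1, Complex.ofReal_mul, mul_assoc, ← h.fourier_sdLap h0 h1,
    Real.fourier_eq, Real.fourier_eq, ← integral_const_mul]
  congr 1; ext x
  rw [h.fracLap_eq h0 h1]
  simp only [Circle.smul_def, smul_eq_mul]
  push_cast; ring

lemma IsTest.integrable_fracLap {φ : Sp d → ℝ} (h : IsTest φ) {σ : ℝ} (h0 : 0 < σ)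
    (h1 : σ < 1) : Integrable (fracLap σ φ) := by
  simp_rw [funext (h.fracLap_eq h0 h1)]
  exact (h.integrable_sdLap h0 h1).const_mul _

lemma IsTest.continuous_fracLap {φ : Sp d → ℝ} (h : IsTest φ) {σ : ℝ} (h0 : 0 < σ)
    (h1 : σ < 1) : Continuous (fracLap σ φ) := by
  simp_rw [funext (h.fracLap_eq h0 h1)]
  exact (h.continuous_sdLap h0 h1).const_mul _

/-- The transform is a Schwartz function and `y^a ≤ 1 + y²` for `0 ≤ a ≤ 2`, a range that covers
every exponent `2σ` with `σ < 1`. -/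
lemma IsTest.integrable_rpow_mul_fourier {φ : Sp d → ℝ} (h : IsTest φ) {a : ℝ} (ha0 : 0 ≤ a)
    (ha2 : a ≤ 2) :
    Integrable fun ξ => ((2 * Real.pi * ‖ξ‖) ^ a : ℝ) * 𝓕 (fun x => (φ x : ℂ)) ξ := by
  have hcs : HasCompactSupport fun x => (φ x : ℂ) := h.2.comp_left (g := Complex.ofReal) rfl
  have hsm : ContDiff ℝ ∞ fun x => (φ x : ℂ) := Complex.ofRealCLM.contDiff.comp h.1
  let S := hcs.toSchwartzMap hsm
  have hS : ((𝓕 S : SchwartzMap (Sp d) ℂ) : Sp d → ℂ) = 𝓕 (fun x => (φ x : ℂ)) := rfl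
  rw [← hS]
  have i0 := (𝓕 S).integrable_pow_mul volume 0
  have i2 := (𝓕 S).integrable_pow_mul volume 2
  refine (i0.add (i2.const_mul ((2 * Real.pi) ^ 2))).mono' ?_ (ae_of_all _ fun ξ => ?_)
  · refine AEStronglyMeasurable.mul ?_ (𝓕 S).continuous.aestronglyMeasurable
    refine (Complex.continuous_ofReal.comp ?_).aestronglyMeasurable
    exact Continuous.rpow_const (by fun_prop) fun _ => Or.inr ha0
  · rw [norm_mul, Complex.norm_real, Real.norm_of_nonneg (by positivity)]
    simp only [Pi.add_apply, pow_zero, one_mul]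
    have : (2 * Real.pi * ‖ξ‖) ^ a ≤ 1 + (2 * Real.pi * ‖ξ‖) ^ 2 := by
      have hy : 0 ≤ 2 * Real.pi * ‖ξ‖ := by positivity
      rcases le_or_gt (2 * Real.pi * ‖ξ‖) 1 with h1 | h1
      · have := Real.rpow_le_one hy h1 ha0
        nlinarith [sq_nonneg (2 * Real.pi * ‖ξ‖)]
      · have := Real.rpow_le_rpow_of_exponent_le h1.le ha2
        rw [Real.rpow_two] at this
        linarith
    calc _ ≤ (1 + (2 * Real.pi * ‖ξ‖) ^ 2) * ‖(𝓕 S) ξ‖ := by gcongr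
      _ = _ := by ring

/-- Parseval's identity by writing `b` as the inverse transform of its transform and moving the
Fourier integral onto `a`. Only the transform of `b` has to be integrable, and `-ξ` plays the role
of complex conjugation for real `a`. -/
lemma integral_mul_eq_integral_fourier {a b : Sp d → ℝ} (ha : Integrable a) (hb : Integrable b)
    (hbc : Continuous b) (hbF : Integrable (𝓕 fun x => (b x : ℂ))) :
    ((∫ x, a x * b x : ℝ) : ℂ) =
      ∫ ξ, 𝓕 (fun x => (a x : ℂ)) (-ξ) * 𝓕 (fun x => (b x : ℂ)) ξ := by
  have hinv : 𝓕⁻ (𝓕 fun x => (b x : ℂ)) = fun x => (b x : ℂ) :=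
    Continuous.fourierInv_fourier_eq (Complex.continuous_ofReal.comp hbc) hb.ofReal hbF
  rw [Real.fourierInv_eq_fourier_comp_neg] at hinv
  have key := VectorFourier.integral_fourierIntegral_smul_eq_flip (L := innerₗ (Sp d))
    (μ := volume) (ν := volume) Real.continuous_fourierChar continuous_inner
    (ha.ofReal (𝕜 := ℂ)) hbF.comp_neg
  rw [flip_innerₗ] at key
  change ∫ ξ, 𝓕 (fun x => (a x : ℂ)) ξ • 𝓕 (fun x => (b x : ℂ)) (-ξ) =
    ∫ x, (a x : ℂ) • 𝓕 (fun ξ => 𝓕 (fun x => (b x : ℂ)) (-ξ)) x at key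
  rw [hinv] at key
  rw [← integral_neg_eq_self] at key
  simp only [smul_eq_mul, neg_neg] at key
  rw [key, ← integral_complex_ofReal]
  simp only [Complex.ofReal_mul]

/-- On the Fourier side both integrals carry the same even multiplier, so it may be attached to
either factor. -/
lemma IsTest.integral_fracLap_mul {φ ψ : Sp d → ℝ} (hφ : IsTest φ) (hψ : IsTest ψ) {σ : ℝ}
    (h0 : 0 < σ) (h1 : σ < 1) : ∫ x, fracLap σ φ x * ψ x = ∫ x, φ x * fracLap σ ψ x := by
  have hF : ∀ {a : ℝ}, 0 ≤ a → a ≤ 2 → _ := fun {a} => hψ.integrable_rpow_mul_fourier (a := a)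
  have i1 : Integrable (𝓕 fun x => (ψ x : ℂ)) := by
    have := hF le_rfl zero_le_two
    simpa using this
  have i2 : Integrable (𝓕 fun x => (fracLap σ ψ x : ℂ)) := by
    rw [funext (hψ.fourier_fracLap h0 h1)]
    exact hF (by positivity) (by linarith)
  have e1 := integral_mul_eq_integral_fourier (hφ.integrable_fracLap h0 h1) hψ.integrable
    hψ.1.continuous i1
  have e2 := integral_mul_eq_integral_fourier hφ.integrable (hψ.integrable_fracLap h0 h1)
    (hψ.continuous_fracLap h0 h1) i2
  rw [← Complex.ofReal_inj, e1, e2]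
  congr 1; ext ξ
  rw [hφ.fourier_fracLap h0 h1, hψ.fourier_fracLap h0 h1, norm_neg]
  ring

/-- The composition identity `(-Δ)^{s/2} (-Δ)^{s/2} = (-Δ)^s`, in weak form. -/
lemma IsTest.integral_fracLap_half_mul {φ ψ : Sp d → ℝ} (hφ : IsTest φ) (hψ : IsTest ψ) {s : ℝ}
    (h0 : 0 < s) (h1 : s < 1) :
    ∫ x, fracLap (s / 2) φ x * fracLap (s / 2) ψ x = ∫ x, φ x * fracLap s ψ x := by
  have h0' : 0 < s / 2 := by positivity
  have h1' : s / 2 < 1 := by linarith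
  have hF : ∀ {a : ℝ}, 0 ≤ a → a ≤ 2 → _ := fun {a} => hψ.integrable_rpow_mul_fourier (a := a)
  have i1 : Integrable (𝓕 fun x => (fracLap (s / 2) ψ x : ℂ)) := by
    rw [funext (hψ.fourier_fracLap h0' h1')]
    exact hF (by positivity) (by linarith)
  have i2 : Integrable (𝓕 fun x => (fracLap s ψ x : ℂ)) := by
    rw [funext (hψ.fourier_fracLap h0 h1)]
    exact hF (by positivity) (by linarith)
  have e1 := integral_mul_eq_integral_fourier (hφ.integrable_fracLap h0' h1')
    (hψ.integrable_fracLap h0' h1') (hψ.continuous_fracLap h0' h1') i1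
  have e2 := integral_mul_eq_integral_fourier hφ.integrable (hψ.integrable_fracLap h0 h1)
    (hψ.continuous_fracLap h0 h1) i2
  rw [← Complex.ofReal_inj, e1, e2]
  congr 1; ext ξ
  rw [hφ.fourier_fracLap h0' h1', hψ.fourier_fracLap h0' h1', hψ.fourier_fracLap h0 h1, norm_neg]
  have : (2 * Real.pi * ‖ξ‖) ^ (2 * s) =
      (2 * Real.pi * ‖ξ‖) ^ (2 * (s / 2)) * (2 * Real.pi * ‖ξ‖) ^ (2 * (s / 2)) := by
    rw [← Real.rpow_add_of_nonneg (by positivity) (by positivity) (by positivity)]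
    congr 1; ring
  rw [this]; push_cast; ring

end Fourier

/-! ### The energy space: moving half Laplacians onto the test function -/

section Energy

variable {d : ℕ}

lemma IsTest.sub {φ ψ : Sp d → ℝ} (hφ : IsTest φ) (hψ : IsTest ψ) :
    IsTest fun x => φ x - ψ x :=
  ⟨hφ.1.sub hψ.1, hφ.2.sub hψ.2⟩

/-- After expanding, `φ(x)φ(x+z)` and `φ(x)φ(x-z)` have equal integrals by translation, as have
`φ(x+z)²` and `φ(x)²`. -/
lemma IsTest.integral_sq_sub_eq {φ : Sp d → ℝ} (h : IsTest φ) (z : Sp d) :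
    ∫ x, (φ x - φ (x + z)) ^ 2 = ∫ x, φ x * secondDiff φ x z := by
  have hc := h.1.continuous
  have sq : ∀ {f g : Sp d → ℝ}, Continuous f → Continuous g → HasCompactSupport f →
      Integrable fun x => f x * g x := fun hf hg hs =>
    (hf.mul hg).integrable_of_hasCompactSupport hs.mul_right
  have hcz : Continuous fun x => φ (x + z) := by fun_prop
  have hcz' : Continuous fun x => φ (x - z) := by fun_prop
  have hsz : HasCompactSupport fun x => φ (x + z) := h.2.comp_homeomorph (Homeomorph.addRight z)
  have i1 := sq hc hc h.2
  have i2 := sq hcz hcz hsz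
  have i3 := sq hc hcz h.2
  have i4 := sq hc hcz' h.2
  have e4 : ∫ x, φ x * φ (x - z) = ∫ x, φ x * φ (x + z) := by
    rw [← integral_add_right_eq_self _ z]
    congr 1; ext x; rw [add_sub_cancel_right, mul_comm]
  have e2 : ∫ x, φ (x + z) * φ (x + z) = ∫ x, φ x * φ x :=
    integral_add_right_eq_self (fun x => φ x * φ x) z
  have l : ∫ x, (φ x - φ (x + z)) ^ 2 =
      ∫ x, ((φ x * φ x + φ (x + z) * φ (x + z)) - 2 * (φ x * φ (x + z))) := by
    congr 1; ext x; ring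
  have r : ∫ x, φ x * secondDiff φ x z =
      ∫ x, ((2 * (φ x * φ x) - φ x * φ (x + z)) - φ x * φ (x - z)) := by
    congr 1; ext x; unfold secondDiff; ring
  have i12 : Integrable fun x => φ x * φ x + φ (x + z) * φ (x + z) := i1.add i2
  have i13 : Integrable fun x => 2 * (φ x * φ x) - φ x * φ (x + z) := (i1.const_mul 2).sub i3
  rw [l, r, integral_sub i12 (i3.const_mul 2), integral_add i1 i2, integral_sub i13 i4, integral_sub (i1.const_mul 2) i3,
    integral_const_mul, integral_const_mul, e4, e2]
  ring

variable [NeZero d]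

/-- The Gagliardo seminorm of a test function as a quadratic form. -/
lemma IsTest.hdotNormSq_eq {φ : Sp d → ℝ} (h : IsTest φ) {s : ℝ} (h0 : 0 < s) (h1 : s < 1) :
    hdotNormSq s φ = ENNReal.ofReal (∫ x, φ x * fracLap s φ x) := by
  have hc := h.1.continuous
  obtain ⟨B, hB0, hB⟩ := h.bounded
  have hprod := h.integrable_prod_secondDiff_div h0 h1
  have hprodφ : Integrable (fun p : Sp d × Sp d =>
      φ p.1 * (secondDiff φ p.1 p.2 / (2 * ‖p.2‖ ^ ((d : ℝ) + 2 * s)))) (volume.prod volume) :=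
    hprod.bdd_mul (c := B) (hc.comp continuous_fst).aestronglyMeasurable
      (ae_of_all _ fun p => hB p.1)
  have hmeas : Measurable fun p : Sp d × Sp d =>
      ENNReal.ofReal ((φ p.1 - φ (p.1 + p.2)) ^ 2 / ‖p.2‖ ^ ((d : ℝ) + 2 * s)) := by
    refine ENNReal.measurable_ofReal.comp (Measurable.div ?_
      ((measurable_kernel s).comp measurable_snd))
    have : Continuous fun p : Sp d × Sp d => (φ p.1 - φ (p.1 + p.2)) ^ 2 := by fun_prop
    exact this.measurable
  -- Substituting `y = x + z` makes the kernel depend on `z` alone, so Tonelli leaves an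
  -- `x`-integral that `integral_sq_sub_eq` evaluates.
  have e1 : ∫⁻ x, ∫⁻ y, ENNReal.ofReal ((φ x - φ y) ^ 2 / ‖x - y‖ ^ ((d : ℝ) + 2 * s)) =
      ∫⁻ z, ∫⁻ x, ENNReal.ofReal ((φ x - φ (x + z)) ^ 2 / ‖z‖ ^ ((d : ℝ) + 2 * s)) := by
    rw [← lintegral_lintegral_swap (f := fun x z =>
      ENNReal.ofReal ((φ x - φ (x + z)) ^ 2 / ‖z‖ ^ ((d : ℝ) + 2 * s))) hmeas.aemeasurable]
    congr 1; ext x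
    rw [← lintegral_add_left_eq_self _ x]
    congr 1; ext z
    rw [sub_add_cancel_left, norm_neg]
  have e2 : ∀ z, ∫⁻ x, ENNReal.ofReal ((φ x - φ (x + z)) ^ 2 / ‖z‖ ^ ((d : ℝ) + 2 * s)) =
      ENNReal.ofReal (2 * ∫ x, φ x * (secondDiff φ x z / (2 * ‖z‖ ^ ((d : ℝ) + 2 * s)))) := by
    intro z
    have hi : Integrable fun x => (φ x - φ (x + z)) ^ 2 := by
      have hs : HasCompactSupport fun x => φ x - φ (x + z) :=
        h.2.sub (h.2.comp_homeomorph (Homeomorph.addRight z))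
      have hcc : Continuous fun x => (φ x - φ (x + z)) ^ 2 := by fun_prop
      refine hcc.integrable_of_hasCompactSupport ?_
      exact hs.comp_left (g := fun t : ℝ => t ^ 2) (by simp)
    rw [← ofReal_integral_eq_lintegral_ofReal (hi.div_const _)
      (ae_of_all _ fun x => div_nonneg (sq_nonneg _) (by positivity)), integral_div,
      h.integral_sq_sub_eq]
    congr 1
    rw [← integral_div, ← integral_const_mul]
    congr 1; ext x
    rw [← mul_div_assoc, ← mul_div_assoc, mul_div_mul_left _ _ two_ne_zero]
  have e3 : ∫⁻ z, ENNReal.ofReal (2 * ∫ x, φ x *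
      (secondDiff φ x z / (2 * ‖z‖ ^ ((d : ℝ) + 2 * s)))) =
      ENNReal.ofReal (2 * ∫ x, φ x * sdLap s φ x) := by
    rw [← ofReal_integral_eq_lintegral_ofReal (hprodφ.integral_prod_right.const_mul 2)
      (ae_of_all _ fun z => ?_), integral_const_mul]
    · congr 2
      rw [← integral_integral_swap (f := fun x z =>
        φ x * (secondDiff φ x z / (2 * ‖z‖ ^ ((d : ℝ) + 2 * s)))) hprodφ]
      congr 1; ext x
      rw [integral_const_mul]; rfl
    · have : ∫ x, φ x * (secondDiff φ x z / (2 * ‖z‖ ^ ((d : ℝ) + 2 * s))) =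
          (∫ x, (φ x - φ (x + z)) ^ 2) / (2 * ‖z‖ ^ ((d : ℝ) + 2 * s)) := by
        rw [h.integral_sq_sub_eq, ← integral_div]
        congr 1; ext x; rw [mul_div_assoc]
      simp only [Pi.zero_apply]
      rw [this]
      have : 0 ≤ ∫ x, (φ x - φ (x + z)) ^ 2 := integral_nonneg fun _ => sq_nonneg _
      positivity
  have hn := normConst_pos (d := d) h0 h1
  unfold hdotNormSq
  rw [e1]
  simp_rw [e2]
  rw [e3, ← ENNReal.ofReal_mul (by positivity)]
  congr 1
  simp_rw [h.fracLap_eq h0 h1]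
  rw [div_mul_eq_mul_div, mul_left_comm, mul_div_cancel_left₀ _ two_ne_zero, ← integral_const_mul]
  congr 1; ext x; ring

lemma aemeasurable_gagliardo {v : Sp d → ℝ} (hv : AEStronglyMeasurable v) (s : ℝ) :
    AEMeasurable (fun p : Sp d × Sp d =>
      ENNReal.ofReal ((v p.1 - v p.2) ^ 2 / ‖p.1 - p.2‖ ^ ((d : ℝ) + 2 * s)))
      (volume.prod volume) := by
  have h1 : AEMeasurable (fun p : Sp d × Sp d => v p.1) (volume.prod volume) :=
    hv.aemeasurable.comp_quasiMeasurePreserving Measure.quasiMeasurePreserving_fst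
  have h2 : AEMeasurable (fun p : Sp d × Sp d => v p.2) (volume.prod volume) :=
    hv.aemeasurable.comp_quasiMeasurePreserving Measure.quasiMeasurePreserving_snd
  have h3 : Measurable fun p : Sp d × Sp d => ‖p.1 - p.2‖ ^ ((d : ℝ) + 2 * s) :=
    (measurable_kernel s).comp (measurable_fst.sub measurable_snd)
  exact (((h1.sub h2).pow_const 2).div h3.aemeasurable).ennreal_ofReal

lemma hdotNormSq_eq_lintegral_prod {v : Sp d → ℝ} (hv : AEStronglyMeasurable v) (s : ℝ) :
    hdotNormSq s v = ENNReal.ofReal (normConst d s / 2) *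
      ∫⁻ p : Sp d × Sp d, ENNReal.ofReal ((v p.1 - v p.2) ^ 2 /
        ‖p.1 - p.2‖ ^ ((d : ℝ) + 2 * s)) ∂(volume.prod volume) := by
  unfold hdotNormSq
  rw [lintegral_prod _ (aemeasurable_gagliardo hv s)]

lemma hdotNormSq_sub_le {v w : Sp d → ℝ} (hv : AEStronglyMeasurable v)
    (hw : AEStronglyMeasurable w) (s : ℝ) :
    hdotNormSq s (fun x => v x - w x) ≤ 2 * (hdotNormSq s v + hdotNormSq s w) := by
  rw [hdotNormSq_eq_lintegral_prod hv, hdotNormSq_eq_lintegral_prod hw,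
    hdotNormSq_eq_lintegral_prod (v := fun x => v x - w x) (hv.sub hw), ← mul_add,
    ← lintegral_add_left' (aemeasurable_gagliardo hv s), mul_left_comm]
  gcongr
  rw [← lintegral_const_mul' _ _ (by simp)]
  refine lintegral_mono fun p => ?_
  have htwo : ∀ a : ℝ, 2 * ENNReal.ofReal a = ENNReal.ofReal (2 * a) := fun a => by
    rw [ENNReal.ofReal_mul zero_le_two, ENNReal.ofReal_ofNat]
  rw [← ENNReal.ofReal_add (by positivity) (by positivity), ← add_div, htwo, ← mul_div_assoc]
  refine ENNReal.ofReal_le_ofReal ?_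
  gcongr
  nlinarith [sq_nonneg ((v p.1 - v p.2) + (w p.1 - w p.2))]

lemma IsTest.fracLap_sub {φ ψ : Sp d → ℝ} (hφ : IsTest φ) (hψ : IsTest ψ) {σ : ℝ} (h0 : 0 < σ)
    (h1 : σ < 1) (x : Sp d) :
    fracLap σ (fun y => φ y - ψ y) x = fracLap σ φ x - fracLap σ ψ x := by
  rw [(hφ.sub hψ).fracLap_eq h0 h1, hφ.fracLap_eq h0 h1, hψ.fracLap_eq h0 h1, ← mul_sub]
  congr 1
  unfold sdLap
  rw [← integral_sub (hφ.integrable_secondDiff_div h0 h1 x)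
    (hψ.integrable_secondDiff_div h0 h1 x)]
  congr 1; ext z
  rw [← sub_div]; congr 1; unfold secondDiff; ring

lemma IsTest.abs_fracLap_le {φ : Sp d → ℝ} (h : IsTest φ) {σ : ℝ} (h0 : 0 < σ) (h1 : σ < 1) :
    ∃ C, 0 ≤ C ∧ ∀ x, |fracLap σ φ x| ≤ C * (1 + ‖x‖) ^ (-((d : ℝ) + 2 * σ)) := by
  obtain ⟨C, hC0, hC⟩ := h.abs_sdLap_le h0 h1
  have hn := normConst_pos (d := d) h0 h1
  refine ⟨normConst d σ * C, by positivity, fun x => ?_⟩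
  rw [h.fracLap_eq h0 h1, abs_mul, abs_of_pos hn, mul_assoc]
  gcongr
  exact hC x

/-- Interpolation: `|h|^q ≤ C^{q-1} |h|`. It places fractional Laplacians of test functions in the
dual of the Sobolev space `L^{2d/(d-2s)}`. -/
lemma memLp_of_integrable_of_bounded {h : Sp d → ℝ} (hi : Integrable h) {C : ℝ}
    (hC : ∀ x, |h x| ≤ C) {q : ℝ} (hq : 1 ≤ q) : MemLp h (ENNReal.ofReal q) := by
  have hC0 : 0 ≤ C := (abs_nonneg _).trans (hC 0)
  rw [← integrable_norm_rpow_iff hi.aestronglyMeasurable (by simp; linarith) (by simp),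
    ENNReal.toReal_ofReal (by linarith)]
  refine (hi.norm.const_mul (C ^ (q - 1))).mono'
    (hi.aestronglyMeasurable.norm.aemeasurable.pow_const q).aestronglyMeasurable
    (ae_of_all _ fun x => ?_)
  rw [Real.norm_of_nonneg (by positivity)]
  calc ‖h x‖ ^ q = ‖h x‖ ^ (q - 1) * ‖h x‖ := by
        rcases eq_or_ne ‖h x‖ 0 with h0 | h0
        · rw [h0, mul_zero, Real.zero_rpow (by linarith)]
        · rw [← Real.rpow_add_one h0, sub_add_cancel]
    _ ≤ _ := by
        gcongr
        exact hC x

lemma IsTest.memLp_fracLap {φ : Sp d → ℝ} (h : IsTest φ) {σ : ℝ} (h0 : 0 < σ) (h1 : σ < 1)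
    {q : ℝ} (hq : 1 ≤ q) : MemLp (fracLap σ φ) (ENNReal.ofReal q) := by
  obtain ⟨C, hC0, hC⟩ := h.bounded_sdLap h0 h1
  refine memLp_of_integrable_of_bounded (h.integrable_fracLap h0 h1)
    (C := |normConst d σ| * C) (fun x => ?_) hq
  rw [h.fracLap_eq h0 h1, abs_mul]
  gcongr
  exact hC x

lemma IsTest.memLp {φ : Sp d → ℝ} (h : IsTest φ) (p : ℝ≥0∞) : MemLp φ p :=
  h.1.continuous.memLp_of_hasCompactSupport h.2

lemma tendsto_integral_mul_of_tendsto_eLpNorm {p q : ℝ≥0∞} [p.HolderConjugate q]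
    {F : ℕ → Sp d → ℝ} {f h : Sp d → ℝ} (hF : ∀ n, MemLp (F n) p) (hf : MemLp f p)
    (hh : MemLp h q) (hlim : Tendsto (fun n => eLpNorm (F n - f) p volume) atTop (𝓝 0)) :
    Tendsto (fun n => ∫ x, F n x * h x) atTop (𝓝 (∫ x, f x * h x)) := by
  refine tendsto_integral_of_L1' _ (hf.1.mul hh.1)
    (Eventually.of_forall fun n => (hF n).integrable_mul hh) ?_
  have hub : Tendsto (fun n => eLpNorm (F n - f) p volume * eLpNorm h q volume) atTop (𝓝 0) := by
    have := ENNReal.Tendsto.mul_const hlim (Or.inr hh.2.ne) (b := eLpNorm h q volume)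
    rwa [zero_mul] at this
  refine tendsto_of_tendsto_of_tendsto_of_le_of_le tendsto_const_nhds hub (fun _ => zero_le)
    fun n => ?_
  have := eLpNorm_smul_le_mul_eLpNorm (p := p) (q := q) (r := 1) hh.1 ((hF n).1.sub hf.1)
  refine le_trans (le_of_eq ?_) this
  congr 1; ext x
  simp [sub_mul]

/-- The `L²` isometry property of `(-Δ)^{s/2}`. -/
lemma IsTest.eLpNorm_fracLap_half_sq {φ : Sp d → ℝ} (h : IsTest φ) {s : ℝ} (h0 : 0 < s)
    (h1 : s < 1) : eLpNorm (fracLap (s / 2) φ) 2 volume ^ 2 = hdotNormSq s φ := by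
  have h0' : 0 < s / 2 := by positivity
  have h1' : s / 2 < 1 := by linarith
  have hm : MemLp (fracLap (s / 2) φ) 2 := by
    simpa using h.memLp_fracLap h0' h1' (q := 2) one_le_two
  rw [h.hdotNormSq_eq h0 h1, ← h.integral_fracLap_half_mul h h0 h1,
    ofReal_integral_eq_lintegral_ofReal (f := fun x => fracLap (s / 2) φ x * fracLap (s / 2) φ x)
      (hm.integrable_mul hm)
      (ae_of_all _ fun x => mul_self_nonneg _)]
  have := eLpNorm_nnreal_pow_eq_lintegral (f := fracLap (s / 2) φ) (μ := volume) (p := 2)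
    two_ne_zero
  simp only [NNReal.coe_ofNat, ENNReal.rpow_ofNat, ENNReal.coe_ofNat] at this
  rw [this]
  congr 1; ext x
  rw [← ofReal_norm, ← ENNReal.ofReal_pow (norm_nonneg _), Real.norm_eq_abs, sq_abs, sq]

/-- For `v ∈ Ḣ^s` with `g = (-Δ)^{s/2} v`, the identity `⟨g, (-Δ)^{s/2} χ⟩ = ⟨v, (-Δ)^s χ⟩`. -/
lemma MemHdot.integral_mul_fracLap_half {s : ℝ} (h0 : 0 < s) (h1 : s < 1) (hd : 2 * s < d)
    {v g χ : Sp d → ℝ} (hv : MemHdot s v) (hg : IsDistribFracLap (s / 2) v g) (hχ : IsTest χ) :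
    ∫ x, g x * fracLap (s / 2) χ x = ∫ x, v x * fracLap s χ x := by
  have h0' : 0 < s / 2 := by positivity
  have h1' : s / 2 < 1 := by linarith
  obtain ⟨hvm, φ, hφ, hlimH, hlimL⟩ := hv
  have hd0 : (0 : ℝ) < d := by linarith
  have hds : (0 : ℝ) < d - 2 * s := by linarith
  set pr : ℝ := 2 * d / (d - 2 * s) with hpr
  have hpr1 : 1 < pr := by rw [hpr, lt_div_iff₀ hds]; linarith
  have hconj := Real.HolderConjugate.conjExponent hpr1
  set qr := Real.conjExponent pr
  have hqr1 : 1 ≤ qr := hconj.symm.lt.le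
  have : (ENNReal.ofReal pr).HolderConjugate (ENNReal.ofReal qr) := hconj.ennrealOfReal
  have hvL : MemLp v (ENNReal.ofReal pr) := by
    obtain ⟨n, hn⟩ := (hlimL.eventually (gt_mem_nhds (zero_lt_one : (0 : ℝ≥0∞) < 1))).exists
    have hsub : MemLp (fun x => v x - φ n x) (ENNReal.ofReal pr) :=
      ⟨hvm.sub ((hφ n).memLp (ENNReal.ofReal pr)).1, hn.trans ENNReal.one_lt_top⟩
    have := hsub.add ((hφ n).memLp _)
    refine this.ae_eq (ae_of_all _ fun x => ?_)
    simp
  have hlimL' : Tendsto (fun n => eLpNorm (φ n - v) (ENNReal.ofReal pr) volume) atTop (𝓝 0) := by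
    refine hlimL.congr fun n => ?_
    rw [← eLpNorm_neg]
    congr 1; ext x; simp
  have hpass : ∀ {h : Sp d → ℝ}, MemLp h (ENNReal.ofReal qr) →
      Tendsto (fun n => ∫ x, φ n x * h x) atTop (𝓝 (∫ x, v x * h x)) := fun hh =>
    tendsto_integral_mul_of_tendsto_eLpNorm (fun n => (hφ n).memLp _) hvL hh hlimL'
  have ha : ∀ {ψ : Sp d → ℝ}, IsTest ψ → MemLp (fracLap (s / 2) ψ) 2 := fun hψ => by
    simpa using hψ.memLp_fracLap h0' h1' (q := 2) one_le_two
  -- Here `g` is only locally integrable while `(-Δ)^{s/2} χ` has no compact support, so the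
  -- definition of `g` cannot be applied to it directly. The half Laplacians of the approximants are
  -- Cauchy in `L²` by the isometry with `Ḣ^s`; their limit `G` agrees with `g` against test
  -- functions, hence almost everywhere, and `G` may be paired with any `L²` function.
  let A : ℕ → Lp ℝ 2 (volume : Measure (Sp d)) := fun n => (ha (hφ n)).toLp _
  have hdist : ∀ n m, edist (A n) (A m) ^ 2 ≤ 2 * (hdotNormSq s (fun x => v x - φ m x) +
      hdotNormSq s (fun x => v x - φ n x)) := by
    intro n m
    rw [Lp.edist_toLp_toLp]
    have e : fracLap (s / 2) (φ n) - fracLap (s / 2) (φ m) =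
        fracLap (s / 2) (fun x => φ n x - φ m x) := by
      ext x; rw [(hφ n).fracLap_sub (hφ m) h0' h1']; rfl
    rw [e, ((hφ n).sub (hφ m)).eLpNorm_fracLap_half_sq h0 h1]
    have e' : (fun x => φ n x - φ m x) = fun x => (v x - φ m x) - (v x - φ n x) := by
      ext x; ring
    rw [e']
    exact hdotNormSq_sub_le (hvm.sub (hφ m).1.continuous.aestronglyMeasurable)
      (hvm.sub (hφ n).1.continuous.aestronglyMeasurable) s
  have hcau : CauchySeq A := by
    rw [EMetric.cauchySeq_iff]
    intro ε hε
    have hε2 : 0 < ε ^ 2 / 4 := ENNReal.div_pos (pow_ne_zero 2 hε.ne') (by simp)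
    obtain ⟨N, hN⟩ := eventually_atTop.1 (hlimH.eventually (gt_mem_nhds hε2))
    refine ⟨N, fun m hm n hn => ?_⟩
    have := hdist m n
    have hlt : edist (A m) (A n) ^ 2 < ε ^ 2 := by
      refine this.trans_lt ?_
      calc 2 * (hdotNormSq s (fun x => v x - φ n x) + hdotNormSq s (fun x => v x - φ m x))
          < 2 * (ε ^ 2 / 4 + ε ^ 2 / 4) := by
            refine ENNReal.mul_lt_mul_right two_ne_zero (by simp) ?_
            exact ENNReal.add_lt_add (hN n hn) (hN m hm)
        _ = ε ^ 2 := by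
            rw [← two_mul, ← mul_assoc, show (2 : ℝ≥0∞) * 2 = 4 by norm_num]
            exact ENNReal.mul_div_cancel (by simp) (by simp)
    exact lt_of_not_ge fun hle => absurd hlt (not_lt.2 (pow_le_pow_left' hle 2))
  obtain ⟨G, hG⟩ := cauchySeq_tendsto_of_complete hcau
  have hGm : MemLp (G : Sp d → ℝ) 2 := Lp.memLp G
  have hlimG : Tendsto (fun n => eLpNorm (fracLap (s / 2) (φ n) - (G : Sp d → ℝ)) 2 volume) atTop (𝓝 0) := by
    have := tendsto_iff_edist_tendsto_0.1 hG
    refine this.congr fun n => ?_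
    rw [Lp.edist_def]
    exact eLpNorm_congr_ae ((ha (hφ n)).coeFn_toLp.sub (ae_eq_refl _))
  have hpassG : ∀ {h : Sp d → ℝ}, MemLp h 2 →
      Tendsto (fun n => ∫ x, fracLap (s / 2) (φ n) x * h x) atTop (𝓝 (∫ x, G x * h x)) := fun hh =>
    tendsto_integral_mul_of_tendsto_eLpNorm (fun n => ha (hφ n)) hGm hh hlimG
  have hgG : ∀ᵐ x, g x = G x := by
    refine ae_eq_of_integral_contDiff_smul_eq hg.1 (hGm.locallyIntegrable one_le_two)
      fun ψ hψ1 hψ2 => ?_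
    have hψ : IsTest ψ := ⟨hψ1, hψ2⟩
    have l1 := hpassG (hψ.memLp 2)
    have l2 := hpass (hψ.memLp_fracLap h0' h1' hqr1)
    simp_rw [(hφ _).integral_fracLap_mul hψ h0' h1'] at l1
    have := tendsto_nhds_unique l1 l2
    simp_rw [smul_eq_mul, mul_comm (ψ _)]
    rw [this, (hg.2 ψ hψ).2]
  have l1 := hpassG (ha hχ)
  have l2 := hpass (hχ.memLp_fracLap h0 h1 hqr1)
  simp_rw [(hφ _).integral_fracLap_half_mul hχ h0 h1] at l1
  rw [← tendsto_nhds_unique l1 l2]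
  exact integral_congr_ae (hgG.mono fun x hx => by simp only [hx])

end Energy

/-! ### Distributional derivatives in time -/

section WeakDerivative

lemma exists_subset_Ioo_of_isCompact {K : Set ℝ} (hK : IsCompact K) (h : K ⊆ Ioi 0) :
    ∃ a b, 0 < a ∧ a < b ∧ K ⊆ Ioo a b := by
  rcases K.eq_empty_or_nonempty with rfl | hne
  · exact ⟨1, 2, one_pos, one_lt_two, empty_subset _⟩
  · obtain ⟨l, hl⟩ := hK.exists_isLeast hne
    obtain ⟨g, hg⟩ := hK.exists_isGreatest hne
    have hl0 : 0 < l := h hl.1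
    have hlg : l ≤ g := hl.2 hg.1
    exact ⟨l / 2, g + 1, by linarith, by linarith, fun x hx =>
      ⟨by linarith [hl.2 hx], by linarith [hg.2 hx]⟩⟩

lemma integral_Ioi_eq_intervalIntegral {f : ℝ → ℝ} {a b : ℝ} (ha : 0 < a) (hab : a < b)
    (hf : ∀ t, t ∉ Ioo a b → f t = 0) : ∫ t in Ioi (0 : ℝ), f t = ∫ t in a..b, f t := by
  rw [intervalIntegral.integral_of_le hab.le]
  refine (setIntegral_eq_of_subset_of_forall_sdiff_eq_zero measurableSet_Ioi
    (fun t ht => ha.trans ht.1) fun t ht => hf t fun h => ht.2 ⟨h.1, h.2.le⟩)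

/-- A function whose distributional derivative on `(0,∞)` is the locally integrable function `-A`
is almost everywhere a primitive of `-A`. -/
lemma exists_ae_eq_sub_integral_of_weak_deriv {F A : ℝ → ℝ} (hF : LocallyIntegrableOn F (Ioi 0))
    (hA : ∀ a b, 0 < a → 0 < b → IntervalIntegrable A volume a b)
    (h : ∀ θ : ℝ → ℝ, ContDiff ℝ ∞ θ → HasCompactSupport θ → tsupport θ ⊆ Ioi 0 →
      ∫ t in Ioi (0 : ℝ), deriv θ t * F t = ∫ t in Ioi (0 : ℝ), θ t * A t) :
    ∃ c, ∀ᵐ t ∂(volume.restrict (Ioi (0 : ℝ))), F t = c - ∫ τ in (1 : ℝ)..t, A τ := by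
  let H : ℝ → ℝ := fun t => ∫ τ in (1 : ℝ)..t, A τ
  have hHc : ContinuousOn H (Ioi 0) := by
    intro t ht
    have ht0 : (0 : ℝ) < t := ht
    have hmin : 0 < min 1 (t / 2) := by positivity
    have hmax : 0 < max 1 (t + 1) := by positivity
    have := intervalIntegral.continuousOn_primitive_interval'
      (hA (min 1 (t / 2)) (max 1 (t + 1)) hmin hmax) (a := 1)
      ⟨inf_le_left.trans (min_le_left _ _), (le_max_left _ _).trans le_sup_right⟩
    refine (this.continuousAt ?_).continuousWithinAt
    rw [uIcc_of_le ((min_le_left _ _).trans (le_max_left _ _))]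
    exact Icc_mem_nhds ((min_le_right _ _).trans_lt (by linarith))
      ((lt_add_one t).trans_le (le_max_right _ _))
  have hHl : LocallyIntegrableOn H (Ioi 0) := hHc.locallyIntegrableOn measurableSet_Ioi
  have hparts : ∀ θ : ℝ → ℝ, ContDiff ℝ ∞ θ → HasCompactSupport θ → tsupport θ ⊆ Ioi 0 →
      ∫ t in Ioi (0 : ℝ), θ t * A t = - ∫ t in Ioi (0 : ℝ), deriv θ t * H t := by
    intro θ hθ hθc hθs
    obtain ⟨a, b, ha, hab, hsub⟩ := exists_subset_Ioo_of_isCompact hθc hθs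
    have hz : ∀ t, t ∉ Ioo a b → θ t = 0 := fun t ht =>
      image_eq_zero_of_notMem_tsupport fun h => ht (hsub h)
    have hz' : ∀ t, t ∉ Ioo a b → deriv θ t = 0 := fun t ht =>
      image_eq_zero_of_notMem_tsupport fun h => ht (hsub (tsupport_deriv_subset h))
    rw [integral_Ioi_eq_intervalIntegral ha hab fun t ht => by rw [hz t ht, zero_mul],
      integral_Ioi_eq_intervalIntegral ha hab fun t ht => by rw [hz' t ht, zero_mul]]
    have hAab := hA a b ha (ha.trans hab)
    -- The base point 1 of `H` may lie outside `[a,b]`, where absolute continuity is needed. Moving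
    -- it to `a` changes `H` by a constant, which is invisible because `θ'` has integral zero.
    let H' : ℝ → ℝ := fun t => ∫ τ in a..t, A τ
    have hH' : AbsolutelyContinuousOnInterval H' a b :=
      hAab.absolutelyContinuousOnInterval_intervalIntegral (c := a) left_mem_uIcc
    have hθAC : AbsolutelyContinuousOnInterval θ a b :=
      (hθ.of_le (by simp)).contDiffOn.absolutelyContinuousOnInterval
    have ibp := hθAC.integral_mul_deriv_eq_deriv_mul hH'
    rw [hz a (by simp), hz b (by simp), zero_mul, zero_mul, sub_zero, zero_sub] at ibp
    have e1 : ∫ t in a..b, θ t * deriv H' t = ∫ t in a..b, θ t * A t := by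
      refine intervalIntegral.integral_congr_ae ?_
      filter_upwards [hAab.ae_hasDerivAt_integral] with t ht htm
      rw [(ht (uIoc_subset_uIcc htm) a left_mem_uIcc).deriv]
    have e2 : ∫ t in a..b, deriv θ t * H t = ∫ t in a..b, deriv θ t * H' t := by
      have hd : ∫ t in a..b, deriv θ t = 0 := by
        rw [intervalIntegral.integral_deriv_eq_sub' θ rfl
          (fun t _ => (hθ.differentiable (by simp)) t)
          (hθ.continuous_deriv (by simp)).continuousOn, hz a (by simp), hz b (by simp), sub_zero]
      have hHH' : ∀ t ∈ uIcc a b, deriv θ t * H t =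
          deriv θ t * H' t + deriv θ t * H a := by
        intro t ht
        rw [uIcc_of_le hab.le] at ht
        have : H t = H a + H' t := (intervalIntegral.integral_add_adjacent_intervals
          (hA 1 a one_pos ha) (hA a t ha (ha.trans_le ht.1))).symm
        rw [this]; ring
      rw [intervalIntegral.integral_congr hHH', intervalIntegral.integral_add,
        intervalIntegral.integral_mul_const, hd, zero_mul, add_zero]
      · exact ((hθ.continuous_deriv (by simp)).continuousOn.mul hH'.continuousOn).intervalIntegrable
      · exact ((hθ.continuous_deriv (by simp)).mul_const _).intervalIntegrable _ _
    rw [e2, ← e1, ibp]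
  let K : ℝ → ℝ := fun t => F t + H t
  have hKl : LocallyIntegrableOn K (Ioi 0) := hF.add hHl
  have hint : ∀ {f k : ℝ → ℝ}, Continuous f → HasCompactSupport f → tsupport f ⊆ Ioi 0 →
      LocallyIntegrableOn k (Ioi 0) → IntegrableOn (fun t => f t * k t) (Ioi 0) := by
    intro f k hf hfc hfs hk
    have h1 : IntegrableOn (fun t => f t * k t) (tsupport f) :=
      (hk.integrableOn_compact_subset hfs hfc).continuousOn_mul hf.continuousOn hfc
    have h2 : Integrable fun t => f t * k t := by
      rw [← integrableOn_iff_integrable_of_support_subset (s := tsupport f)]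
      · exact h1
      · exact fun t ht => subset_tsupport f (left_ne_zero_of_mul ht)
    exact h2.integrableOn
  have hK0 : ∀ θ : ℝ → ℝ, ContDiff ℝ ∞ θ → HasCompactSupport θ → tsupport θ ⊆ Ioi 0 →
      ∫ t in Ioi (0 : ℝ), deriv θ t * K t = 0 := by
    intro θ h1 h2 h3
    have hdc := h1.continuous_deriv (by simp)
    have hdcs := h2.deriv
    have hds := (tsupport_deriv_subset (f := θ)).trans h3
    have := integral_add (hint hdc hdcs hds hF) (hint hdc hdcs hds hHl)
    simp only [K, mul_add]
    rw [this, h θ h1 h2 h3, hparts θ h1 h2 h3, neg_add_cancel]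
  -- Centre 2 and outer radius 1 keep the support in `[1,3]`, inside `(0,∞)`.
  let β : ContDiffBump (2 : ℝ) := ⟨1 / 2, 1, by norm_num, by norm_num⟩
  let η₀ : ℝ → ℝ := β.normed volume
  have hη₀s : ContDiff ℝ ∞ η₀ := β.contDiff_normed
  have hη₀c : HasCompactSupport η₀ := β.hasCompactSupport_normed
  have hη₀t : tsupport η₀ ⊆ Ioi 0 := by
    rw [β.tsupport_normed_eq, Real.closedBall_eq_Icc]
    intro t ht
    have : (2 : ℝ) - 1 ≤ t := ht.1
    exact mem_Ioi.2 (by linarith)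
  have hη₀i : ∫ t, η₀ t = 1 := β.integral_normed
  refine ⟨∫ t in Ioi (0 : ℝ), η₀ t * K t, ?_⟩
  set c := ∫ t in Ioi (0 : ℝ), η₀ t * K t with hc
  -- Du Bois-Reymond: `η - (∫ η) η₀` has integral zero, so its primitive `θ` is again a test
  -- function on `(0,∞)`, and `K = F + H` is orthogonal to `θ'`.
  have key : ∀ η : ℝ → ℝ, ContDiff ℝ ∞ η → HasCompactSupport η → tsupport η ⊆ Ioi 0 →
      ∫ t in Ioi (0 : ℝ), η t * K t = (∫ t, η t) * c := by
    intro η h1 h2 h3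
    let ζ : ℝ → ℝ := fun t => η t - (∫ t, η t) * η₀ t
    have hζs : ContDiff ℝ ∞ ζ := h1.sub (contDiff_const.mul hη₀s)
    obtain ⟨a, b, ha, hab, hsub⟩ := exists_subset_Ioo_of_isCompact (h2.isCompact.union hη₀c.isCompact)
      (union_subset h3 hη₀t)
    have hζz : ∀ t, t ∉ Ioo a b → ζ t = 0 := by
      intro t ht
      have e1 : η t = 0 := image_eq_zero_of_notMem_tsupport fun h => ht (hsub (Or.inl h))
      have e2 : η₀ t = 0 := image_eq_zero_of_notMem_tsupport fun h => ht (hsub (Or.inr h))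
      simp [ζ, e1, e2]
    have hζi : ∫ t in a..b, ζ t = 0 := by
      have hsup : ∀ t, t ∉ Ioc a b → ζ t = 0 := fun t ht => hζz t fun h => ht ⟨h.1, h.2.le⟩
      rw [intervalIntegral.integral_of_le hab.le,
        setIntegral_eq_integral_of_forall_compl_eq_zero hsup]
      simp only [ζ]
      rw [integral_sub (h1.continuous.integrable_of_hasCompactSupport h2)
        ((hη₀s.continuous.integrable_of_hasCompactSupport hη₀c).const_mul _), integral_const_mul,
        hη₀i, mul_one, sub_self]
    let θ : ℝ → ℝ := fun t => ∫ τ in a..t, ζ τ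
    have hζii : ∀ x y, IntervalIntegrable ζ volume x y := fun x y =>
      hζs.continuous.intervalIntegrable x y
    have hθd : ∀ t, HasDerivAt θ (ζ t) t := fun t =>
      intervalIntegral.integral_hasDerivAt_right (hζii a t)
        (hζs.continuous.stronglyMeasurableAtFilter _ _) hζs.continuous.continuousAt
    have hθderiv : deriv θ = ζ := funext fun t => (hθd t).deriv
    have hθs : ContDiff ℝ ∞ θ := contDiff_infty_iff_deriv.2
      ⟨fun t => (hθd t).differentiableAt, by rw [hθderiv]; exact hζs⟩
    have hθz : ∀ t, t ∉ Icc a b → θ t = 0 := by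
      intro t ht
      rcases lt_or_ge t a with hta | hta
      · refine intervalIntegral.integral_zero_ae (ae_of_all _ fun τ hτ => hζz τ ?_)
        rw [uIoc_of_ge hta.le] at hτ
        exact fun h => absurd h.1 (not_lt.2 hτ.2)
      · have htb : b < t := not_le.1 fun h => ht ⟨hta, h⟩
        have e : θ t = (∫ τ in a..b, ζ τ) + ∫ τ in b..t, ζ τ :=
          (intervalIntegral.integral_add_adjacent_intervals (hζii _ _) (hζii _ _)).symm
        rw [e, hζi, zero_add]
        refine intervalIntegral.integral_zero_ae (ae_of_all _ fun τ hτ => hζz τ ?_)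
        rw [uIoc_of_le htb.le] at hτ
        exact fun h => absurd h.2 (not_lt.2 hτ.1.le)
    have hθsub : Function.support θ ⊆ Icc a b := fun t ht => by
      by_contra hn
      exact ht (hθz t hn)
    have hθt : tsupport θ ⊆ Icc a b := closure_minimal hθsub isClosed_Icc
    have hθc : HasCompactSupport θ := HasCompactSupport.of_support_subset_isCompact isCompact_Icc hθsub
    have := hK0 θ hθs hθc (hθt.trans fun t ht => ha.trans_le ht.1)
    rw [hθderiv] at this
    simp only [ζ, sub_mul, mul_assoc] at this
    rw [integral_sub (hint h1.continuous h2 h3 hKl)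
      ((hint hη₀s.continuous hη₀c hη₀t hKl).const_mul _), integral_const_mul, ← hc] at this
    linarith
  have hae := isOpen_Ioi.ae_eq_zero_of_integral_contDiff_smul_eq_zero (μ := volume)
    (f := fun t => K t - c) (U := Ioi (0 : ℝ))
    (hKl.sub ((locallyIntegrable_const c).locallyIntegrableOn _)) (by
      intro η h1 h2 h3
      have e : ∫ t, η t • (K t - c) = ∫ t in Ioi (0 : ℝ), η t • (K t - c) := by
        rw [setIntegral_eq_integral_of_forall_compl_eq_zero]
        intro t ht
        rw [image_eq_zero_of_notMem_tsupport (f := η) fun h => ht (h3 h), zero_smul]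
      have e' : ∫ t in Ioi (0 : ℝ), η t = ∫ t, η t :=
        setIntegral_eq_integral_of_forall_compl_eq_zero fun t ht =>
          image_eq_zero_of_notMem_tsupport fun h => ht (h3 h)
      rw [e]
      simp only [smul_eq_mul, mul_sub]
      rw [integral_sub (hint h1.continuous h2 h3 hKl)
        ((h1.continuous.integrable_of_hasCompactSupport h2).integrableOn.mul_const c),
        integral_mul_const, e', key η h1 h2 h3, sub_self])
  rw [ae_restrict_iff' measurableSet_Ioi]
  filter_upwards [hae] with t ht htm
  have := ht htm
  simp only [K, H] at this
  linarith

end WeakDerivative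

/-! ### From weak solutions to flows of measures -/

section DiffusionFlow

variable {d : ℕ}

/-- A family of measures `lam t`, `t > 0`, evolving by `∂ₜ lam + (-Δ)^s W = 0`, with uniformly
bounded masses and with `W ≥ 0` locally integrable in time against the weight `(1 + |x|)^{-γ}`. -/
structure IsDiffusionFlow [NeZero d] (s γ : ℝ) (W : Sp d → ℝ → ℝ) (lam : ℝ → Measure (Sp d)) :
    Prop where
  nonneg : ∀ᵐ z : Sp d × ℝ ∂(volume.prod (volume.restrict (Ioi (0 : ℝ)))), 0 ≤ W z.1 z.2
  integrable : ∀ a b : ℝ, 0 < a → a < b →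
    Integrable (fun z : Sp d × ℝ => W z.1 z.2 * (1 + ‖z.1‖) ^ (-γ))
      (volume.prod (volume.restrict (Ioo a b)))
  mass_le : ∃ M : ℝ≥0, ∀ᵐ t ∂(volume.restrict (Ioi (0 : ℝ))), lam t univ ≤ M
  evolution : ∀ χ : Sp d → ℝ, IsTest χ → ∃ c : ℝ, ∀ᵐ t ∂(volume.restrict (Ioi (0 : ℝ))),
    ∫ x, χ x ∂(lam t) = c - ∫ τ in (1 : ℝ)..t, ∫ x, W x τ * fracLap s χ x

lemma volume_restrict_univ_prod (S : Set ℝ) :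
    (volume : Measure (Sp d × ℝ)).restrict (univ ×ˢ S) = volume.prod (volume.restrict S) := by
  rw [Measure.volume_eq_prod, ← Measure.prod_restrict, Measure.restrict_univ]

lemma ae_ae_swap_of_ae_prod {α β : Type*} [MeasurableSpace α] [MeasurableSpace β] {μ : Measure α}
    {ν : Measure β} [SFinite μ] [SFinite ν] {p : α × β → Prop} (h : ∀ᵐ z ∂(μ.prod ν), p z) :
    ∀ᵐ y ∂ν, ∀ᵐ x ∂μ, p (x, y) :=
  Measure.ae_ae_of_ae_prod (p := fun z : β × α => p z.swap)
    (Measure.measurePreserving_swap.quasiMeasurePreserving.ae h)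

/-- Divided by the weight, `h` becomes a bounded multiplier. -/
lemma Integrable.mul_of_weight {γ : ℝ} {W : Sp d → ℝ → ℝ} {ν : Measure ℝ} [SFinite ν]
    (hW : Integrable (fun z : Sp d × ℝ => W z.1 z.2 * (1 + ‖z.1‖) ^ (-γ)) (volume.prod ν))
    {h : Sp d → ℝ} (hm : Measurable h) {C : ℝ} (hC : ∀ x, |h x| ≤ C * (1 + ‖x‖) ^ (-γ)) :
    Integrable (fun z : Sp d × ℝ => W z.1 z.2 * h z.1) (volume.prod ν) := by
  have hpos : ∀ x : Sp d, 0 < (1 + ‖x‖) ^ (-γ) := fun x => by positivity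
  have hmw : Measurable fun x : Sp d => (1 + ‖x‖) ^ (-γ) := by fun_prop
  have := hW.mul_bdd (c := C) (g := fun z : Sp d × ℝ => h z.1 / (1 + ‖z.1‖) ^ (-γ))
    ((hm.div hmw).comp measurable_fst).aestronglyMeasurable (ae_of_all _ fun z => by
      rw [norm_div, Real.norm_eq_abs, Real.norm_of_nonneg (hpos _).le, div_le_iff₀ (hpos _)]
      exact hC z.1)
  refine this.congr (ae_of_all _ fun z => ?_)
  simp only
  rw [mul_assoc, mul_div_cancel₀ _ (hpos _).ne']

lemma IsTest.mul_const {φ : Sp d → ℝ} (h : IsTest φ) (c : ℝ) : IsTest fun x => φ x * c :=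
  ⟨h.1.mul contDiff_const, h.2.mul_right⟩

/-- Inside the unit ball `(1 + |x|)^{-γ} ≤ 1 ≤ |x|^{-γ₀}`; outside, `|x| ≤ 1 + |x|`. This replaces
`ρ` by a smooth weight in all tail estimates. -/
lemma WeightBounds.rpow_le {γ₀ γ : ℝ} {ρ : Sp d → ℝ} (hρ : WeightBounds γ₀ γ ρ) [NeZero d]
    (hγ0 : 0 ≤ γ) (hγ₀0 : 0 ≤ γ₀) :
    ∃ K, 0 < K ∧ ∀ᵐ x : Sp d, (1 + ‖x‖) ^ (-γ) ≤ K * ρ x := by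
  obtain ⟨c, C, hc, -, h⟩ := hρ
  refine ⟨c⁻¹, inv_pos.2 hc, ?_⟩
  -- At the origin `‖x‖ ^ (-γ₀)` has the default value 0 unless `γ₀ = 0`, so the comparison with 1
  -- fails there.
  have hne : ∀ᵐ x : Sp d, x ≠ 0 := by
    rw [ae_iff]; simp
  filter_upwards [h, hne] with x hx hx0
  have hxp : 0 < ‖x‖ := norm_pos_iff.2 hx0
  rw [← div_eq_inv_mul, le_div_iff₀ hc, mul_comm]
  rcases lt_or_ge ‖x‖ 1 with h1 | h1
  · refine le_trans ?_ (hx.1 h1).1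
    gcongr
    exact (Real.rpow_le_one_of_one_le_of_nonpos (by linarith) (by linarith)).trans
      (Real.one_le_rpow_of_pos_of_le_one_of_nonpos hxp h1.le (by linarith))
  · refine le_trans (mul_le_mul_of_nonneg_left ?_ hc.le) (hx.2 h1).1
    exact Real.rpow_le_rpow_of_nonpos hxp (by linarith) (by linarith)

lemma weightMeasure_absolutelyContinuous (ρ : Sp d → ℝ) : weightMeasure ρ ≪ volume :=
  withDensity_absolutelyContinuous _ _

/-- The measure `u(·,t) ρ dx`. -/
noncomputable def flowMeasure (ρ : Sp d → ℝ) (u : Sp d → ℝ → ℝ) (t : ℝ) : Measure (Sp d) :=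
  (weightMeasure ρ).withDensity fun x => ENNReal.ofReal (u x t)

lemma flowMeasure_univ (ρ : Sp d → ℝ) (u : Sp d → ℝ → ℝ) (t : ℝ) :
    flowMeasure ρ u t univ = ∫⁻ x, ENNReal.ofReal (u x t) ∂(weightMeasure ρ) := by
  unfold flowMeasure
  rw [withDensity_apply _ MeasurableSet.univ, Measure.restrict_univ]

lemma integral_flowMeasure {ρ : Sp d → ℝ} {u : Sp d → ℝ → ℝ} {t : ℝ}
    (hm : AEStronglyMeasurable (fun x => u x t) (weightMeasure ρ))
    (h0 : ∀ᵐ x, 0 ≤ u x t) (f : Sp d → ℝ) :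
    ∫ x, f x ∂(flowMeasure ρ u t) = ∫ x, f x * u x t ∂(weightMeasure ρ) := by
  unfold flowMeasure
  rw [integral_withDensity_eq_integral_toReal_smul₀ hm.aemeasurable.ennreal_ofReal
    (ae_of_all _ fun _ => ENNReal.ofReal_lt_top)]
  refine integral_congr_ae ?_
  filter_upwards [(weightMeasure_absolutelyContinuous ρ).ae_le h0] with x hx
  rw [ENNReal.toReal_ofReal hx, smul_eq_mul, mul_comm]

lemma integral_weightMeasure {ρ : Sp d → ℝ} (hρm : AEMeasurable ρ volume)
    (h0 : ∀ᵐ x, 0 ≤ ρ x) (f : Sp d → ℝ) :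
    ∫ x, f x ∂(weightMeasure ρ) = ∫ x, f x * ρ x := by
  unfold weightMeasure
  rw [integral_withDensity_eq_integral_toReal_smul₀ hρm.ennreal_ofReal
    (ae_of_all _ fun _ => ENNReal.ofReal_lt_top)]
  refine integral_congr_ae ?_
  filter_upwards [h0] with x hx
  rw [ENNReal.toReal_ofReal hx, smul_eq_mul, mul_comm]

variable [NeZero d]

lemma IsTest.fracLap_mul_const {φ : Sp d → ℝ} (h : IsTest φ) {σ : ℝ} (h0 : 0 < σ) (h1 : σ < 1)
    (c : ℝ) (x : Sp d) : fracLap σ (fun y => φ y * c) x = c * fracLap σ φ x := by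
  rw [(h.mul_const c).fracLap_eq h0 h1, h.fracLap_eq h0 h1, mul_left_comm]
  congr 1
  unfold sdLap
  rw [← integral_const_mul]
  congr 1; ext z
  unfold secondDiff; ring

lemma IsTest.abs_fracLap_le_weight {φ : Sp d → ℝ} (h : IsTest φ) {s γ : ℝ} (h0 : 0 < s)
    (h1 : s < 1) (hγ : γ ≤ d + 2 * s) :
    ∃ C, 0 ≤ C ∧ ∀ x, |fracLap s φ x| ≤ C * (1 + ‖x‖) ^ (-γ) := by
  obtain ⟨C, hC0, hC⟩ := h.abs_fracLap_le h0 h1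
  refine ⟨C, hC0, fun x => (hC x).trans ?_⟩
  gcongr
  linarith [norm_nonneg x]

/-- The tensor product of a test function in space and one in time. -/
lemma IsTest.isSpaceTimeTest_mul {χ : Sp d → ℝ} (hχ : IsTest χ) {θ : ℝ → ℝ}
    (hθ : ContDiff ℝ ∞ θ) (hθc : HasCompactSupport θ) (hθs : tsupport θ ⊆ Ioi 0) :
    IsSpaceTimeTest fun z : Sp d × ℝ => χ z.1 * θ z.2 := by
  have hsub : Function.support (fun z : Sp d × ℝ => χ z.1 * θ z.2) ⊆ tsupport χ ×ˢ tsupport θ :=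
    fun z hz => ⟨subset_tsupport _ (left_ne_zero_of_mul hz),
      subset_tsupport _ (right_ne_zero_of_mul hz)⟩
  refine ⟨(hχ.1.comp contDiff_fst).mul (hθ.comp contDiff_snd),
    HasCompactSupport.of_support_subset_isCompact (hχ.2.isCompact.prod hθc.isCompact) hsub, ?_⟩
  refine (closure_minimal hsub ((isClosed_tsupport χ).prod (isClosed_tsupport θ))).trans ?_
  exact prod_mono (subset_univ _) hθs

variable {s m γ : ℝ} {ρ : Sp d → ℝ} {u : Sp d → ℝ → ℝ}

lemma IsWeakSolution.ae_good (hu : IsWeakSolution s m ρ u) :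
    ∃ M : ℝ≥0, ∀ᵐ t ∂(volume.restrict (Ioi (0 : ℝ))),
      AEStronglyMeasurable (fun x => u x t) (weightMeasure ρ) ∧ (∀ᵐ x, 0 ≤ u x t) ∧
        ∫⁻ x, ‖u x t‖ₑ ∂(weightMeasure ρ) ≤ M := by
  obtain ⟨M, hM⟩ := hu.linftyL1
  have hn := hu.nonneg
  rw [volume_restrict_univ_prod] at hn
  refine ⟨M, ?_⟩
  filter_upwards [hM, ae_ae_swap_of_ae_prod hn] with t h1 h2
  exact ⟨h1.1, h2, h1.2⟩

lemma flowMeasure_univ_le (ρ : Sp d → ℝ) (u : Sp d → ℝ → ℝ) (t : ℝ) :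
    flowMeasure ρ u t univ ≤ ∫⁻ x, ‖u x t‖ₑ ∂(weightMeasure ρ) := by
  rw [flowMeasure_univ]
  refine lintegral_mono fun x => ?_
  rw [← ofReal_norm]
  exact ENNReal.ofReal_le_ofReal (le_abs_self _)

/-- Either alternative makes `u^m` integrable in space-time, away from `t = 0`, against the
weight. -/
lemma IsWeakSolution.integrable_rpow (hu : IsWeakSolution s m ρ u) (hm : 1 < m)
    (hρm : AEMeasurable ρ volume) {K : ℝ} (hK0 : 0 < K)
    (hK : ∀ᵐ x : Sp d, (1 + ‖x‖) ^ (-γ) ≤ K * ρ x)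
    (hb : BoundedAwayFromZero u ∨ PowerTimeIntegrable m ρ u) {a b : ℝ} (ha : 0 < a)
    (hab : a < b) :
    Integrable (fun z : Sp d × ℝ => u z.1 z.2 ^ m * (1 + ‖z.1‖) ^ (-γ))
      (volume.prod (volume.restrict (Ioo a b))) := by
  have hsub : Ioo a b ⊆ Ioi (0 : ℝ) := fun t ht => ha.trans ht.1
  have hle : (volume : Measure (Sp d)).prod (volume.restrict (Ioo a b)) ≤
      volume.prod (volume.restrict (Ioi (0 : ℝ))) :=
    Measure.prod_mono le_rfl (Measure.restrict_mono hsub le_rfl)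
  have hum := hu.measurable
  have hun := hu.nonneg
  rw [volume_restrict_univ_prod] at hum hun
  have hum' := (hum.mono_measure hle).aemeasurable
  have hun' : ∀ᵐ z : Sp d × ℝ ∂(volume.prod (volume.restrict (Ioo a b))), 0 ≤ u z.1 z.2 :=
    ae_mono hle hun
  have hmw : Measurable fun z : Sp d × ℝ => (1 + ‖z.1‖) ^ (-γ) := by fun_prop
  have hw0 : ∀ x : Sp d, 0 ≤ (1 + ‖x‖) ^ (-γ) := fun x => by positivity
  have hme : AEMeasurable (fun z : Sp d × ℝ => u z.1 z.2 ^ m * (1 + ‖z.1‖) ^ (-γ))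
      (volume.prod (volume.restrict (Ioo a b))) := (hum'.pow_const m).mul hmw.aemeasurable
  refine ⟨hme.aestronglyMeasurable, ?_⟩
  rw [hasFiniteIntegral_iff_ofReal (hun'.mono fun z hz =>
    mul_nonneg (Real.rpow_nonneg hz m) (hw0 z.1))]
  rcases hb with hb | hb
  · obtain ⟨M₀, hM₀⟩ := hb a ha
    rw [volume_restrict_univ_prod] at hM₀
    have hle2 : (volume : Measure (Sp d)).prod (volume.restrict (Ioo a b)) ≤
        volume.prod (volume.restrict (Ioi a)) :=
      Measure.prod_mono le_rfl (Measure.restrict_mono Ioo_subset_Ioi_self le_rfl)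
    have hM₀' := ae_mono hle2 hM₀
    obtain ⟨M, hM⟩ := hu.ae_good
    -- For bounded `u`, `u^m ≤ |M₀|^{m-1} u` and the weight is at most `K ρ`, so the mass bound on
    -- each time slice concludes.
    set c := |M₀| ^ (m - 1) * K with hc
    have hc0 : 0 ≤ c := by positivity
    have hK' : ∀ᵐ z : Sp d × ℝ ∂(volume.prod (volume.restrict (Ioo a b))),
        (1 + ‖z.1‖) ^ (-γ) ≤ K * ρ z.1 := Measure.quasiMeasurePreserving_fst.ae hK
    have hρ' : AEMeasurable (fun z : Sp d × ℝ => ρ z.1)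
        (volume.prod (volume.restrict (Ioo a b))) :=
      hρm.comp_quasiMeasurePreserving Measure.quasiMeasurePreserving_fst
    have hM' := ae_mono (Measure.restrict_mono hsub (le_refl volume)) hM
    calc ∫⁻ z, ENNReal.ofReal (u z.1 z.2 ^ m * (1 + ‖z.1‖) ^ (-γ))
          ∂(volume.prod (volume.restrict (Ioo a b)))
        ≤ ∫⁻ z, ENNReal.ofReal c * (ENNReal.ofReal (ρ z.1) * ENNReal.ofReal (u z.1 z.2))
            ∂(volume.prod (volume.restrict (Ioo a b))) := by
          refine lintegral_mono_ae ?_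
          filter_upwards [hun', hM₀', hK'] with z hz1 hz2 hz3
          have hρ0 : 0 ≤ ρ z.1 := by
            have := (hw0 z.1).trans hz3
            exact nonneg_of_mul_nonneg_right this hK0
          rw [← ENNReal.ofReal_mul hρ0, ← ENNReal.ofReal_mul hc0]
          refine ENNReal.ofReal_le_ofReal ?_
          have hpow : u z.1 z.2 ^ m ≤ |M₀| ^ (m - 1) * u z.1 z.2 := by
            have e : u z.1 z.2 ^ m = u z.1 z.2 ^ (m - 1) * u z.1 z.2 := by
              rcases eq_or_ne (u z.1 z.2) 0 with h | h
              · rw [h, mul_zero, Real.zero_rpow (by linarith)]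
              · rw [← Real.rpow_add_one h, sub_add_cancel]
            rw [e]
            gcongr
            exact (le_abs_self _).trans (hz2.trans (le_abs_self _))
          calc u z.1 z.2 ^ m * (1 + ‖z.1‖) ^ (-γ)
              ≤ (|M₀| ^ (m - 1) * u z.1 z.2) * (K * ρ z.1) := by gcongr
            _ = c * (ρ z.1 * u z.1 z.2) := by rw [hc]; ring
      _ = ENNReal.ofReal c * ∫⁻ t in Ioo a b, ∫⁻ x, ENNReal.ofReal (ρ x) *
            ENNReal.ofReal (u x t) := by
          rw [lintegral_const_mul' _ _ ENNReal.ofReal_ne_top,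
            lintegral_prod_symm (fun z : Sp d × ℝ => ENNReal.ofReal (ρ z.1) *
              ENNReal.ofReal (u z.1 z.2)) (hρ'.ennreal_ofReal.mul hum'.ennreal_ofReal)]
      _ ≤ ENNReal.ofReal c * ∫⁻ t in Ioo a b, (M : ℝ≥0∞) := by
          refine mul_le_mul_right (lintegral_mono_ae ?_) _
          filter_upwards [hM'] with t ht
          have := (flowMeasure_univ_le ρ u t).trans ht.2.2
          rw [flowMeasure_univ] at this
          unfold weightMeasure at this
          rwa [lintegral_withDensity_eq_lintegral_mul_non_measurable₀ _ hρm.ennreal_ofReal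
            (ae_of_all _ fun _ => ENNReal.ofReal_lt_top)] at this
      _ < ⊤ := by
          rw [setLIntegral_const, Real.volume_Ioo]
          exact ENNReal.mul_lt_top ENNReal.ofReal_lt_top
            (ENNReal.mul_lt_top ENNReal.coe_lt_top ENNReal.ofReal_lt_top)
  · have hfin := hb a b ha hab
    unfold weightMeasure at hfin
    rw [lintegral_withDensity_eq_lintegral_mul_non_measurable₀ _ hρm.ennreal_ofReal
      (ae_of_all _ fun _ => ENNReal.ofReal_lt_top)] at hfin
    rw [lintegral_prod _ hme.ennreal_ofReal]
    calc ∫⁻ x, ∫⁻ t in Ioo a b, ENNReal.ofReal (u x t ^ m * (1 + ‖x‖) ^ (-γ))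
        ≤ ∫⁻ x, ENNReal.ofReal K * (ENNReal.ofReal (ρ x) *
            ∫⁻ t in Ioo a b, ENNReal.ofReal (u x t ^ m)) := by
          refine lintegral_mono_ae ?_
          filter_upwards [hK] with x hx
          simp_rw [ENNReal.ofReal_mul' (hw0 x)]
          rw [lintegral_mul_const' _ _ ENNReal.ofReal_ne_top, mul_comm, ← mul_assoc,
            ← ENNReal.ofReal_mul hK0.le]
          gcongr
      _ < ⊤ := by
          rw [lintegral_const_mul' _ _ ENNReal.ofReal_ne_top]
          exact ENNReal.mul_lt_top ENNReal.ofReal_lt_top hfin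

/-- Separating variables in the test function and moving the half Laplacian from `(-Δ)^{s/2} u^m`
onto `χ` leaves an ordinary weak derivative in time, ready for the du Bois-Reymond lemma. -/
lemma IsWeakSolution.weak_time (hs0 : 0 < s) (hs1 : s < 1) (hd : 2 * s < d)
    (hu : IsWeakSolution s m ρ u) {χ : Sp d → ℝ} (hχ : IsTest χ) {θ : ℝ → ℝ}
    (hθ : ContDiff ℝ ∞ θ) (hθc : HasCompactSupport θ) (hθs : tsupport θ ⊆ Ioi 0) :
    ∫ t in Ioi (0 : ℝ), deriv θ t * ∫ x, χ x * u x t * ρ x =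
      ∫ t in Ioi (0 : ℝ), θ t * ∫ x, u x t ^ m * fracLap s χ x := by
  have h0' : 0 < s / 2 := by positivity
  have h1' : s / 2 < 1 := by linarith
  obtain ⟨g, -, hg, hweak⟩ := hu.weak
  have h := hweak _ (hχ.isSpaceTimeTest_mul hθ hθc hθs)
  have e1 : ∫ t in Ioi (0 : ℝ), ∫ x, u x t * deriv (fun τ => χ x * θ τ) t * ρ x =
      ∫ t in Ioi (0 : ℝ), deriv θ t * ∫ x, χ x * u x t * ρ x := by
    congr 1; ext t
    rw [← integral_const_mul]
    congr 1; ext x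
    rw [deriv_const_mul _ ((hθ.differentiable (by simp)) t)]
    ring
  have e2 : ∫ t in Ioi (0 : ℝ), ∫ x, g x t * fracLap (s / 2) (fun y => χ y * θ t) x =
      ∫ t in Ioi (0 : ℝ), θ t * ∫ x, u x t ^ m * fracLap s χ x := by
    refine integral_congr_ae ?_
    filter_upwards [hg, hu.energy.1] with t ht1 ht2
    rw [← ht2.integral_mul_fracLap_half hs0 hs1 hd ht1 hχ, ← integral_const_mul]
    congr 1; ext x
    rw [hχ.fracLap_mul_const h0' h1']; ring
  rw [e1, e2] at h
  linarith

/-- A weak solution generates a diffusion flow. -/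
lemma IsWeakSolution.isDiffusionFlow (hs0 : 0 < s) (hs1 : s < 1) (hd : 2 * s < d) (hm : 1 < m)
    (hγ2 : γ ≤ d + 2 * s) (hρm : AEMeasurable ρ volume) {K : ℝ} (hK0 : 0 < K)
    (hK : ∀ᵐ x : Sp d, (1 + ‖x‖) ^ (-γ) ≤ K * ρ x) (hu : IsWeakSolution s m ρ u)
    (hb : BoundedAwayFromZero u ∨ PowerTimeIntegrable m ρ u) :
    IsDiffusionFlow s γ (fun x t => u x t ^ m) (flowMeasure ρ u) := by
  have hun := hu.nonneg
  have hum := hu.measurable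
  rw [volume_restrict_univ_prod] at hun hum
  obtain ⟨M, hM⟩ := hu.ae_good
  have hρ0 : ∀ᵐ x, 0 ≤ ρ x := hK.mono fun x hx =>
    nonneg_of_mul_nonneg_right ((by positivity : (0 : ℝ) ≤ (1 + ‖x‖) ^ (-γ)).trans hx) hK0
  have hmass : ∀ᵐ t ∂(volume.restrict (Ioi (0 : ℝ))), flowMeasure ρ u t univ ≤ M :=
    hM.mono fun t ht => (flowMeasure_univ_le ρ u t).trans ht.2.2
  have hint : ∀ a b : ℝ, 0 < a → a < b → _ := fun a b ha hab =>
    hu.integrable_rpow hm hρm hK0 hK hb ha hab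
  refine ⟨hun.mono fun z hz => Real.rpow_nonneg hz m, hint, ⟨M, hmass⟩, fun χ hχ => ?_⟩
  set F : ℝ → ℝ := fun t => ∫ x, χ x * u x t * ρ x with hF
  have hFeq : ∀ᵐ t ∂(volume.restrict (Ioi (0 : ℝ))), ∫ x, χ x ∂(flowMeasure ρ u t) = F t :=
    hM.mono fun t ht => by
      rw [integral_flowMeasure ht.1 ht.2.1, integral_weightMeasure hρm hρ0]
  obtain ⟨B, hB0, hB⟩ := hχ.bounded
  obtain ⟨C, hC0, hC⟩ := hχ.abs_fracLap_le_weight hs0 hs1 hγ2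
  have hFm : AEStronglyMeasurable F (volume.restrict (Ioi (0 : ℝ))) := by
    have h1 : AEStronglyMeasurable (fun z : Sp d × ℝ => χ z.1 * u z.1 z.2 * ρ z.1)
        (volume.prod (volume.restrict (Ioi (0 : ℝ)))) := by
      refine ((hχ.1.continuous.comp continuous_fst).aestronglyMeasurable.mul hum).mul ?_
      exact (hρm.comp_quasiMeasurePreserving
        Measure.quasiMeasurePreserving_fst).aestronglyMeasurable
    exact h1.prod_swap.integral_prod_right'
  have hFb : ∀ᵐ t ∂(volume.restrict (Ioi (0 : ℝ))), ‖F t‖ ≤ B * M := by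
    filter_upwards [hFeq, hmass] with t h1 h2
    rw [← h1]
    have hfin : IsFiniteMeasure (flowMeasure ρ u t) := ⟨h2.trans_lt ENNReal.coe_lt_top⟩
    refine (norm_integral_le_of_norm_le_const (C := B) (ae_of_all _ hB)).trans ?_
    gcongr
    exact ENNReal.toReal_le_coe_of_le_coe h2
  have hFl : LocallyIntegrableOn F (Ioi 0) := by
    intro t ht
    refine ⟨Ioo 0 (t + 1), ?_, ?_⟩
    · rw [← Ioi_inter_Iio]
      exact inter_mem_nhdsWithin _ (Iio_mem_nhds (lt_add_one t))
    · have hr : (volume : Measure ℝ).restrict (Ioo 0 (t + 1)) ≤ volume.restrict (Ioi 0) :=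
        Measure.restrict_mono Ioo_subset_Ioi_self le_rfl
      exact Integrable.of_bound (hFm.mono_measure hr) (B * M) (ae_mono hr hFb)
  have hA : ∀ a b, 0 < a → 0 < b →
      IntervalIntegrable (fun t => ∫ x, u x t ^ m * fracLap s χ x) volume a b := by
    have hA' : ∀ a b, 0 < a → a < b →
        IntervalIntegrable (fun t => ∫ x, u x t ^ m * fracLap s χ x) volume a b := by
      intro a b ha hab
      rw [intervalIntegrable_iff_integrableOn_Ioo_of_le hab.le]
      exact (Integrable.mul_of_weight (W := fun x t => u x t ^ m) (hint a b ha hab)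
        (hχ.continuous_fracLap hs0 hs1).measurable hC).integral_prod_right
    intro a b ha hb
    rcases lt_trichotomy a b with h | h | h
    · exact hA' a b ha h
    · rw [h]
    · exact (hA' b a hb h).symm
  obtain ⟨c, hc⟩ := exists_ae_eq_sub_integral_of_weak_deriv hFl hA fun θ h1 h2 h3 =>
    hu.weak_time hs0 hs1 hd hχ h1 h2 h3
  refine ⟨c, ?_⟩
  filter_upwards [hFeq, hc] with t h1 h2
  rw [h1, h2]

end DiffusionFlow

/-! ### Positivity of the fractional Laplacian of the regularised Riesz kernel -/

section RadialBump

/-- A smooth radially nonincreasing function supported in the closed unit ball. -/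
noncomputable def radialBump (d : ℕ) (x : Sp d) : ℝ := expNegInvGlue (1 - ‖x‖ ^ 2)

variable {d : ℕ}

lemma radialBump_nonneg (x : Sp d) : 0 ≤ radialBump d x := expNegInvGlue.nonneg _

lemma radialBump_pos {x : Sp d} (h : ‖x‖ < 1) : 0 < radialBump d x :=
  expNegInvGlue.pos_of_pos (by nlinarith [norm_nonneg x])

lemma radialBump_eq_zero {x : Sp d} (h : 1 ≤ ‖x‖) : radialBump d x = 0 :=
  expNegInvGlue.zero_of_nonpos (by nlinarith)

lemma radialBump_anti {x y : Sp d} (h : ‖x‖ ≤ ‖y‖) : radialBump d y ≤ radialBump d x :=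
  expNegInvGlue.monotone (by gcongr)

lemma radialBump_le_zero_val (x : Sp d) : radialBump d x ≤ radialBump d 0 :=
  radialBump_anti (by simp)

lemma isTest_radialBump : IsTest (radialBump d) := by
  refine ⟨?_, HasCompactSupport.of_support_subset_isCompact
    (isCompact_closedBall (0 : Sp d) 1) fun x hx => ?_⟩
  · exact (expNegInvGlue.contDiff (n := ⊤)).comp (contDiff_const.sub (contDiff_norm_sq ℝ))
  · rw [mem_closedBall_zero_iff]
    by_contra h
    exact hx (radialBump_eq_zero (not_le.1 h).le)

/-- Rearrangement: translating a radially nonincreasing function decreases its mass in a centred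
ball. -/
lemma setIntegral_radialBump_add_le {R : ℝ} (z : Sp d) :
    ∫ x in Metric.ball (0 : Sp d) R, radialBump d (x + z) ≤
      ∫ x in Metric.ball (0 : Sp d) R, radialBump d x := by
  classical
  set B := Metric.ball (0 : Sp d) R with hB
  have hBm : MeasurableSet B := measurableSet_ball
  have hBf : volume B ≠ ⊤ := measure_ball_lt_top.ne
  -- For `R ≥ 0` this is the value of the bump on the sphere of radius `R`. After subtracting it the
  -- bump is nonnegative in the ball and nonpositive outside, so among all translates of the ball
  -- the centred one collects the largest integral.
  set κ := expNegInvGlue (1 - R ^ 2) with hκ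
  have hi := isTest_radialBump (d := d).integrable
  have hiz : Integrable fun x => radialBump d (x + z) := hi.comp_add_right z
  have hconst : IntegrableOn (fun _ : Sp d => κ) B := integrableOn_const hBf
  suffices h : ∫ x in B, (radialBump d (x + z) - κ) ≤ ∫ x in B, (radialBump d x - κ) by
    rw [integral_sub hiz.integrableOn hconst, integral_sub hi.integrableOn hconst] at h
    linarith
  rw [← integral_indicator hBm, ← integral_indicator hBm,
    ← integral_sub_right_eq_self (B.indicator fun x => radialBump d (x + z) - κ) z]
  refine integral_mono ?_ ((integrable_indicator_iff hBm).2 (hi.integrableOn.sub hconst))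
    fun y => ?_
  · exact ((integrable_indicator_iff hBm).2 (hiz.integrableOn.sub hconst)).comp_sub_right z
  · simp only [indicator_apply, sub_add_cancel]
    by_cases hy : y ∈ B
    · have hyR : ‖y‖ < R := by rwa [hB, mem_ball_zero_iff] at hy
      have : κ ≤ radialBump d y := expNegInvGlue.monotone (by gcongr)
      rw [if_pos hy]
      split_ifs <;> linarith
    · rw [if_neg hy]
      split_ifs with h1
      · have hR0 : 0 ≤ R := by
          rw [hB, mem_ball_zero_iff] at h1; exact (norm_nonneg _).trans h1.le
        have hyR : R ≤ ‖y‖ := by rwa [hB, mem_ball_zero_iff, not_lt] at hy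
        have : radialBump d y ≤ κ := expNegInvGlue.monotone (by gcongr)
        linarith
      · exact le_rfl

lemma setIntegral_secondDiff_radialBump (R : ℝ) (z : Sp d) :
    ∫ x in Metric.ball (0 : Sp d) R, secondDiff (radialBump d) x z =
      2 * (∫ x in Metric.ball (0 : Sp d) R, radialBump d x) -
        (∫ x in Metric.ball (0 : Sp d) R, radialBump d (x + z)) -
        ∫ x in Metric.ball (0 : Sp d) R, radialBump d (x + -z) := by
  have hi := isTest_radialBump (d := d).integrable
  have i1 : IntegrableOn (fun x => radialBump d (x + z)) (Metric.ball (0 : Sp d) R) :=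
    (hi.comp_add_right z).integrableOn
  have i2 : IntegrableOn (fun x => radialBump d (x + -z)) (Metric.ball (0 : Sp d) R) :=
    (hi.comp_add_right (-z)).integrableOn
  have i3 : IntegrableOn (fun x => 2 * radialBump d x) (Metric.ball (0 : Sp d) R) :=
    (hi.const_mul 2).integrableOn
  have i13 : IntegrableOn (fun x => 2 * radialBump d x - radialBump d (x + z))
    (Metric.ball (0 : Sp d) R) := i3.sub i1
  unfold secondDiff
  simp_rw [sub_eq_add_neg _ z]
  rw [integral_sub i13 i2, integral_sub i3 i1, integral_const_mul]

/-- Each of the two translates has at most the mass of the centred bump in the ball. -/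
lemma setIntegral_secondDiff_radialBump_nonneg (R : ℝ) (z : Sp d) :
    0 ≤ ∫ x in Metric.ball (0 : Sp d) R, secondDiff (radialBump d) x z := by
  rw [setIntegral_secondDiff_radialBump]
  have := setIntegral_radialBump_add_le (R := R) z
  have := setIntegral_radialBump_add_le (R := R) (-z)
  linarith

/-- Both translated unit balls miss the ball of radius `R`. This regime supplies the strict part of
the lower bound below. -/
lemma setIntegral_secondDiff_radialBump_of_far {R : ℝ} {z : Sp d} (hz : R + 1 ≤ ‖z‖) :
    ∫ x in Metric.ball (0 : Sp d) R, secondDiff (radialBump d) x z =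
      2 * ∫ x in Metric.ball (0 : Sp d) R, radialBump d x := by
  have hzero : ∀ y : Sp d, R + 1 ≤ ‖y‖ →
      ∫ x in Metric.ball (0 : Sp d) R, radialBump d (x + y) = 0 := by
    intro y hy
    refine setIntegral_eq_zero_of_forall_eq_zero fun x hx => radialBump_eq_zero ?_
    rw [mem_ball_zero_iff] at hx
    have := norm_sub_norm_le y (-x)
    rw [norm_neg, sub_neg_eq_add, add_comm y x] at this
    linarith
  rw [setIntegral_secondDiff_radialBump, hzero z hz, hzero (-z) (by rwa [norm_neg])]
  ring

variable [NeZero d]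

/-- On the ball of radius `1/2` the bump is at least its value at that radius, so the volume of the
smaller ball gives the bound. -/
lemma setIntegral_radialBump_ge :
    ∃ c, 0 < c ∧ ∀ R : ℝ, 0 < R →
      c * min R (1 / 2) ^ d ≤ ∫ x in Metric.ball (0 : Sp d) R, radialBump d x := by
  set κ := expNegInvGlue (1 - (1 / 2 : ℝ) ^ 2) with hκ
  have hκ0 : 0 < κ := expNegInvGlue.pos_of_pos (by norm_num)
  set Ω := (volume : Measure (Sp d)).real (Metric.ball 0 1) with hΩ
  have hΩ0 : 0 < Ω := ENNReal.toReal_pos (Metric.measure_ball_pos _ _ one_pos).ne'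
    measure_ball_lt_top.ne
  have hi := isTest_radialBump (d := d).integrable
  refine ⟨κ * Ω, by positivity, fun R hR => ?_⟩
  have hmin : 0 < min R (1 / 2) := by positivity
  have hv : (volume : Measure (Sp d)).real (Metric.ball 0 (min R (1 / 2))) =
      min R (1 / 2) ^ d * Ω := by
    rw [measureReal_def, Measure.addHaar_ball _ _ hmin.le, ENNReal.toReal_mul,
      ENNReal.toReal_ofReal (by positivity), finrank_euclideanSpace_fin]
    rfl
  calc κ * Ω * min R (1 / 2) ^ d
      = ∫ _ in Metric.ball (0 : Sp d) (min R (1 / 2)), κ := by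
        rw [setIntegral_const, hv, smul_eq_mul]; ring
    _ ≤ ∫ x in Metric.ball (0 : Sp d) (min R (1 / 2)), radialBump d x := by
        refine setIntegral_mono_on (integrableOn_const measure_ball_lt_top.ne) hi.integrableOn
          measurableSet_ball fun x hx => ?_
        rw [mem_ball_zero_iff] at hx
        have : ‖x‖ < 1 / 2 := hx.trans_le (min_le_right _ _)
        exact expNegInvGlue.monotone (by gcongr)
    _ ≤ _ := setIntegral_mono_set hi.integrableOn (ae_of_all _ radialBump_nonneg)
        (Metric.ball_subset_ball (min_le_left _ _)).eventuallyLE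

/-- The fractional Laplacian of a radially nonincreasing bump has positive mass in every centred
ball, with a quantitative lower bound. -/
lemma setIntegral_sdLap_radialBump_ge {s : ℝ} (h0 : 0 < s) (h1 : s < 1) :
    ∃ c, 0 < c ∧ ∀ R : ℝ, 0 < R → c * (min R (1 / 2) ^ d * (1 + R) ^ (-(2 * s))) ≤
      ∫ x in Metric.ball (0 : Sp d) R, sdLap s (radialBump d) x := by
  obtain ⟨c₁, hc₁, hR₁⟩ := setIntegral_radialBump_ge (d := d)
  set Ω := (volume : Measure (Sp d)).real (Metric.ball 0 1) with hΩ
  have hΩ0 : 0 < Ω := ENNReal.toReal_pos (Metric.measure_ball_pos _ _ one_pos).ne'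
    measure_ball_lt_top.ne
  set α := (d : ℝ) + 2 * s with hα
  have hα0 : 0 < α := by positivity
  refine ⟨c₁ * (3 ^ (-α) * Ω), by positivity, fun R hR => ?_⟩
  set B := Metric.ball (0 : Sp d) R with hB
  set I := ∫ x in B, radialBump d x with hI
  have hI0 : 0 ≤ I := integral_nonneg fun _ => radialBump_nonneg _
  have hprod : Integrable (fun p : Sp d × Sp d =>
      secondDiff (radialBump d) p.1 p.2 / (2 * ‖p.2‖ ^ α)) ((volume.restrict B).prod volume) :=
    (isTest_radialBump.integrable_prod_secondDiff_div h0 h1).mono_measure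
      (Measure.prod_mono Measure.restrict_le_self le_rfl)
  let k : Sp d → ℝ := fun z => (∫ x in B, secondDiff (radialBump d) x z) / (2 * ‖z‖ ^ α)
  have hk : ∀ z, ∫ x in B, secondDiff (radialBump d) x z / (2 * ‖z‖ ^ α) = k z := fun z =>
    integral_div _ _
  have e : ∫ x in B, sdLap s (radialBump d) x = ∫ z, k z := by
    simp_rw [← hk]
    exact integral_integral_swap hprod
  have hki : Integrable k := by
    have := hprod.integral_prod_right
    simpa only [hk] using this
  have hk0 : ∀ z, 0 ≤ k z := fun z =>
    div_nonneg (setIntegral_secondDiff_radialBump_nonneg R z) (by positivity)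
  set a := 1 + R with ha
  have ha0 : 0 < a := by positivity
  -- The ball of radius `a = 1 + R` about `p` lies in `a ≤ |z| ≤ 3a`, where the translates miss the
  -- ball and the kernel is at least `(3a)^{-α}`. Its volume is of order `a^d`, which leaves
  -- `a^{-2s}`; the rest of the integral is nonnegative and is dropped.
  let p : Sp d := EuclideanSpace.single 0 (2 * a)
  have hp : ‖p‖ = 2 * a := by simp [p, abs_of_pos ha0]
  have hv : (volume : Measure (Sp d)).real (Metric.ball p a) = a ^ d * Ω := by
    rw [measureReal_def, Measure.addHaar_ball _ _ ha0.le, ENNReal.toReal_mul,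
      ENNReal.toReal_ofReal (by positivity), finrank_euclideanSpace_fin]
    rfl
  have hlow : ∀ z ∈ Metric.ball p a, I * (3 * a) ^ (-α) ≤ k z := by
    intro z hz
    rw [mem_ball_iff_norm] at hz
    have hz1 : a ≤ ‖z‖ := by
      have := norm_sub_norm_le p z
      rw [norm_sub_rev] at this
      linarith
    have hz2 : ‖z‖ ≤ 3 * a := by
      have := norm_sub_norm_le z p
      linarith
    simp only [k]
    rw [setIntegral_secondDiff_radialBump_of_far (by rw [add_comm]; exact hz1),
      mul_div_mul_left _ _ two_ne_zero, div_eq_mul_inv, ← Real.rpow_neg (norm_nonneg z)]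
    exact mul_le_mul_of_nonneg_left
      (Real.rpow_le_rpow_of_nonpos (ha0.trans_le hz1) hz2 (by linarith)) hI0
  calc c₁ * (3 ^ (-α) * Ω) * (min R (1 / 2) ^ d * a ^ (-(2 * s)))
      = (c₁ * min R (1 / 2) ^ d) * (3 ^ (-α) * a ^ (-(2 * s)) * Ω) := by ring
    _ ≤ I * (3 ^ (-α) * a ^ (-(2 * s)) * Ω) := by
        gcongr
        exact hR₁ R hR
    _ = ∫ _ in Metric.ball p a, I * (3 * a) ^ (-α) := by
        rw [setIntegral_const, hv, smul_eq_mul, Real.mul_rpow (by norm_num) ha0.le]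
        have : a ^ (-(2 * s)) = a ^ d * a ^ (-α) := by
          rw [← Real.rpow_natCast a d, ← Real.rpow_add ha0, hα]; congr 1; ring
        rw [this]; ring
    _ ≤ ∫ z in Metric.ball p a, k z :=
        setIntegral_mono_on (integrableOn_const measure_ball_lt_top.ne) hki.integrableOn
          measurableSet_ball hlow
    _ ≤ ∫ z, k z := setIntegral_le_integral hki (ae_of_all _ hk0)
    _ = _ := e.symm

lemma sdLap_radialBump_eq_of_norm_eq {s : ℝ} {x y : Sp d} (h : ‖x‖ = ‖y‖) :
    sdLap s (radialBump d) x = sdLap s (radialBump d) y := by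
  obtain ⟨A, hA⟩ := exists_isometry_map_eq h
  unfold sdLap
  rw [← hA, ← integral_comp_isometry A
    (fun z => secondDiff (radialBump d) (A x) z / (2 * ‖z‖ ^ ((d : ℝ) + 2 * s)))]
  congr 1; ext z
  simp only [secondDiff, ← map_add, ← map_sub, radialBump, A.norm_map]

/-- Integration in polar coordinates, in the form of a superposition of dilates of a radial
function. -/
lemma setIntegral_ball_eq_integral_dilates {f : Sp d → ℝ}
    (hf : ∀ x y : Sp d, ‖x‖ = ‖y‖ → f x = f y) {L : ℝ} (hL : 0 < L) {x : Sp d} (hx : x ≠ 0) :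
    ∫ y in Metric.ball (0 : Sp d) (‖x‖ / L), f y =
      d * (volume : Measure (Sp d)).real (Metric.ball 0 1) * ‖x‖ ^ d *
        ∫ r in Ioi L, r ^ (-1 - (d : ℝ)) * f (r⁻¹ • x) := by
  classical
  have hd : 1 ≤ d := Nat.one_le_iff_ne_zero.mpr (NeZero.ne d)
  have hxp : 0 < ‖x‖ := norm_pos_iff.2 hx
  let e : Sp d := ‖x‖⁻¹ • x
  have he : ‖e‖ = 1 := by simp [e, norm_smul, hxp.ne']
  let F : ℝ → ℝ := fun y => (Iio (‖x‖ / L)).indicator (fun y => f (y • e)) y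
  have h1 : ∫ y in Metric.ball (0 : Sp d) (‖x‖ / L), f y = ∫ y : Sp d, F ‖y‖ := by
    rw [← integral_indicator measurableSet_ball]
    congr 1; ext y
    simp only [F, indicator_apply, mem_ball_zero_iff, mem_Iio]
    split_ifs
    · exact hf _ _ (by rw [norm_smul, he, mul_one, norm_norm])
    · rfl
  -- The substitution `y = |x| / r` maps the radii `0 < y < |x|/L` onto `r > L`; the indicator in
  -- `F` carries the cutoff through it.
  have h2 : ∫ y in Ioi (0 : ℝ), y ^ (d - 1) • F y =
      ‖x‖ ^ d * ∫ r in Ioi L, r ^ (-1 - (d : ℝ)) * f (r⁻¹ • x) := by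
    have hscale := integral_comp_mul_left_Ioi' (fun y : ℝ => y ^ (d - 1) • F y) 0 hxp
    rw [mul_zero] at hscale
    rw [← hscale, ← integral_comp_rpow_Ioi _ (by norm_num : (-1 : ℝ) ≠ 0), smul_eq_mul,
      ← integral_const_mul, ← integral_const_mul,
      ← integral_indicator measurableSet_Ioi, ← integral_indicator measurableSet_Ioi]
    congr 1; ext r
    simp only [indicator_apply, mem_Ioi]
    by_cases hr : 0 < r
    · have hiff : ‖x‖ * r ^ (-1 : ℝ) < ‖x‖ / L ↔ L < r := by
        rw [Real.rpow_neg_one, ← div_eq_mul_inv, div_lt_div_iff_of_pos_left hxp hr hL]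
      simp only [F, indicator_apply, mem_Iio, hiff, if_pos hr]
      split_ifs with hLr
      · have hxr : (‖x‖ * r ^ (-1 : ℝ)) • e = r⁻¹ • x := by
          rw [Real.rpow_neg_one, mul_comm, mul_smul]
          simp only [e]
          rw [smul_inv_smul₀ hxp.ne']
        have hrp : r ^ (-1 - (d : ℝ)) = r ^ (-2 : ℝ) * (r⁻¹) ^ (d - 1) := by
          rw [← Real.rpow_natCast (r⁻¹), Real.inv_rpow hr.le, ← Real.rpow_neg hr.le,
            ← Real.rpow_add hr, Nat.cast_sub hd]
          congr 1; push_cast; ring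
        have hxd : ‖x‖ ^ d = ‖x‖ * ‖x‖ ^ (d - 1) := by
          rw [← pow_succ', Nat.sub_add_cancel hd]
        rw [hxr, hrp, hxd, Real.rpow_neg_one, mul_pow]
        norm_num
        ring
      · simp
    · have hLr : ¬ L < r := fun h => hr (hL.trans h)
      simp [hr, hLr]
  rw [h1, integral_fun_norm_addHaar, finrank_euclideanSpace_fin, h2, nsmul_eq_mul, smul_eq_mul]
  ring

/-- The superposition `∫_L^∞ r^{-1-d} ((-Δ)^s φ)(x / r) dr` for a radially nonincreasing bump `φ`,
which is the fractional Laplacian of a regularised Riesz kernel. -/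
noncomputable def potentialSource (d : ℕ) [NeZero d] (s L : ℝ) (x : Sp d) : ℝ :=
  ∫ r in Ioi L, r ^ (-1 - (d : ℝ)) * fracLap s (radialBump d) (r⁻¹ • x)

/-- Polar coordinates reduce this to the mass of `(-Δ)^s φ` in the ball of radius `R = |x|/L`. There
`min(R, 1/2) ≥ R / (2(1 + R))`, and the factor `R^d = |x|^d L^{-d}` cancels the `|x|^d` of the polar
formula. -/
lemma potentialSource_ge {s : ℝ} (h0 : 0 < s) (h1 : s < 1) :
    ∃ c, 0 < c ∧ ∀ L : ℝ, 0 < L → ∀ x : Sp d, x ≠ 0 →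
      c * (L ^ (-(d : ℝ)) * (1 + ‖x‖ / L) ^ (-((d : ℝ) + 2 * s))) ≤ potentialSource d s L x := by
  obtain ⟨c₁, hc₁, hR₁⟩ := setIntegral_sdLap_radialBump_ge (d := d) h0 h1
  have hd : 1 ≤ d := Nat.one_le_iff_ne_zero.mpr (NeZero.ne d)
  have hd0 : (0 : ℝ) < d := by exact_mod_cast hd
  set Ω := (volume : Measure (Sp d)).real (Metric.ball 0 1) with hΩ
  have hΩ0 : 0 < Ω := ENNReal.toReal_pos (Metric.measure_ball_pos _ _ one_pos).ne'
    measure_ball_lt_top.ne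
  have hn := normConst_pos (d := d) h0 h1
  refine ⟨normConst d s * (c₁ * (1 / 2) ^ d) / (d * Ω), by positivity, fun L hL x hx => ?_⟩
  have hxp : 0 < ‖x‖ := norm_pos_iff.2 hx
  have key := setIntegral_ball_eq_integral_dilates (f := sdLap s (radialBump d))
    (fun x y h => sdLap_radialBump_eq_of_norm_eq h) hL hx
  set R := ‖x‖ / L with hR
  have hRp : 0 < R := by positivity
  have hps : potentialSource d s L x =
      normConst d s * ∫ r in Ioi L, r ^ (-1 - (d : ℝ)) * sdLap s (radialBump d) (r⁻¹ • x) := by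
    unfold potentialSource
    rw [← integral_const_mul]
    congr 1; ext r
    rw [isTest_radialBump.fracLap_eq h0 h1]; ring
  set J := ∫ r in Ioi L, r ^ (-1 - (d : ℝ)) * sdLap s (radialBump d) (r⁻¹ • x) with hJ
  have hge := hR₁ R hRp
  rw [key] at hge
  have hmin : R * (1 / 2 * (1 + R)⁻¹) ≤ min R (1 / 2) := by
    have h1R : 0 < 1 + R := by positivity
    refine le_min ?_ ?_
    · refine mul_le_of_le_one_right hRp.le ?_
      have : (1 + R)⁻¹ ≤ 1 := inv_le_one_of_one_le₀ (by linarith)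
      linarith
    · have : R * (1 + R)⁻¹ ≤ 1 := by rw [← div_eq_mul_inv, div_le_one h1R]; linarith
      linarith
  have hmin' : R ^ d * ((1 / 2) ^ d * ((1 + R)⁻¹) ^ d) ≤ min R (1 / 2) ^ d := by
    rw [← mul_pow, ← mul_pow]
    gcongr
  have hsplit : (1 + R) ^ (-((d : ℝ) + 2 * s)) = ((1 + R)⁻¹) ^ d * (1 + R) ^ (-(2 * s)) := by
    rw [neg_add, Real.rpow_add (by positivity), Real.rpow_neg (by positivity), Real.rpow_natCast,
      inv_pow]
  have hRd : R ^ d = ‖x‖ ^ d * L ^ (-(d : ℝ)) := by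
    rw [hR, div_pow, Real.rpow_neg hL.le, Real.rpow_natCast, div_eq_mul_inv]
  have hfin : (c₁ * (1 / 2) ^ d) * (L ^ (-(d : ℝ)) * (1 + R) ^ (-((d : ℝ) + 2 * s))) ≤
      d * Ω * J := by
    have hxd : 0 < ‖x‖ ^ d := by positivity
    refine le_of_mul_le_mul_left ?_ hxd
    calc ‖x‖ ^ d * ((c₁ * (1 / 2) ^ d) * (L ^ (-(d : ℝ)) * (1 + R) ^ (-((d : ℝ) + 2 * s))))
        = c₁ * ((R ^ d * ((1 / 2) ^ d * ((1 + R)⁻¹) ^ d)) * (1 + R) ^ (-(2 * s))) := by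
          rw [hsplit, hRd]; ring
      _ ≤ c₁ * (min R (1 / 2) ^ d * (1 + R) ^ (-(2 * s))) := by gcongr
      _ ≤ _ := hge
      _ = ‖x‖ ^ d * (d * Ω * J) := by ring
  rw [hps]
  calc normConst d s * (c₁ * (1 / 2) ^ d) / (d * Ω) *
        (L ^ (-(d : ℝ)) * (1 + R) ^ (-((d : ℝ) + 2 * s)))
      = normConst d s * (((c₁ * (1 / 2) ^ d) *
          (L ^ (-(d : ℝ)) * (1 + R) ^ (-((d : ℝ) + 2 * s)))) / (d * Ω)) := by ring
    _ ≤ normConst d s * J := by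
        gcongr
        rw [div_le_iff₀ (by positivity)]
        linarith

end RadialBump

/-! ### Dilated bumps -/

section ScaledBump

variable {d : ℕ}

/-- The radial bump dilated to the ball of radius `r`. -/
noncomputable def scaledBump (d : ℕ) (r : ℝ) (x : Sp d) : ℝ := radialBump d (r⁻¹ • x)

lemma scaledBump_nonneg (r : ℝ) (x : Sp d) : 0 ≤ scaledBump d r x := radialBump_nonneg _

lemma scaledBump_le (r : ℝ) (x : Sp d) : scaledBump d r x ≤ radialBump d 0 :=
  radialBump_le_zero_val _

lemma norm_scaledBump_le (r : ℝ) (x : Sp d) : ‖scaledBump d r x‖ ≤ radialBump d 0 := by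
  rw [Real.norm_of_nonneg (scaledBump_nonneg r x)]; exact scaledBump_le r x

lemma scaledBump_mono {r r' : ℝ} (hr : 0 < r) (h : r ≤ r') (x : Sp d) :
    scaledBump d r x ≤ scaledBump d r' x := by
  refine radialBump_anti ?_
  rw [norm_smul, norm_smul, Real.norm_of_nonneg (inv_nonneg.2 (hr.le.trans h)),
    Real.norm_of_nonneg (inv_nonneg.2 hr.le)]
  gcongr

lemma IsTest.comp_inv_smul {φ : Sp d → ℝ} (h : IsTest φ) {r : ℝ} (hr : 0 < r) :
    IsTest fun x => φ (r⁻¹ • x) :=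
  ⟨h.1.comp (contDiff_const_smul _), h.2.comp_smul (inv_ne_zero hr.ne')⟩

lemma isTest_scaledBump {r : ℝ} (hr : 0 < r) : IsTest (scaledBump d r) :=
  isTest_radialBump.comp_inv_smul hr

lemma continuous_scaledBump (r : ℝ) : Continuous (scaledBump d r) :=
  isTest_radialBump.1.continuous.comp (continuous_const_smul _)

lemma integrable_scaledBump (r : ℝ) (ν : Measure (Sp d)) [IsFiniteMeasure ν] :
    Integrable (scaledBump d r) ν :=
  Integrable.of_bound (continuous_scaledBump r).aestronglyMeasurable _
    (ae_of_all _ (norm_scaledBump_le r))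

lemma integral_scaledBump_le (r : ℝ) (ν : Measure (Sp d)) [IsFiniteMeasure ν] :
    ∫ x, scaledBump d r x ∂ν ≤ radialBump d 0 * ν.real univ := by
  refine (integral_mono (integrable_scaledBump r ν) (integrable_const _)
    (scaledBump_le r)).trans_eq ?_
  rw [integral_const, smul_eq_mul, mul_comm]

lemma integral_scaledBump_nonneg (r : ℝ) (ν : Measure (Sp d)) :
    0 ≤ ∫ x, scaledBump d r x ∂ν :=
  integral_nonneg (scaledBump_nonneg r)

lemma tendsto_scaledBump (x : Sp d) :
    Tendsto (fun r => scaledBump d r x) atTop (𝓝 (radialBump d 0)) := by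
  refine (isTest_radialBump.1.continuous.tendsto 0).comp ?_
  simpa using (tendsto_inv_atTop_zero (𝕜 := ℝ)).smul_const x

lemma tendsto_integral_scaledBump (ν : Measure (Sp d)) [IsFiniteMeasure ν] :
    Tendsto (fun r => ∫ x, scaledBump d r x ∂ν) atTop (𝓝 (radialBump d 0 * ν.real univ)) := by
  have : radialBump d 0 * ν.real univ = ∫ _ : Sp d, radialBump d 0 ∂ν := by
    rw [integral_const, smul_eq_mul, mul_comm]
  rw [this]
  exact tendsto_integral_filter_of_dominated_convergence (fun _ => radialBump d 0)
    (Eventually.of_forall fun r => (continuous_scaledBump r).aestronglyMeasurable)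
    (Eventually.of_forall fun r => ae_of_all _ (norm_scaledBump_le r)) (integrable_const _)
    (ae_of_all _ tendsto_scaledBump)

lemma continuousOn_integral_scaledBump (ν : Measure (Sp d)) [IsFiniteMeasure ν] :
    ContinuousOn (fun r => ∫ x, scaledBump d r x ∂ν) (Ioi 0) := by
  intro r hr
  refine tendsto_integral_filter_of_dominated_convergence (fun _ => radialBump d 0)
    (Eventually.of_forall fun r => (continuous_scaledBump r).aestronglyMeasurable)
    (Eventually.of_forall fun r => ae_of_all _ (norm_scaledBump_le r)) (integrable_const _)
    (ae_of_all _ fun x => ?_)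
  have : ContinuousAt (fun r : ℝ => scaledBump d r x) r :=
    isTest_radialBump.1.continuous.continuousAt.comp
      ((continuousAt_inv₀ (ne_of_gt hr)).smul continuousAt_const)
  exact this.continuousWithinAt

variable [NeZero d]

lemma IsTest.fracLap_comp_inv_smul {φ : Sp d → ℝ} (h : IsTest φ) {s : ℝ} (h0 : 0 < s)
    (h1 : s < 1) {r : ℝ} (hr : 0 < r) (x : Sp d) :
    fracLap s (fun y => φ (r⁻¹ • y)) x = r ^ (-(2 * s)) * fracLap s φ (r⁻¹ • x) := by
  rw [(h.comp_inv_smul hr).fracLap_eq h0 h1, h.fracLap_eq h0 h1, mul_left_comm]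
  congr 1
  have e : ∀ z : Sp d, secondDiff (fun y => φ (r⁻¹ • y)) x z / (2 * ‖z‖ ^ ((d : ℝ) + 2 * s)) =
      (fun z => r ^ (-((d : ℝ) + 2 * s)) *
        (secondDiff φ (r⁻¹ • x) z / (2 * ‖z‖ ^ ((d : ℝ) + 2 * s)))) (r⁻¹ • z) := by
    intro z
    have hz : ‖z‖ = r * ‖r⁻¹ • z‖ := by
      rw [norm_smul, Real.norm_of_nonneg (by positivity), mul_inv_cancel_left₀ hr.ne']
    have hrr : r ^ ((d : ℝ) + 2 * s) ≠ 0 := (Real.rpow_pos_of_pos hr _).ne'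
    simp only [secondDiff, smul_add, smul_sub]
    rw [hz, Real.mul_rpow hr.le (norm_nonneg _), Real.rpow_neg hr.le, div_eq_mul_inv,
      div_eq_mul_inv, mul_left_comm 2, mul_inv]
    ring
  unfold sdLap
  have hint := Measure.integral_comp_inv_smul_of_nonneg (E := Sp d) volume
    (fun z => r ^ (-((d : ℝ) + 2 * s)) *
      (secondDiff φ (r⁻¹ • x) z / (2 * ‖z‖ ^ ((d : ℝ) + 2 * s)))) hr.le
  refine (integral_congr_ae (ae_of_all _ e)).trans (hint.trans ?_)
  rw [integral_const_mul, smul_eq_mul, finrank_euclideanSpace_fin, ← mul_assoc,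
    ← Real.rpow_natCast, ← Real.rpow_add hr]
  congr 2
  ring

lemma fracLap_scaledBump {s : ℝ} (h0 : 0 < s) (h1 : s < 1) {r : ℝ} (hr : 0 < r) (x : Sp d) :
    fracLap s (scaledBump d r) x = r ^ (-(2 * s)) * fracLap s (radialBump d) (r⁻¹ • x) :=
  isTest_radialBump.fracLap_comp_inv_smul h0 h1 hr x

/-- Passing to a weight independent of `r` costs `r^γ` for `r ≥ 1`, since `1 + |x|/r ≥ (1 +
|x|)/max(1,r)`. This power is weighed against `r^{-1-d}` in the potential and against `r^{-2s}` in
the conservation of mass. -/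
lemma abs_fracLap_radialBump_smul_le {s γ : ℝ} (h0 : 0 < s) (h1 : s < 1) (hγ0 : 0 ≤ γ)
    (hγ : γ ≤ d + 2 * s) :
    ∃ C, 0 ≤ C ∧ ∀ r : ℝ, 0 < r → ∀ x : Sp d,
      |fracLap s (radialBump d) (r⁻¹ • x)| ≤ C * max 1 r ^ γ * (1 + ‖x‖) ^ (-γ) := by
  obtain ⟨C, hC0, hC⟩ := (isTest_radialBump (d := d)).abs_fracLap_le_weight h0 h1 hγ
  refine ⟨C, hC0, fun r hr x => (hC _).trans ?_⟩
  rw [mul_assoc]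
  refine mul_le_mul_of_nonneg_left ?_ hC0
  rw [norm_smul, Real.norm_of_nonneg (by positivity)]
  have hm : 0 < max 1 r := by positivity
  have key : (max 1 r)⁻¹ * (1 + ‖x‖) ≤ 1 + r⁻¹ * ‖x‖ := by
    rw [mul_add, mul_one]
    gcongr
    · exact inv_le_one_of_one_le₀ (le_max_left _ _)
    · exact le_max_right _ _
  calc (1 + r⁻¹ * ‖x‖) ^ (-γ) ≤ ((max 1 r)⁻¹ * (1 + ‖x‖)) ^ (-γ) :=
        Real.rpow_le_rpow_of_nonpos (by positivity) key (by linarith)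
    _ = max 1 r ^ γ * (1 + ‖x‖) ^ (-γ) := by
        rw [Real.mul_rpow (by positivity) (by positivity), Real.inv_rpow hm.le,
          Real.rpow_neg hm.le, inv_inv]

end ScaledBump

/-! ### Monotone potential, control of test functions and conservation of mass -/

section Transition

variable {d : ℕ} [NeZero d]

/-- The measures `ν₁` and `ν₂` satisfy `ν₁ - ν₂ = (-Δ)^s V` when tested against the functions of
the family `T`, where `V ≥ 0` is integrable against `(1 + |x|)^{-γ}`. -/
def IsTransition (s γ : ℝ) (T : Set (Sp d → ℝ)) (V : Sp d → ℝ) (ν₁ ν₂ : Measure (Sp d)) : Prop :=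
  0 ≤ᵐ[volume] V ∧ Integrable (fun x => V x * (1 + ‖x‖) ^ (-γ)) ∧
    ∀ χ ∈ T, ∫ x, χ x ∂ν₁ - ∫ x, χ x ∂ν₂ = ∫ x, V x * fracLap s χ x

lemma integrable_mul_of_abs_le_weight {γ : ℝ} {V : Sp d → ℝ}
    (hV : Integrable (fun x => V x * (1 + ‖x‖) ^ (-γ))) {h : Sp d → ℝ} (hm : Measurable h) {C : ℝ}
    (hC : ∀ x, |h x| ≤ C * (1 + ‖x‖) ^ (-γ)) : Integrable fun x => V x * h x := by
  have hpos : ∀ x : Sp d, 0 < (1 + ‖x‖) ^ (-γ) := fun x => by positivity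
  have hmw : Measurable fun x : Sp d => (1 + ‖x‖) ^ (-γ) := by fun_prop
  have := hV.mul_bdd (c := C) (g := fun x => h x / (1 + ‖x‖) ^ (-γ))
    (hm.div hmw).aestronglyMeasurable (ae_of_all _ fun x => by
      rw [norm_div, Real.norm_eq_abs, Real.norm_of_nonneg (hpos _).le, div_le_iff₀ (hpos _)]
      exact hC x)
  refine this.congr (ae_of_all _ fun x => ?_)
  simp only
  rw [mul_assoc, mul_div_cancel₀ _ (hpos _).ne']

variable {s γ : ℝ} {T : Set (Sp d → ℝ)} {V : Sp d → ℝ} {ν₁ ν₂ : Measure (Sp d)}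

/-- The weighted average over `r > L` of the masses of `ν` seen by the bumps of radius `r`. -/
noncomputable def bumpPotential (s L : ℝ) (ν : Measure (Sp d)) : ℝ :=
  ∫ r in Ioi L, r ^ (-1 - (d : ℝ) + 2 * s) * ∫ x, scaledBump d r x ∂ν

/-- The identity extends from rational logarithmic radii to all radii, by continuity. -/
lemma IsTransition.integral_scaledBump_sub (h : IsTransition s γ T V ν₁ ν₂) (h0 : 0 < s) (h1 : s < 1)
    (hγ0 : 0 ≤ γ) (hγ : γ ≤ d + 2 * s) [IsFiniteMeasure ν₁] [IsFiniteMeasure ν₂]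
    (hT : ∀ q : ℚ, scaledBump d (Real.exp q) ∈ T) {r : ℝ} (hr : 0 < r) :
    ∫ x, scaledBump d r x ∂ν₁ - ∫ x, scaledBump d r x ∂ν₂ =
      r ^ (-(2 * s)) * ∫ x, V x * fracLap s (radialBump d) (r⁻¹ • x) := by
  obtain ⟨C, hC0, hC⟩ := abs_fracLap_radialBump_smul_le (d := d) h0 h1 hγ0 hγ
  have hfc := (isTest_radialBump (d := d)).continuous_fracLap h0 h1
  have hcont : ∀ ν : Measure (Sp d), IsFiniteMeasure ν →
      Continuous fun a : ℝ => ∫ x, scaledBump d (Real.exp a) x ∂ν := fun ν _ =>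
    (continuousOn_integral_scaledBump ν).comp_continuous Real.continuous_exp Real.exp_pos
  have hcV : Continuous fun a : ℝ =>
      ∫ x, V x * fracLap s (radialBump d) ((Real.exp a)⁻¹ • x) := by
    rw [continuous_iff_continuousAt]
    intro a
    -- Bounding the radii from above makes the factor `max 1 r ^ γ` uniform, which yields one
    -- dominating function.
    have hev : ∀ᶠ b in 𝓝 a, b < a + 1 := Iio_mem_nhds (lt_add_one a)
    refine tendsto_integral_filter_of_dominated_convergence
      (fun x => C * max 1 (Real.exp (a + 1)) ^ γ * ‖V x * (1 + ‖x‖) ^ (-γ)‖) ?_ ?_ ?_ ?_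
    · refine Eventually.of_forall fun b => ?_
      exact (integrable_mul_of_abs_le_weight h.2.1
        (hfc.comp (continuous_const_smul _)).measurable
        (hC (Real.exp b) (Real.exp_pos b))).aestronglyMeasurable
    · filter_upwards [hev] with b hb
      refine ae_of_all _ fun x => ?_
      rw [norm_mul, norm_mul, Real.norm_of_nonneg (by positivity : (0 : ℝ) ≤ (1 + ‖x‖) ^ (-γ)),
        mul_left_comm]
      refine mul_le_mul_of_nonneg_left ((hC _ (Real.exp_pos b) x).trans ?_) (norm_nonneg _)
      gcongr
    · exact h.2.1.norm.const_mul _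
    · refine ae_of_all _ fun x => ?_
      have : ContinuousAt (fun a : ℝ => V x * fracLap s (radialBump d) ((Real.exp a)⁻¹ • x)) a :=
        continuousAt_const.mul (hfc.continuousAt.comp
          ((Real.continuous_exp.continuousAt.inv₀ (Real.exp_ne_zero a)).smul continuousAt_const))
      exact this
  have hL : Continuous fun a : ℝ => ∫ x, scaledBump d (Real.exp a) x ∂ν₁ -
      ∫ x, scaledBump d (Real.exp a) x ∂ν₂ := (hcont ν₁ inferInstance).sub (hcont ν₂ inferInstance)
  have hR : Continuous fun a : ℝ => Real.exp a ^ (-(2 * s)) *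
      ∫ x, V x * fracLap s (radialBump d) ((Real.exp a)⁻¹ • x) :=
    (Real.continuous_exp.rpow_const fun a => Or.inl (Real.exp_ne_zero a)).mul hcV
  have heq := (Rat.denseRange_cast (𝕜 := ℝ)).equalizer hL hR (funext fun q => by
    simp only [Function.comp_apply]
    rw [h.2.2 _ (hT q), ← integral_const_mul]
    congr 1; ext x
    rw [fracLap_scaledBump h0 h1 (Real.exp_pos _)]
    ring)
  simpa only [Real.exp_log hr] using! congrFun heq (Real.log r)

lemma integrableOn_rpow_mul_integral_scaledBump (hd : 2 * s < d) {L : ℝ} (hL : 0 < L)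
    (ν : Measure (Sp d)) [IsFiniteMeasure ν] :
    IntegrableOn (fun r => r ^ (-1 - (d : ℝ) + 2 * s) * ∫ x, scaledBump d r x ∂ν)
      (Ioi L) := by
  refine (integrableOn_Ioi_rpow_of_lt (by linarith) hL).mul_bdd
    (c := radialBump d 0 * ν.real univ) ?_ (ae_of_all _ fun r => ?_)
  · exact ((continuousOn_integral_scaledBump ν).mono (Ioi_subset_Ioi hL.le)).aestronglyMeasurable
      measurableSet_Ioi
  · rw [Real.norm_of_nonneg (integral_scaledBump_nonneg r ν)]
    exact integral_scaledBump_le r ν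

lemma bumpPotential_le (hd : 2 * s < d) {L : ℝ} (hL : 0 < L) (ν : Measure (Sp d))
    [IsFiniteMeasure ν] :
    bumpPotential s L ν ≤
      (∫ r in Ioi L, r ^ (-1 - (d : ℝ) + 2 * s)) * (radialBump d 0 * ν.real univ) := by
  unfold bumpPotential
  rw [← integral_mul_const]
  refine setIntegral_mono_on (integrableOn_rpow_mul_integral_scaledBump hd hL ν)
    ((integrableOn_Ioi_rpow_of_lt (by linarith) hL).mul_const _) measurableSet_Ioi fun r hr => ?_
  have hr0 : 0 < r := hL.trans hr
  gcongr
  exact integral_scaledBump_le r ν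

/-- The bumps increase with the radius, so the smallest one, of radius `L`, bounds all others from
below. With the upper bound by the mass, this determines the mass as `L → ∞` after division by the
common radial integral. -/
lemma le_bumpPotential (hd : 2 * s < d) {L : ℝ} (hL : 0 < L) (ν : Measure (Sp d))
    [IsFiniteMeasure ν] :
    (∫ r in Ioi L, r ^ (-1 - (d : ℝ) + 2 * s)) * ∫ x, scaledBump d L x ∂ν ≤
      bumpPotential s L ν := by
  unfold bumpPotential
  rw [← integral_mul_const]
  refine setIntegral_mono_on ((integrableOn_Ioi_rpow_of_lt (by linarith) hL).mul_const _)
    (integrableOn_rpow_mul_integral_scaledBump hd hL ν) measurableSet_Ioi fun r hr => ?_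
  have hr0 : 0 < r := hL.trans hr
  gcongr
  · exact integrable_scaledBump L ν
  · exact integrable_scaledBump r ν
  · exact fun x => scaledBump_mono hL (le_of_lt hr) x

/-- For `r > L ≥ 1` the dilated fractional Laplacian is at most a constant times `r^γ (1 +
|x|)^{-γ}`, and `r^{-1-d+γ}` is integrable at infinity because `γ < d`. -/
lemma integrable_prod_potentialSource (hV : Integrable (fun x => V x * (1 + ‖x‖) ^ (-γ)))
    (h0 : 0 < s) (h1 : s < 1) (hγ0 : 0 ≤ γ) (hγ : γ < d) {L : ℝ} (hL : 1 ≤ L) :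
    Integrable (fun z : Sp d × ℝ => V z.1 *
      (z.2 ^ (-1 - (d : ℝ)) * fracLap s (radialBump d) (z.2⁻¹ • z.1)))
      (volume.prod (volume.restrict (Ioi L))) := by
  have hL0 : 0 < L := one_pos.trans_le hL
  obtain ⟨C, hC0, hC⟩ := abs_fracLap_radialBump_smul_le (d := d) h0 h1 hγ0
    (by linarith : γ ≤ d + 2 * s)
  have hfc := (isTest_radialBump (d := d)).continuous_fracLap h0 h1
  have hr : IntegrableOn (fun r : ℝ => r ^ (-1 - (d : ℝ) + γ)) (Ioi L) :=
    integrableOn_Ioi_rpow_of_lt (by linarith) hL0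
  have hprod := Integrable.mul_prod hV hr
  have hmem : ∀ᵐ z : Sp d × ℝ ∂(volume.prod (volume.restrict (Ioi L))), L < z.2 :=
    Measure.quasiMeasurePreserving_snd.ae (ae_restrict_mem measurableSet_Ioi)
  have hm : Measurable fun z : Sp d × ℝ => fracLap s (radialBump d) (z.2⁻¹ • z.1) /
      (z.2 ^ γ * (1 + ‖z.1‖) ^ (-γ)) := by
    refine (hfc.measurable.comp ((measurable_snd.inv).smul measurable_fst)).div ?_
    fun_prop
  refine (hprod.mul_bdd (c := C) hm.aestronglyMeasurable ?_).congr ?_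
  · filter_upwards [hmem] with z hz
    have hz0 : 0 < z.2 := hL0.trans hz
    have hp : 0 < z.2 ^ γ * (1 + ‖z.1‖) ^ (-γ) := by positivity
    rw [norm_div, Real.norm_of_nonneg hp.le, div_le_iff₀ hp, Real.norm_eq_abs, ← mul_assoc]
    refine (hC z.2 hz0 z.1).trans_eq ?_
    rw [max_eq_right (hL.trans hz.le)]
  · filter_upwards [hmem] with z hz
    have hz0 : 0 < z.2 := hL0.trans hz
    have hp1 : z.2 ^ γ ≠ 0 := by positivity
    have hp2 : (1 + ‖z.1‖) ^ (-γ) ≠ 0 := by positivity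
    rw [Real.rpow_add hz0]
    field_simp

lemma integrable_mul_potentialSource (hV : Integrable (fun x => V x * (1 + ‖x‖) ^ (-γ)))
    (h0 : 0 < s) (h1 : s < 1) (hγ0 : 0 ≤ γ) (hγ : γ < d) {L : ℝ} (hL : 1 ≤ L) :
    Integrable fun x => V x * potentialSource d s L x := by
  refine (integrable_prod_potentialSource hV h0 h1 hγ0 hγ hL).integral_prod_left.congr
    (ae_of_all _ fun x => ?_)
  simp only
  rw [integral_const_mul]
  rfl

/-- Each radius contributes a factor `r^{-2s}` by scaling, which lowers `r^{-1-d+2s}` to `r^{-1-d}`;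
Fubini then assembles `potentialSource`. -/
lemma IsTransition.bumpPotential_sub (h : IsTransition s γ T V ν₁ ν₂) (h0 : 0 < s) (h1 : s < 1)
    (hd : 2 * s < d) (hγ0 : 0 ≤ γ) (hγ : γ < d) [IsFiniteMeasure ν₁] [IsFiniteMeasure ν₂]
    (hT : ∀ q : ℚ, scaledBump d (Real.exp q) ∈ T) {L : ℝ} (hL : 1 ≤ L) :
    bumpPotential s L ν₁ - bumpPotential s L ν₂ = ∫ x, V x * potentialSource d s L x := by
  have hL0 : 0 < L := one_pos.trans_le hL
  unfold bumpPotential potentialSource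
  rw [← integral_sub (integrableOn_rpow_mul_integral_scaledBump hd hL0 ν₁)
    (integrableOn_rpow_mul_integral_scaledBump hd hL0 ν₂)]
  simp_rw [← integral_const_mul]
  rw [integral_integral_swap (f := fun x r => V x *
    (r ^ (-1 - (d : ℝ)) * fracLap s (radialBump d) (r⁻¹ • x)))
    (integrable_prod_potentialSource h.2.1 h0 h1 hγ0 hγ hL)]
  refine setIntegral_congr_fun measurableSet_Ioi fun r hr => ?_
  have hr0 : 0 < r := hL0.trans hr
  rw [integral_const_mul, integral_const_mul, ← mul_sub,
    h.integral_scaledBump_sub h0 h1 hγ0 (by linarith) hT hr0, ← mul_assoc, ← Real.rpow_add hr0,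
    ← integral_const_mul]
  congr 1; ext x
  rw [mul_left_comm]
  congr 3; ring

lemma potentialSource_nonneg (h0 : 0 < s) (h1 : s < 1) {L : ℝ} (hL : 0 < L) {x : Sp d}
    (hx : x ≠ 0) : 0 ≤ potentialSource d s L x := by
  obtain ⟨c, hc, h⟩ := potentialSource_ge (d := d) h0 h1
  exact le_trans (by positivity) (h L hL x hx)

lemma ae_ne_zero : ∀ᵐ x : Sp d, x ≠ 0 := by
  rw [ae_iff]; simp

/-- The potential decreases along the flow. -/
lemma IsTransition.bumpPotential_le (h : IsTransition s γ T V ν₁ ν₂) (h0 : 0 < s) (h1 : s < 1)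
    (hd : 2 * s < d) (hγ0 : 0 ≤ γ) (hγ : γ < d) [IsFiniteMeasure ν₁] [IsFiniteMeasure ν₂]
    (hT : ∀ q : ℚ, scaledBump d (Real.exp q) ∈ T) {L : ℝ} (hL : 1 ≤ L) :
    bumpPotential s L ν₂ ≤ bumpPotential s L ν₁ := by
  rw [← sub_nonneg, h.bumpPotential_sub h0 h1 hd hγ0 hγ hT hL]
  refine integral_nonneg_of_ae ?_
  filter_upwards [h.1, ae_ne_zero] with x hx hx0
  exact mul_nonneg hx (potentialSource_nonneg h0 h1 (one_pos.trans_le hL) hx0)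

/-- The variation of any test function along the flow is controlled by that of the potential. -/
lemma IsTest.exists_abs_integral_sub_le (h0 : 0 < s) (h1 : s < 1) (hd : 2 * s < d) (hγ0 : 0 ≤ γ)
    (hγ : γ < d) (hT : ∀ q : ℚ, scaledBump d (Real.exp q) ∈ T) {χ : Sp d → ℝ}
    (hχ : IsTest χ) (hχT : χ ∈ T) :
    ∃ K, 0 ≤ K ∧ ∀ (ν₁ ν₂ : Measure (Sp d)) (V : Sp d → ℝ), IsFiniteMeasure ν₁ →
      IsFiniteMeasure ν₂ → IsTransition s γ T V ν₁ ν₂ →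
      |∫ x, χ x ∂ν₁ - ∫ x, χ x ∂ν₂| ≤ K * (bumpPotential s 1 ν₁ - bumpPotential s 1 ν₂) := by
  obtain ⟨c, hc, hps⟩ := potentialSource_ge (d := d) h0 h1
  obtain ⟨C, hC0, hC⟩ := hχ.abs_fracLap_le h0 h1
  -- The ratio compares the upper bound `C (1 + |x|)^{-(d+2s)}` for `(-Δ)^s χ` with the lower bound
  -- for `potentialSource` at `L = 1`; both are integrated against the same `V ≥ 0`.
  refine ⟨C / c, by positivity, fun ν₁ ν₂ V _ _ h => ?_⟩
  rw [h.2.2 χ hχT, h.bumpPotential_sub h0 h1 hd hγ0 hγ hT le_rfl, ← integral_const_mul,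
    ← Real.norm_eq_abs]
  refine norm_integral_le_of_norm_le
    ((integrable_mul_potentialSource h.2.1 h0 h1 hγ0 hγ le_rfl).const_mul _) ?_
  filter_upwards [h.1, ae_ne_zero] with x hx hx0
  rw [norm_mul, Real.norm_of_nonneg hx, mul_left_comm]
  refine mul_le_mul_of_nonneg_left ((hC x).trans ?_) hx
  have := hps 1 one_pos x hx0
  rw [Real.one_rpow, one_mul, div_one] at this
  rw [div_mul_eq_mul_div, le_div_iff₀ hc]
  calc C * (1 + ‖x‖) ^ (-((d : ℝ) + 2 * s)) * c
      = C * (c * (1 + ‖x‖) ^ (-((d : ℝ) + 2 * s))) := by ring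
    _ ≤ _ := by gcongr

/-- The total mass is conserved. -/
lemma IsTransition.measure_univ_eq (h : IsTransition s γ T V ν₁ ν₂) (h0 : 0 < s) (h1 : s < 1)
    (hd : 2 * s < d) (hγ0 : 0 ≤ γ) (hγ : γ < 2 * s) [IsFiniteMeasure ν₁] [IsFiniteMeasure ν₂]
    (hT : ∀ q : ℚ, scaledBump d (Real.exp q) ∈ T) : ν₁.real univ = ν₂.real univ := by
  obtain ⟨C, hC0, hC⟩ := abs_fracLap_radialBump_smul_le (d := d) h0 h1 hγ0
    (by linarith : γ ≤ d + 2 * s)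
  have hl := (tendsto_integral_scaledBump ν₁).sub (tendsto_integral_scaledBump ν₂)
  have hr : Tendsto (fun r : ℝ => ∫ x, scaledBump d r x ∂ν₁ -
      ∫ x, scaledBump d r x ∂ν₂) atTop (𝓝 0) := by
    set I := ∫ x, ‖V x * (1 + ‖x‖) ^ (-γ)‖ with hI
    -- Scaling gives `r^{-2s}` and the weight costs `r^γ`, so the flux through infinity vanishes
    -- because `γ < 2s`.
    have hlim : Tendsto (fun r : ℝ => C * I * r ^ (-(2 * s - γ))) atTop (𝓝 0) := by
      simpa using (tendsto_rpow_neg_atTop (by linarith : 0 < 2 * s - γ)).const_mul (C * I)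
    refine squeeze_zero_norm' ?_ hlim
    filter_upwards [eventually_ge_atTop (1 : ℝ)] with r hr
    have hr0 : 0 < r := one_pos.trans_le hr
    rw [h.integral_scaledBump_sub h0 h1 hγ0 (by linarith) hT hr0, norm_mul,
      Real.norm_of_nonneg (by positivity : 0 ≤ r ^ (-(2 * s)))]
    have : ‖∫ x, V x * fracLap s (radialBump d) (r⁻¹ • x)‖ ≤ C * r ^ γ * I := by
      rw [hI, ← integral_const_mul]
      refine norm_integral_le_of_norm_le (h.2.1.norm.const_mul _) (ae_of_all _ fun x => ?_)
      rw [norm_mul, norm_mul, Real.norm_of_nonneg (by positivity : (0 : ℝ) ≤ (1 + ‖x‖) ^ (-γ)),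
        mul_left_comm]
      refine mul_le_mul_of_nonneg_left ((hC _ hr0 x).trans_eq ?_) (norm_nonneg _)
      rw [max_eq_right hr]
    calc r ^ (-(2 * s)) * ‖∫ x, V x * fracLap s (radialBump d) (r⁻¹ • x)‖
        ≤ r ^ (-(2 * s)) * (C * r ^ γ * I) := by gcongr
      _ = C * I * r ^ (-(2 * s - γ)) := by
          rw [show -(2 * s - γ) = -(2 * s) + γ by ring, Real.rpow_add hr0]; ring
  have := tendsto_nhds_unique hl hr
  rw [← mul_sub] at this
  have hb : radialBump d 0 ≠ 0 := (radialBump_pos (by simp)).ne'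
  linarith [(mul_eq_zero.1 this).resolve_left hb]

end Transition

/-! ### Vague and narrow convergence of measures -/

section VagueConvergence

variable {d : ℕ}

/-- A countable family of test functions, dense in `C_c` for uniform convergence. -/
lemma exists_countable_dense_isTest (d : ℕ) :
    ∃ D : Set (Sp d → ℝ), D.Countable ∧ (∀ χ ∈ D, IsTest χ) ∧
      ∀ f : Sp d → ℝ, Continuous f → HasCompactSupport f → ∀ ε > 0,
        ∃ χ ∈ D, ∀ x, |f x - χ x| ≤ ε := by
  have key : ∀ n : ℕ, ∃ D : Set (Sp d → ℝ), D.Countable ∧ (∀ χ ∈ D, IsTest χ) ∧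
      ∀ g : Sp d → ℝ, IsTest g → (∀ x ∉ Metric.closedBall (0 : Sp d) n, g x = 0) →
        ∀ ε > 0, ∃ χ ∈ D, ∀ x, |g x - χ x| ≤ ε := by
    intro n
    set B := Metric.closedBall (0 : Sp d) n with hB
    have : CompactSpace B := isCompact_iff_compactSpace.1 (isCompact_closedBall _ _)
    -- As a subset of the separable metric space `C(B, ℝ)`, the restrictions of test functions
    -- supported in `B` contain a countable dense set of their own. Closeness on `B` is closeness
    -- everywhere, as both functions vanish outside.
    let S : Set C(B, ℝ) := {g | ∃ χ : Sp d → ℝ, IsTest χ ∧ (∀ x ∉ B, χ x = 0) ∧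
      ∀ x : B, g x = χ x}
    obtain ⟨t, htS, htc, htd⟩ :=
      (TopologicalSpace.IsSeparable.of_separableSpace S).exists_countable_dense_subset
    have htS' : ∀ k ∈ t, ∃ χ : Sp d → ℝ, IsTest χ ∧ (∀ x ∉ B, χ x = 0) ∧
      ∀ x : B, k x = χ x := fun k hk => htS hk
    choose! F hF using htS'
    refine ⟨F '' t, htc.image F, ?_, fun g hg hg0 ε hε => ?_⟩
    · rintro _ ⟨k, hk, rfl⟩
      exact (hF k hk).1
    · let g' : C(B, ℝ) := ⟨fun x => g x, hg.1.continuous.comp continuous_subtype_val⟩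
      obtain ⟨k, hk, hdist⟩ := Metric.mem_closure_iff.1
        (htd (show g' ∈ S from ⟨g, hg, hg0, fun _ => rfl⟩)) ε hε
      refine ⟨F k, mem_image_of_mem F hk, fun x => ?_⟩
      by_cases hx : x ∈ B
      · have h1 := (ContinuousMap.dist_apply_le_dist (f := g') (g := k) ⟨x, hx⟩).trans hdist.le
        rw [Real.dist_eq, (hF k hk).2.2] at h1
        exact h1
      · rw [hg0 x hx, (hF k hk).2.1 x hx, sub_zero, abs_zero]
        exact hε.le
  choose D hDc hDt hDd using key
  refine ⟨⋃ n, D n, countable_iUnion hDc, fun χ hχ => ?_, fun f hf hfc ε hε => ?_⟩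
  · obtain ⟨n, hn⟩ := mem_iUnion.1 hχ
    exact hDt n χ hn
  · obtain ⟨g, hg, hgf, hsupp⟩ := hf.exists_contDiff_approx (⊤ : ℕ∞) (ε := fun _ => ε / 2)
      continuous_const (fun _ => half_pos hε)
    have hgt : IsTest g := ⟨hg, hfc.mono hsupp⟩
    obtain ⟨R, hR⟩ := hfc.isCompact.isBounded.subset_closedBall (0 : Sp d)
    obtain ⟨n, hn⟩ := exists_nat_ge R
    obtain ⟨χ, hχ, hχg⟩ := hDd n g hgt (fun x hx => by
      by_contra h
      exact hx (Metric.closedBall_subset_closedBall hn (hR (subset_tsupport f (hsupp h)))))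
      (ε / 2) (half_pos hε)
    refine ⟨χ, mem_iUnion.2 ⟨n, hχ⟩, fun x => ?_⟩
    have h1 := (hgf x).le
    rw [dist_comm, Real.dist_eq] at h1
    have h2 := abs_add_le (f x - g x) (g x - χ x)
    rw [sub_add_sub_cancel] at h2
    linarith [hχg x]

lemma abs_integral_sub_le {ν : Measure (Sp d)} {M : ℝ≥0} (hM : ν univ ≤ M) {f g : Sp d → ℝ}
    (hf : Continuous f) (hfc : HasCompactSupport f) (hg : Continuous g)
    (hgc : HasCompactSupport g) {δ : ℝ} (hδ : ∀ x, |f x - g x| ≤ δ) :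
    |∫ x, f x ∂ν - ∫ x, g x ∂ν| ≤ δ * M := by
  have : IsFiniteMeasure ν := ⟨hM.trans_lt ENNReal.coe_lt_top⟩
  have hδ0 : 0 ≤ δ := (abs_nonneg _).trans (hδ 0)
  rw [← integral_sub (hf.integrable_of_hasCompactSupport hfc)
    (hg.integrable_of_hasCompactSupport hgc), ← Real.norm_eq_abs]
  refine (norm_integral_le_of_norm_le_const (ae_of_all _ hδ)).trans ?_
  gcongr
  exact ENNReal.toReal_le_coe_of_le_coe hM

/-- With masses at most `M`, replacing `f` by a function within `δ` changes every integral by at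
most `δ M`, so the integrals of `f` are Cauchy along the filter. -/
lemma exists_tendsto_integral_of_dense {ι : Type*} {l : Filter ι} [NeBot l]
    {lam : ι → Measure (Sp d)} {M : ℝ≥0} (hM : ∀ᶠ t in l, lam t univ ≤ M)
    {D : Set (Sp d → ℝ)} (hDt : ∀ χ ∈ D, IsTest χ)
    (hD : ∀ χ ∈ D, ∃ c, Tendsto (fun t => ∫ x, χ x ∂(lam t)) l (𝓝 c)) {f : Sp d → ℝ}
    (hf : Continuous f) (hfc : HasCompactSupport f)
    (hfD : ∀ ε > 0, ∃ χ ∈ D, ∀ x, |f x - χ x| ≤ ε) :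
    ∃ c, Tendsto (fun t => ∫ x, f x ∂(lam t)) l (𝓝 c) := by
  rw [← cauchy_map_iff_exists_tendsto, Metric.cauchy_iff]
  refine ⟨inferInstance, fun ε hε => ?_⟩
  have hM0 : (0 : ℝ) ≤ M := M.2
  obtain ⟨χ, hχ, hfχ⟩ := hfD (ε / (4 * (M + 1))) (by positivity)
  obtain ⟨c, hc⟩ := hD χ hχ
  have hle : ε / (4 * (M + 1)) * M ≤ ε / 4 := by
    rw [div_mul_eq_mul_div, div_le_div_iff₀ (by positivity) (by norm_num)]
    nlinarith
  refine ⟨_, image_mem_map (hM.and (Metric.tendsto_nhds.1 hc (ε / 4) (by positivity))), ?_⟩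
  have key : ∀ t, lam t univ ≤ M ∧ dist (∫ x, χ x ∂(lam t)) c < ε / 4 →
      dist (∫ x, f x ∂(lam t)) c < ε / 2 := by
    rintro t ⟨h1, h2⟩
    have h3 := abs_integral_sub_le h1 hf hfc (hDt χ hχ).1.continuous (hDt χ hχ).2 hfχ
    rw [← Real.dist_eq] at h3
    linarith [dist_triangle (∫ x, f x ∂(lam t)) (∫ x, χ x ∂(lam t)) c]
  rintro _ ⟨t, ht, rfl⟩ _ ⟨t', ht', rfl⟩
  have h1 := key t ht
  have h2 := key t' ht'
  rw [dist_comm] at h2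
  exact (dist_triangle _ c _).trans_lt (by linarith)

open CompactlySupported in
/-- Vague compactness: if the integrals of all functions of `C_c` converge, the limit is
integration against a finite measure. -/
lemma exists_vague_limit {ι : Type*} {l : Filter ι} [NeBot l] {lam : ι → Measure (Sp d)}
    {M : ℝ≥0} (hM : ∀ᶠ t in l, lam t univ ≤ M)
    (hlim : ∀ f : Sp d → ℝ, Continuous f → HasCompactSupport f →
      ∃ c, Tendsto (fun t => ∫ x, f x ∂(lam t)) l (𝓝 c)) :
    ∃ μ : Measure (Sp d), μ univ ≤ M ∧ ∀ f : Sp d → ℝ, Continuous f → HasCompactSupport f →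
      Tendsto (fun t => ∫ x, f x ∂(lam t)) l (𝓝 (∫ x, f x ∂μ)) := by
  have hlim' : ∀ f : C_c(Sp d, ℝ), ∃ c, Tendsto (fun t => ∫ x, f x ∂(lam t)) l (𝓝 c) :=
    fun f => hlim f f.continuous f.hasCompactSupport
  choose Λ hΛ using hlim'
  have hint : ∀ᶠ t in l, ∀ f : C_c(Sp d, ℝ), Integrable f (lam t) := hM.mono fun t ht f => by
    have : IsFiniteMeasure (lam t) := ⟨ht.trans_lt ENNReal.coe_lt_top⟩
    exact f.continuous.integrable_of_hasCompactSupport f.hasCompactSupport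
  let Λ' : C_c(Sp d, ℝ) →ₚ[ℝ] ℝ :=
  { toFun := Λ
    map_add' := fun g g' => by
      refine tendsto_nhds_unique (hΛ (g + g')) (((hΛ g).add (hΛ g')).congr' ?_)
      filter_upwards [hint] with t ht
      rw [← integral_add (ht g) (ht g')]
      rfl
    map_smul' := fun c g => by
      refine tendsto_nhds_unique (hΛ (c • g)) (((hΛ g).const_smul c).congr fun t => ?_)
      rw [← integral_smul]
      rfl
    monotone' := fun g g' hgg' => by
      refine le_of_tendsto_of_tendsto (hΛ g) (hΛ g') ?_
      filter_upwards [hint] with t ht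
      exact integral_mono (ht g) (ht g') hgg' }
  have hval : ∀ f : C_c(Sp d, ℝ), Tendsto (fun t => ∫ x, f x ∂(lam t)) l
      (𝓝 (∫ x, f x ∂(RealRMK.rieszMeasure Λ'))) := fun f => by
    rw [RealRMK.integral_rieszMeasure]
    exact hΛ f
  refine ⟨RealRMK.rieszMeasure Λ', ?_, fun f hf hfc => hval ⟨⟨f, hf⟩, hfc⟩⟩
  have hball : ∀ n : ℕ, RealRMK.rieszMeasure Λ' (Metric.closedBall (0 : Sp d) n) ≤ M := by
    intro n
    -- The inner radius is `n + 1` rather than `n` because it must be positive also for `n = 0`.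
    let b : ContDiffBump (0 : Sp d) := ⟨n + 1, n + 2, by positivity, by linarith⟩
    let f : C_c(Sp d, ℝ) := ⟨⟨b, b.continuous⟩, b.hasCompactSupport⟩
    refine (RealRMK.rieszMeasure_le_of_eq_one Λ' (f := f) (fun x => b.nonneg)
      (isCompact_closedBall _ _) fun x hx => b.one_of_mem_closedBall
        (Metric.closedBall_subset_closedBall (by simp [b]) hx)).trans ?_
    have : Λ' f ≤ M := by
      refine le_of_tendsto (hΛ f) ?_
      filter_upwards [hM, hint] with t ht hi
      have : IsFiniteMeasure (lam t) := ⟨ht.trans_lt ENNReal.coe_lt_top⟩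
      refine (integral_mono (hi f) (integrable_const (1 : ℝ)) fun x => b.le_one).trans ?_
      rw [integral_const, smul_eq_mul, mul_one]
      exact ENNReal.toReal_le_coe_of_le_coe ht
    exact (ENNReal.ofReal_le_ofReal this).trans_eq (ENNReal.ofReal_coe_nnreal)
  rw [← Metric.iUnion_closedBall_nat (0 : Sp d), Monotone.measure_iUnion]
  · exact iSup_le hball
  · exact fun m n hmn => Metric.closedBall_subset_closedBall (by exact_mod_cast hmn)

/-- Vague convergence without loss of mass is narrow convergence. -/
lemma tendsto_integral_of_vague {ι : Type*} {l : Filter ι} {lam : ι → Measure (Sp d)}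
    {μ : Measure (Sp d)} [IsFiniteMeasure μ]
    (hv : ∀ f : Sp d → ℝ, Continuous f → HasCompactSupport f →
      Tendsto (fun t => ∫ x, f x ∂(lam t)) l (𝓝 (∫ x, f x ∂μ)))
    (hm : ∀ᶠ t in l, lam t univ = μ univ) (φ : Sp d →ᵇ ℝ) :
    Tendsto (fun t => ∫ x, φ x ∂(lam t)) l (𝓝 (∫ x, φ x ∂μ)) := by
  set b := radialBump d 0 with hb
  have hb0 : 0 < b := radialBump_pos (by simp)
  set ψ : ℝ → Sp d → ℝ := fun r x => b⁻¹ * scaledBump d r x with hψ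
  have hψc : ∀ r, Continuous (ψ r) := fun r => continuous_const.mul (continuous_scaledBump r)
  have hψ0 : ∀ r x, 0 ≤ ψ r x := fun r x =>
    mul_nonneg (inv_nonneg.2 hb0.le) (scaledBump_nonneg r x)
  have hψ1 : ∀ r x, ψ r x ≤ 1 := fun r x => by
    rw [hψ, inv_mul_le_iff₀ hb0, mul_one]
    exact scaledBump_le r x
  have hψi : ∀ r (ν : Measure (Sp d)), IsFiniteMeasure ν → Integrable (ψ r) ν := fun r ν _ =>
    (integrable_scaledBump r ν).const_mul _
  -- Cutting `φ` off costs at most `‖φ‖` times the mass missed by `ψ r`. For `μ` this is small when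
  -- `r` is large; since the masses agree and `∫ ψ r` converges vaguely, it is then small for `lam
  -- t` as well.
  have hcut : ∀ r (ν : Measure (Sp d)), IsFiniteMeasure ν →
      |∫ x, φ x ∂ν - ∫ x, φ x * ψ r x ∂ν| ≤ ‖φ‖ * (ν.real univ - ∫ x, ψ r x ∂ν) := by
    intro r ν _
    have hi : Integrable (fun x => φ x) ν := φ.integrable ν
    have hi2 : Integrable (fun x => φ x * ψ r x) ν :=
      hi.mul_bdd (c := 1) (hψc r).aestronglyMeasurable (ae_of_all _ fun x => by
        rw [Real.norm_of_nonneg (hψ0 r x)]; exact hψ1 r x)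
    have e : ν.real univ - ∫ x, ψ r x ∂ν = ∫ x, (1 - ψ r x) ∂ν := by
      rw [integral_sub (integrable_const _) (hψi r ν inferInstance), integral_const, smul_eq_mul,
        mul_one]
    rw [← integral_sub hi hi2, e, ← integral_const_mul, ← Real.norm_eq_abs]
    refine norm_integral_le_of_norm_le
      (((integrable_const _).sub (hψi r ν inferInstance)).const_mul _) (ae_of_all _ fun x => ?_)
    rw [show φ x - φ x * ψ r x = φ x * (1 - ψ r x) by ring, norm_mul,
      Real.norm_of_nonneg (sub_nonneg.2 (hψ1 r x))]
    exact mul_le_mul_of_nonneg_right (φ.norm_coe_le_norm x) (sub_nonneg.2 (hψ1 r x))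
  have hlimμ : Tendsto (fun r => ‖φ‖ * (μ.real univ - ∫ x, ψ r x ∂μ)) atTop (𝓝 0) := by
    have h := (tendsto_integral_scaledBump μ).const_mul b⁻¹
    rw [← hb, inv_mul_cancel_left₀ hb0.ne'] at h
    have h2 := (h.const_sub (μ.real univ)).const_mul ‖φ‖
    rw [sub_self, mul_zero] at h2
    refine h2.congr fun r => ?_
    rw [hψ, integral_const_mul]
  rw [Metric.tendsto_nhds]
  intro ε hε
  obtain ⟨r, hr0, hr⟩ := ((eventually_gt_atTop (0 : ℝ)).and
    (hlimμ.eventually (gt_mem_nhds (by positivity : 0 < ε / 4)))).exists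
  have hψs : HasCompactSupport (ψ r) := (isTest_scaledBump hr0).2.mul_left
  have hlam : Tendsto (fun t => ‖φ‖ * (μ.real univ - ∫ x, ψ r x ∂(lam t))) l
      (𝓝 (‖φ‖ * (μ.real univ - ∫ x, ψ r x ∂μ))) :=
    ((hv (ψ r) (hψc r) hψs).const_sub _).const_mul _
  have hφψ := hv (fun x => φ x * ψ r x) (φ.continuous.mul (hψc r)) hψs.mul_left
  filter_upwards [hm, hlam.eventually (gt_mem_nhds hr),
    Metric.tendsto_nhds.1 hφψ (ε / 4) (by positivity)] with t h1 h2 h3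
  have hfin : IsFiniteMeasure (lam t) := ⟨h1.trans_lt (measure_lt_top μ univ)⟩
  have h4 := hcut r (lam t) hfin
  have h5 := hcut r μ inferInstance
  rw [measureReal_def, h1, ← measureReal_def] at h4
  rw [Real.dist_eq] at h3 ⊢
  rw [abs_le] at h4 h5
  rw [abs_lt] at h3 ⊢
  constructor <;> linarith [h4.1, h4.2, h5.1, h5.2, h3.1, h3.2]

end VagueConvergence

/-! ### Existence and uniqueness of the initial trace -/

section InitialTrace

lemma neBot_nhdsWithin_Ioi_diff {N : Set ℝ} (hN : volume N = 0) :
    NeBot (𝓝[Ioi 0 \ N] (0 : ℝ)) := by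
  rw [← mem_closure_iff_nhdsWithin_neBot, Metric.mem_closure_iff]
  intro ε hε
  by_contra! h
  have hsub : Ioo 0 ε ⊆ N := fun t ht => by
    by_contra htN
    have := h t ⟨ht.1, htN⟩
    rw [Real.dist_eq, zero_sub, abs_neg, abs_of_pos ht.1] at this
    exact absurd ht.2 (not_lt.2 this)
  have := measure_mono_null hsub hN
  rw [Real.volume_Ioo, sub_zero, ENNReal.ofReal_eq_zero] at this
  linarith

/-- A function whose increments are controlled by those of a bounded monotone function has a
limit. -/
lemma exists_tendsto_of_abs_sub_le {S : Set ℝ} (hS : S ⊆ Ioi 0) [NeBot (𝓝[S] (0 : ℝ))]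
    {F H : ℝ → ℝ} {K B : ℝ} (hK : 0 ≤ K) (hB : ∀ t ∈ S, H t ≤ B) (hH : AntitoneOn H S)
    (hF : ∀ t₁ ∈ S, ∀ t₂ ∈ S, t₁ < t₂ → |F t₁ - F t₂| ≤ K * (H t₁ - H t₂)) :
    ∃ c, Tendsto F (𝓝[S] 0) (𝓝 c) := by
  rw [← cauchy_map_iff_exists_tendsto, Metric.cauchy_iff]
  refine ⟨inferInstance, fun ε hε => ?_⟩
  have hSne : S.Nonempty := by
    obtain ⟨t, ht⟩ := (self_mem_nhdsWithin : S ∈ 𝓝[S] (0 : ℝ)) |> Filter.nonempty_of_mem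
    exact ⟨t, ht⟩
  have hbdd : BddAbove (H '' S) := ⟨B, by rintro _ ⟨t, ht, rfl⟩; exact hB t ht⟩
  -- Before `t₀` the monotone function stays within `ε/(K+1)` of its supremum, so `F` oscillates by
  -- less than `ε` there.
  obtain ⟨_, ⟨t₀, ht₀, rfl⟩, hlt⟩ := exists_lt_of_lt_csSup (hSne.image H)
    (sub_lt_self (sSup (H '' S)) (by positivity : 0 < ε / (K + 1)))
  have hU : S ∩ Iio t₀ ∈ 𝓝[S] (0 : ℝ) := inter_mem_nhdsWithin S (Iio_mem_nhds (hS ht₀))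
  refine ⟨_, image_mem_map hU, ?_⟩
  have key : ∀ t ∈ S ∩ Iio t₀, ∀ t' ∈ S ∩ Iio t₀, t < t' → dist (F t) (F t') < ε := by
    rintro t ⟨htS, -⟩ t' ⟨ht'S, ht'⟩ htt'
    have h1 : H t ≤ sSup (H '' S) := le_csSup hbdd (mem_image_of_mem H htS)
    have h2 : H t₀ ≤ H t' := hH ht'S ht₀ (le_of_lt ht')
    rw [Real.dist_eq]
    calc |F t - F t'| ≤ K * (H t - H t') := hF t htS t' ht'S htt'
      _ ≤ K * (ε / (K + 1)) := by gcongr; linarith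
      _ < ε := by
          rw [mul_div_assoc', div_lt_iff₀ (by positivity)]
          nlinarith
  rintro _ ⟨t, ht, rfl⟩ _ ⟨t', ht', rfl⟩
  rcases lt_trichotomy t t' with h | h | h
  · exact key t ht t' ht' h
  · rw [h, dist_self]; exact hε
  · rw [dist_comm]; exact key t' ht' t ht h

variable {d : ℕ} [NeZero d] {s γ : ℝ} {W : Sp d → ℝ → ℝ} {lam : ℝ → Measure (Sp d)}

lemma IsDiffusionFlow.intervalIntegrable (h : IsDiffusionFlow s γ W lam) (h0 : 0 < s) (h1 : s < 1)
    (hγ : γ ≤ d + 2 * s) {χ : Sp d → ℝ} (hχ : IsTest χ) {a b : ℝ} (ha : 0 < a) (hb : 0 < b) :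
    IntervalIntegrable (fun t => ∫ x, W x t * fracLap s χ x) volume a b := by
  obtain ⟨C, -, hC⟩ := hχ.abs_fracLap_le_weight h0 h1 hγ
  have key : ∀ a b, 0 < a → a < b →
      IntervalIntegrable (fun t => ∫ x, W x t * fracLap s χ x) volume a b := by
    intro a b ha hab
    rw [intervalIntegrable_iff_integrableOn_Ioo_of_le hab.le]
    exact (Integrable.mul_of_weight (W := W) (h.integrable a b ha hab)
      (hχ.continuous_fracLap h0 h1).measurable hC).integral_prod_right
  rcases lt_trichotomy a b with hab | rfl | hab
  · exact key a b ha hab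
  · exact IntervalIntegrable.refl
  · exact (key b a hb hab).symm

/-- Subtracting the two primitives leaves the integral over `(t₁,t₂)`, and Fubini moves it inside,
so `V` is the time integral of `W`. It serves all of `T` at once. -/
lemma IsDiffusionFlow.exists_isTransition (h : IsDiffusionFlow s γ W lam) (h0 : 0 < s)
    (h1 : s < 1) (hγ : γ ≤ d + 2 * s) {T : Set (Sp d → ℝ)} (hT : ∀ χ ∈ T, IsTest χ)
    {c : (Sp d → ℝ) → ℝ} {t₁ t₂ : ℝ} (ht₁ : 0 < t₁) (ht : t₁ < t₂)
    (hc₁ : ∀ χ ∈ T, ∫ x, χ x ∂(lam t₁) =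
      c χ - ∫ τ in (1 : ℝ)..t₁, ∫ x, W x τ * fracLap s χ x)
    (hc₂ : ∀ χ ∈ T, ∫ x, χ x ∂(lam t₂) =
      c χ - ∫ τ in (1 : ℝ)..t₂, ∫ x, W x τ * fracLap s χ x) :
    ∃ V, IsTransition s γ T V (lam t₁) (lam t₂) := by
  have hsub : Ioo t₁ t₂ ⊆ Ioi (0 : ℝ) := fun t ht => ht₁.trans ht.1
  have hint := h.integrable t₁ t₂ ht₁ ht
  refine ⟨fun x => ∫ τ in Ioo t₁ t₂, W x τ, ?_, ?_, fun χ hχ => ?_⟩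
  · have hle : (volume : Measure (Sp d)).prod (volume.restrict (Ioo t₁ t₂)) ≤
        volume.prod (volume.restrict (Ioi (0 : ℝ))) :=
      Measure.prod_mono le_rfl (Measure.restrict_mono hsub le_rfl)
    filter_upwards [Measure.ae_ae_of_ae_prod (ae_mono hle h.nonneg)] with x hx
    exact integral_nonneg_of_ae hx
  · refine hint.integral_prod_left.congr (ae_of_all _ fun x => ?_)
    simp only
    rw [integral_mul_const]
  · obtain ⟨C, -, hC⟩ := (hT χ hχ).abs_fracLap_le_weight h0 h1 hγ
    have hi := Integrable.mul_of_weight (W := W) hint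
      ((hT χ hχ).continuous_fracLap h0 h1).measurable hC
    rw [hc₁ χ hχ, hc₂ χ hχ, sub_sub_sub_cancel_left, intervalIntegral.integral_interval_sub_left
      (h.intervalIntegrable h0 h1 hγ (hT χ hχ) one_pos (ht₁.trans ht))
      (h.intervalIntegrable h0 h1 hγ (hT χ hχ) one_pos ht₁),
      intervalIntegral.integral_of_le ht.le, integral_Ioc_eq_integral_Ioo]
    simp_rw [← integral_mul_const]
    exact (integral_integral_swap (f := fun x τ => W x τ * fracLap s χ x) hi).symm

/-- The kernel is not compactly supported, but each bump is; the mass bound dominates the integral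
over radii because `2s < d`. The potential therefore passes to a vague limit before loss of mass has
been excluded. -/
lemma tendsto_bumpPotential {l : Filter ℝ} [l.IsCountablyGenerated] (hd : 2 * s < d) {L : ℝ}
    (hL : 0 < L) {M : ℝ≥0} (hM : ∀ᶠ t in l, lam t univ ≤ M) {μ : Measure (Sp d)}
    (hv : ∀ f : Sp d → ℝ, Continuous f → HasCompactSupport f →
      Tendsto (fun t => ∫ x, f x ∂(lam t)) l (𝓝 (∫ x, f x ∂μ))) :
    Tendsto (fun t => bumpPotential s L (lam t)) l (𝓝 (bumpPotential s L μ)) := by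
  unfold bumpPotential
  refine tendsto_integral_filter_of_dominated_convergence
    (fun r => r ^ (-1 - (d : ℝ) + 2 * s) * (radialBump d 0 * M)) ?_ ?_ ?_ ?_
  · filter_upwards [hM] with t ht
    have : IsFiniteMeasure (lam t) := ⟨ht.trans_lt ENNReal.coe_lt_top⟩
    exact (integrableOn_rpow_mul_integral_scaledBump hd hL (lam t)).aestronglyMeasurable
  · filter_upwards [hM] with t ht
    have : IsFiniteMeasure (lam t) := ⟨ht.trans_lt ENNReal.coe_lt_top⟩
    filter_upwards [ae_restrict_mem measurableSet_Ioi] with r hr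
    have hr0 : 0 < r := hL.trans hr
    rw [norm_mul, Real.norm_of_nonneg (by positivity),
      Real.norm_of_nonneg (integral_scaledBump_nonneg r _)]
    gcongr
    refine (integral_scaledBump_le r (lam t)).trans ?_
    exact mul_le_mul_of_nonneg_left (ENNReal.toReal_le_coe_of_le_coe ht) (radialBump_nonneg 0)
  · exact (integrableOn_Ioi_rpow_of_lt (by linarith) hL).mul_const _
  · filter_upwards [ae_restrict_mem measurableSet_Ioi] with r hr
    exact (hv _ (continuous_scaledBump r) (isTest_scaledBump (hL.trans hr)).2).const_mul _

/-- A diffusion flow has an initial trace, in duality with bounded continuous functions, which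
carries the conserved mass of the flow. -/
theorem IsDiffusionFlow.exists_initial_trace (h : IsDiffusionFlow s γ W lam) (h0 : 0 < s)
    (h1 : s < 1) (hd : 2 * s < d) (hγ0 : 0 ≤ γ) (hγ : γ < 2 * s) :
    ∃ (μ : FiniteMeasure (Sp d)) (N : Set ℝ), volume N = 0 ∧
      (∀ φ : Sp d →ᵇ ℝ, Tendsto (fun t => ∫ x, φ x ∂(lam t)) (𝓝[Ioi 0 \ N] 0)
        (𝓝 (∫ x, φ x ∂(μ : Measure (Sp d))))) ∧
      ∀ t ∈ Ioi 0 \ N, lam t univ = (μ : Measure (Sp d)) univ := by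
  have hγd : γ < d := hγ.trans hd
  have hγ2 : γ ≤ d + 2 * s := by linarith
  obtain ⟨D, hDc, hDt, hDd⟩ := exists_countable_dense_isTest d
  obtain ⟨M, hM⟩ := h.mass_le
  -- The identities hold off a null set of times depending on the test function, so only countably
  -- many may be used. `D` determines the limit, and bumps of radius `e^q`, `q` rational, recover
  -- all radii by continuity.
  set T : Set (Sp d → ℝ) := D ∪ range fun q : ℚ => scaledBump d (Real.exp q) with hTdef
  have hTc : T.Countable := hDc.union (countable_range _)
  have hTb : ∀ q : ℚ, scaledBump d (Real.exp q) ∈ T := fun q => Or.inr (mem_range_self q)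
  have hTt : ∀ χ ∈ T, IsTest χ := by
    rintro χ (hχ | ⟨q, rfl⟩)
    · exact hDt χ hχ
    · exact isTest_scaledBump (Real.exp_pos _)
  have hev : ∀ χ ∈ T, ∃ c : ℝ, ∀ᵐ t ∂(volume.restrict (Ioi (0 : ℝ))),
      ∫ x, χ x ∂(lam t) = c - ∫ τ in (1 : ℝ)..t, ∫ x, W x τ * fracLap s χ x :=
    fun χ hχ => h.evolution χ (hTt χ hχ)
  choose! c hc using hev
  have hgood := (ae_restrict_iff' measurableSet_Ioi).1 (hM.and ((ae_ball_iff hTc).2 hc))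
  rw [ae_iff] at hgood
  set N : Set ℝ := _ with hNdef
  have hN0 : volume N = 0 := hgood
  set S : Set ℝ := Ioi 0 \ N with hSdef
  have hSpos : S ⊆ Ioi 0 := sdiff_subset
  have hS : ∀ t ∈ S, lam t univ ≤ M ∧ ∀ χ ∈ T, ∫ x, χ x ∂(lam t) =
      c χ - ∫ τ in (1 : ℝ)..t, ∫ x, W x τ * fracLap s χ x := fun t ht =>
    not_not.1 ht.2 ht.1
  have hfin : ∀ t ∈ S, IsFiniteMeasure (lam t) := fun t ht =>
    ⟨(hS t ht).1.trans_lt ENNReal.coe_lt_top⟩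
  have hne : NeBot (𝓝[S] (0 : ℝ)) := neBot_nhdsWithin_Ioi_diff hN0
  have hMl : ∀ᶠ t in 𝓝[S] (0 : ℝ), lam t univ ≤ M :=
    eventually_nhdsWithin_of_forall fun t ht => (hS t ht).1
  have htrans : ∀ t₁ ∈ S, ∀ t₂ ∈ S, t₁ < t₂ → ∃ V, IsTransition s γ T V (lam t₁) (lam t₂) :=
    fun t₁ ht₁ t₂ ht₂ ht => h.exists_isTransition h0 h1 hγ2 hTt (hSpos ht₁) ht
      (hS t₁ ht₁).2 (hS t₂ ht₂).2
  have hanti : ∀ L : ℝ, 1 ≤ L → AntitoneOn (fun t => bumpPotential s L (lam t)) S := by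
    intro L hL t₁ ht₁ t₂ ht₂ ht
    rcases ht.eq_or_lt with rfl | hlt
    · exact le_rfl
    · have := hfin t₁ ht₁
      have := hfin t₂ ht₂
      obtain ⟨V, hV⟩ := htrans t₁ ht₁ t₂ ht₂ hlt
      exact hV.bumpPotential_le h0 h1 hd hγ0 hγd hTb hL
  have hreal : ∀ t ∈ S, (lam t).real univ ≤ M := fun t ht =>
    ENNReal.toReal_le_coe_of_le_coe (hS t ht).1
  have hJ0 : ∀ L : ℝ, 0 < L → 0 < ∫ r in Ioi L, r ^ (-1 - (d : ℝ) + 2 * s) := fun L hL => by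
    rw [integral_Ioi_rpow_of_lt (by linarith) hL, neg_div, ← div_neg]
    exact div_pos (Real.rpow_pos_of_pos hL _) (by linarith)
  have hb0 : 0 < radialBump d 0 := radialBump_pos (by simp)
  have hDlim : ∀ χ ∈ D, ∃ c, Tendsto (fun t => ∫ x, χ x ∂(lam t)) (𝓝[S] 0) (𝓝 c) := by
    intro χ hχ
    obtain ⟨K, hK0, hK⟩ := (hDt χ hχ).exists_abs_integral_sub_le (T := T) h0 h1 hd hγ0 hγd hTb
      (Or.inl hχ)
    refine exists_tendsto_of_abs_sub_le hSpos hK0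
      (B := (∫ r in Ioi (1 : ℝ), r ^ (-1 - (d : ℝ) + 2 * s)) * (radialBump d 0 * M))
      (fun t ht => ?_) (hanti 1 le_rfl) fun t₁ ht₁ t₂ ht₂ ht => ?_
    · have := hfin t ht
      refine (bumpPotential_le hd one_pos (lam t)).trans ?_
      have := hJ0 1 one_pos
      gcongr
      exact hreal t ht
    · obtain ⟨V, hV⟩ := htrans t₁ ht₁ t₂ ht₂ ht
      exact hK _ _ V (hfin t₁ ht₁) (hfin t₂ ht₂) hV
  obtain ⟨μ, hμM, hμ⟩ := exists_vague_limit hMl fun f hf hfc =>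
    exists_tendsto_integral_of_dense hMl hDt hDlim hf hfc (hDd f hf hfc)
  have hμfin : IsFiniteMeasure μ := ⟨hμM.trans_lt ENNReal.coe_lt_top⟩
  have hconst : ∀ t₁ ∈ S, ∀ t₂ ∈ S, (lam t₁).real univ = (lam t₂).real univ := by
    have key : ∀ t₁ ∈ S, ∀ t₂ ∈ S, t₁ < t₂ → (lam t₁).real univ = (lam t₂).real univ := by
      intro t₁ ht₁ t₂ ht₂ ht
      have := hfin t₁ ht₁
      have := hfin t₂ ht₂
      obtain ⟨V, hV⟩ := htrans t₁ ht₁ t₂ ht₂ ht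
      exact hV.measure_univ_eq h0 h1 hd hγ0 hγ hTb
    intro t₁ ht₁ t₂ ht₂
    rcases lt_trichotomy t₁ t₂ with hlt | rfl | hlt
    · exact key t₁ ht₁ t₂ ht₂ hlt
    · rfl
    · exact (key t₂ ht₂ t₁ ht₁ hlt).symm
  -- Mass can only be lost in a vague limit: test with bumps of radius `r`, then let `r → ∞`.
  have hle1 : ∀ t ∈ S, μ.real univ ≤ (lam t).real univ := by
    intro t ht
    refine le_of_mul_le_mul_left (le_of_tendsto (tendsto_integral_scaledBump μ) ?_) hb0
    filter_upwards [eventually_gt_atTop (0 : ℝ)] with r hr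
    refine le_of_tendsto (hμ _ (continuous_scaledBump r) (isTest_scaledBump hr).2)
      (eventually_nhdsWithin_of_forall fun t' ht' => ?_)
    have := hfin t' ht'
    rw [hconst t ht t' ht']
    exact integral_scaledBump_le r (lam t')
  -- Monotonicity forbids mass from entering from infinity at time zero: the potential at `t` is at
  -- most its limit, the potential of `μ`. Comparing both with the mass and dividing by the radial
  -- integral gives `∫ φ(x/L) dλ_t ≤ φ(0) μ(ℝ^d)`, and then `L → ∞`. The restriction `L ≥ 1` is that
  -- of `hanti`.
  have hle2 : ∀ t ∈ S, (lam t).real univ ≤ μ.real univ := by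
    intro t ht
    have := hfin t ht
    refine le_of_mul_le_mul_left (le_of_tendsto (tendsto_integral_scaledBump (lam t)) ?_) hb0
    filter_upwards [eventually_ge_atTop (1 : ℝ)] with L hL
    have hL0 : 0 < L := one_pos.trans_le hL
    refine le_of_mul_le_mul_left ?_ (hJ0 L hL0)
    refine (le_bumpPotential hd hL0 (lam t)).trans (le_trans ?_ (bumpPotential_le hd hL0 μ))
    refine ge_of_tendsto (tendsto_bumpPotential hd hL0 hMl hμ) ?_
    have hU : S ∩ Iio t ∈ 𝓝[S] (0 : ℝ) := inter_mem_nhdsWithin S (Iio_mem_nhds (hSpos ht))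
    filter_upwards [hU] with t' ht'
    exact hanti L hL ht'.1 ht (le_of_lt ht'.2)
  have hmass : ∀ t ∈ S, lam t univ = μ univ := fun t ht => by
    have := hfin t ht
    rw [← ofReal_measureReal (μ := lam t) (s := univ), ← ofReal_measureReal (μ := μ) (s := univ),
      le_antisymm (hle2 t ht) (hle1 t ht)]
  exact ⟨⟨μ, hμfin⟩, N, hN0, fun φ => tendsto_integral_of_vague hμ
    (eventually_nhdsWithin_of_forall hmass) φ, hmass⟩

/-- The exceptional sets may differ, but the times outside their union still accumulate at 0, so the
limits agree for every bounded continuous function, and these determine a finite measure. -/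
lemma IsInitialTrace.unique {ρ : Sp d → ℝ} {u : Sp d → ℝ → ℝ} {μ ν : FiniteMeasure (Sp d)}
    (hμ : IsInitialTrace ρ u μ) (hν : IsInitialTrace ρ u ν) : ν = μ := by
  obtain ⟨N, hN, -, h⟩ := hμ
  obtain ⟨N', hN', -, h'⟩ := hν
  have hne := neBot_nhdsWithin_Ioi_diff (measure_union_null hN hN')
  have hm : ∀ A ⊆ N ∪ N', 𝓝[Ioi 0 \ (N ∪ N')] (0 : ℝ) ≤ 𝓝[Ioi 0 \ A] 0 := fun A hA =>
    nhdsWithin_mono _ (sdiff_subset_sdiff_right hA)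
  have key : (ν : Measure (Sp d)) = μ := by
    refine ext_of_forall_integral_eq_of_IsFiniteMeasure fun φ => ?_
    exact tendsto_nhds_unique ((h' φ).mono_left (hm N' subset_union_right))
      ((h φ).mono_left (hm N subset_union_left))
  exact Subtype.ext key

end InitialTrace

end FracPME

/-! ### Initial trace of the weak solution -/

theorem theorem3p3 (d : ℕ) [NeZero d] (s m γ γ₀ : ℝ)
    (hs0 : 0 < s) (hs1 : s < 1) (hd : 2 * s < d) (hm : 1 < m)
    (hγ0 : 0 ≤ γ) (hγs : γ < 2 * s) (hγd : γ ≤ d - 2 * s)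
    (hγ₀0 : 0 ≤ γ₀) (hγ₀γ : γ₀ ≤ γ)
    (ρ : EuclideanSpace ℝ (Fin d) → ℝ) (hρm : AEMeasurable ρ volume)
    (hρ : FracPME.WeightBounds γ₀ γ ρ)
    (u : EuclideanSpace ℝ (Fin d) → ℝ → ℝ)
    (hu : FracPME.IsWeakSolution s m ρ u)
    (hb : FracPME.BoundedAwayFromZero u ∨ FracPME.PowerTimeIntegrable m ρ u) :
    ∃ μ : FiniteMeasure (EuclideanSpace ℝ (Fin d)),
      FracPME.IsInitialTrace ρ u μ ∧
      (∀ ν : FiniteMeasure (EuclideanSpace ℝ (Fin d)), FracPME.IsInitialTrace ρ u ν → ν = μ) ∧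
      ∀ᵐ t ∂(volume.restrict (Ioi (0 : ℝ))),
        (μ : Measure (EuclideanSpace ℝ (Fin d))) univ =
          ∫⁻ x, ENNReal.ofReal (u x t) ∂(FracPME.weightMeasure ρ) := by
  obtain ⟨K, hK0, hK⟩ := hρ.rpow_le hγ0 hγ₀0
  have hflow := hu.isDiffusionFlow hs0 hs1 hd hm (by linarith) hρm hK0 hK hb
  obtain ⟨μ, N, hN, hlim, hmass⟩ := hflow.exists_initial_trace hs0 hs1 hd hγ0 hγs
  obtain ⟨M, hM⟩ := hu.ae_good
  have hgood := (ae_restrict_iff' measurableSet_Ioi).1 hM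
  rw [ae_iff] at hgood
  set N' : Set ℝ := _ with hN'def
  have hN' : volume N' = 0 := hgood
  -- Outside `N'` the slice `u(·,t)` is measurable, nonnegative and integrable, so integrals against
  -- the flow measure are the weighted integrals of `u`.
  have hgood' : ∀ t ∈ Ioi (0 : ℝ) \ (N ∪ N'), _ := fun t ht =>
    not_not.1 (fun hn => ht.2 (Or.inr hn)) ht.1
  have htrace : FracPME.IsInitialTrace ρ u μ := by
    refine ⟨N ∪ N', measure_union_null hN hN', fun t ht => ?_, fun φ => ?_⟩
    · have := hgood' t ht
      exact ⟨this.1, this.2.2.trans_lt ENNReal.coe_lt_top⟩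
    · refine ((hlim φ).mono_left
        (nhdsWithin_mono _ (sdiff_subset_sdiff_right subset_union_left))).congr' ?_
      refine eventually_nhdsWithin_of_forall fun t ht => ?_
      have := hgood' t ht
      exact FracPME.integral_flowMeasure this.1 this.2.1 φ
  refine ⟨μ, htrace, fun ν hν => htrace.unique hν, ?_⟩
  rw [ae_restrict_iff' measurableSet_Ioi]
  filter_upwards [measure_eq_zero_iff_ae_notMem.1 hN] with t htN ht
  -- Only `N` has to be avoided: the total mass of the flow measure has this form at every time, by
  -- its definition.
  rw [← hmass t ⟨ht, htN⟩, FracPME.flowMeasure_univ]
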